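/- Conventions. A monoid is a commutative semigroup $M$ with identity and more than one element in which every nonzero element is cancellative. Here $z(M)=\{z\in M\mid zx=z\text{ for all }x\in M\}$ is its set of zero elements ($z(M)$ has at most one element and may be empty), and an element is nonzero if it is not in $z(M)$. An integral domain is regarded as a monoid under multiplication. Let $Q$ be the quotient monoid of $M$ (all fractions with nonzero denominators). For $Y\subseteq Q$ put $Y^{-1}=\{q\in Q\mid qY\subseteq M\}$. For $X\subseteq M$ define: - $X_s=XM\cup z(M)$. - If $M\neq Q$, then $X_v=(X^{-1})^{-1}$; if $M=Q$, then $X_v=z(M)$ for $X\subseteq z(M)$ and $X_v=M$ otherwise. - $X_t=\bigcup\{E_v\mid E\subseteq X\text{ finite}\}$. - $X_w=\{x\in M\mid xF\subseteq X_s\text{ and }F_t=M\text{ for some }F\subseteq M\}$. A $w$-ideal is a set $X\subseteq M$ with $X_w=X$. It is $w$-finitely generated if $X=E_w$ for some finite $E\subseteq X$, and nontrivial if $z(M)\subsetneq X$. A set $X\subseteq M$ is radical if $X=\{x\in M\mid x^n\in X\text{ for some }n\geq 1\}$. A principal ideal of $M$ is a set $AM\cup z(M)$ with $A\subseteq M$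 and $|A|\leq 1$. The monoid $M$ is - a $w$-SP-monoid if every $w$-ideal of $M$ has the form $(I_1\cdots I_n)_w$ with $n\geq 1$ and radical $w$-ideals $I_1,\dots,I_n$ of $M$; - a $w$-Bézout monoid if every nontrivial $w$-finitely generated $w$-ideal of $M$ is principal; - radical factorial if every principal ideal of $M$ is a finite product of radical principal ideals of $M$. An integral domain is called a $w$-SP-domain, a $w$-Bézout domain or radical factorial if its multiplicative monoid has the corresponding property. A grading monoid is a cancellative commutative monoid $H$ with more than one element, written additively, such that $nx=ny$ implies $x=y$ for all $x,y\in H$ and all $n\geq 1$. For a grading monoid $H$ and an integral domain $R$, the monoid ring $R[H]$ is an integral domain. **Proposition 6.4.** Let $R$ be an integral domain, $H$ a grading monoid, $K$ a field of quotients of $R$ and $G$ a quotient group of $H$. 1. $R[H]$ is a $w$-SP-domain if and only if $R$ is a $w$-SP-domain, $H$ is a $w$-SP-monoid and $K[G]$ is radical factorial. 2. $R[H]$ is a $w$-Bézout domain and a $w$-SP-domain if and only if $R$ is a $w$-Bézout domain and a $w$-SP-domain, $H$ is a $w$-Bézout monoid and a $w$-SP-monoid, and $K[G]$ is radical factorial.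 -/

import Mathlib

open scoped Pointwise

namespace WSP

/-! ### Monoids, possibly with a zero element -/

/-- The set `z(H)` of zero elements of a commutative monoid `H`
(it has at most one element, and it is empty if `H` has no zero element). -/
def zeroElts (H : Type*) [CommMonoid H] : Set H := {z | ∀ x : H, z * x = z}

/-- The standing convention on monoids: a commutative monoid with more than one element in which
every nonzero element is cancellative. -/
class IsCancelOffZero (H : Type*) [CommMonoid H] : Prop extends Nontrivial H where
  mul_left_cancel_of_notMem : ∀ a : H, a ∉ zeroElts H → ∀ b c : H, a * b = a * c → b = c

/-- A nontrivial cancellative commutative monoid satisfies the convention. -/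
instance {H : Type*} [CancelCommMonoid H] [Nontrivial H] : IsCancelOffZero H where
  mul_left_cancel_of_notMem _ _ _ _ h := mul_left_cancel h

/-- The multiplicative monoid of an integral domain satisfies the convention. -/
instance {R : Type*} [CommRing R] [IsDomain R] : IsCancelOffZero R where
  mul_left_cancel_of_notMem a ha b c h := by
    refine mul_left_cancel₀ (a := a) ?_ h
    rintro rfl
    exact ha fun x => zero_mul x

section QuotientMonoid

variable (H : Type*) [CommMonoid H] [IsCancelOffZero H]

/-- The multiplicative set of nonzero elements of `H`. -/
def nonzeroElts : Submonoid H where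
  carrier := {x | x ∉ zeroElts H}
  one_mem' h := by
    obtain ⟨x, y, hxy⟩ := exists_pair_ne H
    exact hxy (by rw [← one_mul x, ← one_mul y, h x, h y])
  mul_mem' {a b} ha hb hab := by
    obtain ⟨x, y, hxy⟩ := exists_pair_ne H
    refine hxy ?_
    have key : ∀ z : H, z = 1 := fun z => by
      have h1 : a * (b * z) = a * b := by rw [← mul_assoc]; exact hab z
      have h2 : b * z = b := IsCancelOffZero.mul_left_cancel_of_notMem a ha _ _ h1
      exact IsCancelOffZero.mul_left_cancel_of_notMem b hb _ _ (by rw [h2, mul_one])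
    rw [key x, key y]

/-- The quotient monoid of `H`: all fractions with nonzero denominators. -/
abbrev QuotMonoid : Type _ := Localization (nonzeroElts H)

/-- The canonical embedding of `H` into its quotient monoid. -/
def toQuot : H →* QuotMonoid H := (Localization.monoidOf (nonzeroElts H)).toMonoidHom

end QuotientMonoid

section Systems

variable {H : Type*} [CommMonoid H] [IsCancelOffZero H]

/-! ### The `s`-, `v`-, `t`- and `w`-system -/

/-- The `s`-system: `X_s = XH ∪ z(H)`. -/
def sSys (X : Set H) : Set H := X * Set.univ ∪ zeroElts H

/-- `Y⁻¹ = {z | zY ⊆ H}`, for a subset `Y` of the quotient monoid of `H`. -/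
def fracInv (Y : Set (QuotMonoid H)) : Set (QuotMonoid H) :=
  {z | ∀ y ∈ Y, z * y ∈ Set.range (toQuot H)}

open Classical in
/-- The `v`-system. If `H` differs from its quotient monoid, then `X_v = (X⁻¹)⁻¹`; otherwise
`X_v = z(H)` for `X ⊆ z(H)` and `X_v = H` for all other `X`. -/
noncomputable def vSys (X : Set H) : Set H :=
  if Function.Surjective (toQuot H) then
    (if X ⊆ zeroElts H then zeroElts H else Set.univ)
  else toQuot H ⁻¹' fracInv (fracInv (toQuot H '' X))

/-- The `t`-system: `X_t` is the union of all `E_v`, where `E` is a finite subset of `X`. -/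
def tSys (X : Set H) : Set H := {x | ∃ E : Set H, E ⊆ X ∧ E.Finite ∧ x ∈ vSys E}

/-- The `p`-modularization of `r`: it maps `X` to the set of all `x` such that `xF ⊆ X_p` for some
`F ⊆ H` with `F_r = H`. -/
def modularization (p r : Set H → Set H) (X : Set H) : Set H :=
  {x | ∃ F : Set H, (∀ f ∈ F, x * f ∈ p X) ∧ r F = Set.univ}

/-- The `w`-system: the `s`-modularization of the `t`-system. -/
def wSys : Set H → Set H := modularization sSys tSys

end Systems

/-! ### Notions depending on an ideal system `r` -/

section Notions

variable {H : Type*} [CommMonoid H]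

/-- `X` is radical: it equals `{x | x ^ n ∈ X for some n ≥ 1}`. -/
def IsRadicalSet (X : Set H) : Prop := {x : H | ∃ n : ℕ, 1 ≤ n ∧ x ^ n ∈ X} = X

/-- `J` is a principal ideal: an `s`-ideal generated by at most one element. -/
def IsPrincipalIdeal (J : Set H) : Prop :=
  ∃ A : Set H, A.Subsingleton ∧ J = A * Set.univ ∪ zeroElts H

/-- Every principal ideal of `H` is a (nonempty) finite product of radical principal ideals. -/
def IsRadicalFactorial (H : Type*) [CommMonoid H] : Prop :=
  ∀ J : Set H, IsPrincipalIdeal J →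
    ∃ L : List (Set H), L ≠ [] ∧ (∀ I ∈ L, IsPrincipalIdeal I ∧ IsRadicalSet I) ∧ J = L.prod

/-- `X` is an `r`-ideal. -/
def IsRIdeal (r : Set H → Set H) (X : Set H) : Prop := r X = X

/-- `H` is an `r`-SP-monoid: every `r`-ideal is a finite `r`-product of radical `r`-ideals. -/
def IsSPMonoid (r : Set H → Set H) : Prop :=
  ∀ J : Set H, IsRIdeal r J →
    ∃ L : List (Set H), L ≠ [] ∧ (∀ I ∈ L, IsRIdeal r I ∧ IsRadicalSet I) ∧ J = r L.prod

/-- `I` is an `r`-finitely generated `r`-ideal. -/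
def IsRFinGen (r : Set H → Set H) (I : Set H) : Prop :=
  IsRIdeal r I ∧ ∃ E : Set H, E ⊆ I ∧ E.Finite ∧ I = r E

/-- `H` is an `r`-Bézout monoid: every nontrivial `r`-finitely generated `r`-ideal is principal. -/
def IsBezoutMonoid (r : Set H → Set H) : Prop :=
  ∀ I : Set H, IsRFinGen r I → zeroElts H ⊂ I → IsPrincipalIdeal I

end Notions

/-- `H` is a `w`-SP-monoid (for a domain, viewed as a multiplicative monoid: a `w`-SP-domain). -/
def IsWSP (H : Type*) [CommMonoid H] [IsCancelOffZero H] : Prop :=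
  IsSPMonoid (wSys : Set H → Set H)

/-- `H` is a `w`-Bézout monoid (for a domain, viewed as a multiplicative monoid: a
`w`-Bézout domain). -/
def IsWBezout (H : Type*) [CommMonoid H] [IsCancelOffZero H] : Prop :=
  IsBezoutMonoid (wSys : Set H → Set H)

/-! ### Monoid rings over grading monoids are domains -/

/-- A cancellative torsion-free commutative monoid has unique sums. -/
theorem uniqueSums_of_grading (H : Type*) [AddCancelCommMonoid H] [IsAddTorsionFree H] :
    UniqueSums H where
  uniqueAdd_of_nonempty {A B} hA hB := by
    classical
    set S : AddSubmonoid H := AddSubmonoid.closure (↑(A ∪ B) : Set H) with hS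
    have hAS : ∀ a ∈ A, a ∈ S := fun a ha =>
      AddSubmonoid.subset_closure (by simp [ha])
    have hBS : ∀ b ∈ B, b ∈ S := fun b hb =>
      AddSubmonoid.subset_closure (by simp [hb])
    have hfg : AddMonoid.FG S :=
      (AddMonoid.fg_iff_addSubmonoid_fg S).2 ⟨A ∪ B, rfl⟩
    have htf : IsAddTorsionFree S :=
      ⟨fun n hn a b hab => Subtype.ext
        (IsAddTorsionFree.nsmul_right_injective hn (congrArg Subtype.val hab))⟩
    let _ : AddCancelCommMonoid S :=
      { (inferInstance : AddCommMonoid S) with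
        add_left_cancel := fun a b c h =>
          Subtype.ext (add_left_cancel (congrArg Subtype.val h)) }
    have hts : TwoUniqueSums S := @AffineAddMonoid.to_twoUniqueSums S _ hfg htf
    have hu : UniqueSums S := inferInstance
    obtain ⟨a0, ha0⟩ := hA
    obtain ⟨b0, hb0⟩ := hB
    obtain ⟨a, ha, b, hb, h⟩ := hu.uniqueAdd_of_nonempty
      (A := A.subtype (· ∈ S)) (B := B.subtype (· ∈ S))
      ⟨⟨a0, hAS a0 ha0⟩, by simpa using ha0⟩ ⟨⟨b0, hBS b0 hb0⟩, by simpa using hb0⟩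
    refine ⟨a, by simpa using ha, b, by simpa using hb, fun x y hx hy hxy => ?_⟩
    have := @h ⟨x, hAS x hx⟩ ⟨y, hBS y hy⟩ (by simpa using hx) (by simpa using hy)
      (Subtype.ext hxy)
    exact ⟨congrArg Subtype.val this.1, congrArg Subtype.val this.2⟩

/-- The monoid ring of a grading monoid over a domain is a domain. -/
instance isDomain_monoidRing (R H : Type*) [CommRing R] [IsDomain R] [AddCancelCommMonoid H]
    [IsAddTorsionFree H] : IsDomain (AddMonoidAlgebra R H) :=
  have := uniqueSums_of_grading H
  NoZeroDivisors.to_isDomain _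

end WSP

/-! The proof replaces ideals by divisors. Call a family `V` of `ℕ∞`-valued valuations a divisor
family if it detects divisibility, if the functions `v ↦ min v(T)` (`T` a finite nonempty set of
nonzero elements) are closed under truncated subtraction and under `min(·, 1)`, and if each nonzero
element has bounded values. Such functions stand for the `w`-closures of finite sets, and the core
result is that a monoid is a `w`-SP-monoid exactly when it has a divisor family.

Given a family, each nontrivial `w`-ideal is the `w`-closure of a product of radical layers, because
a bounded `x` equals the sum of the terms `min (x - k) 1` (`DivFamily.isWSP`). Conversely, in a
`w`-SP-monoid consider the primes that contain no finite set `E` with `E⁻¹ = M`. A minimal prime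
over an element is locally principal, and no such prime lies strictly above it
(`IsWSP.subset_of_isMinOver`), so these primes carry discrete valuations. Factoring `aM` into
radical `w`-ideals then writes `v a` as a sum of representable functions bounded by one
(`IsWSP.divFamily`).

The group ring `K[G]` has greatest common divisors that are stable under multiplication
(`hasSG_groupRing`). For monoids of that kind, radical factoriality produces a divisor family
(`HasSG.divFamily`). Conversely, `K[G]` is the localization of `R[H]` at the monomials, and gcds in
`K[G]` of finite subsets of `R[H]` turn a divisor family of `R[H]` into radical factorizations
(`DivFamily.exists_radElt_factorization`).

It remains to move divisor families. Those of `R[H]` restrict to the constants and to the exponents.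
In the other direction, the Gauss extensions of valuations of `R` and of `H`, together with the
valuations of `K[G]`, form a divisor family of `R[H]` (`DivFamily.monoidRing`). In these terms
`w`-Bézout says that the minimum of the values of two elements is again given by an element, and
this property follows the same restrictions and extensions. -/

set_option linter.unusedSectionVars false

namespace WSP

/-! ### Zero elements, cancellation and divisibility -/

section Zero

variable {M : Type*} [CommMonoid M] [IsCancelOffZero M] {a b c z : M}

theorem one_notMem_zeroElts : (1 : M) ∉ zeroElts M := (nonzeroElts M).one_mem

theorem mul_notMem_zeroElts (ha : a ∉ zeroElts M) (hb : b ∉ zeroElts M) : a * b ∉ zeroElts M :=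
  (nonzeroElts M).mul_mem ha hb

theorem mul_mem_zeroElts_left (hz : z ∈ zeroElts M) : z * a ∈ zeroElts M := by
  rwa [hz a]

theorem mul_mem_zeroElts_right (hz : z ∈ zeroElts M) : a * z ∈ zeroElts M := by
  rw [mul_comm]; exact mul_mem_zeroElts_left hz

theorem mul_mem_zeroElts_iff : a * b ∈ zeroElts M ↔ a ∈ zeroElts M ∨ b ∈ zeroElts M := by
  refine ⟨fun h => ?_, fun h => h.elim mul_mem_zeroElts_left mul_mem_zeroElts_right⟩
  by_contra! hn
  exact mul_notMem_zeroElts hn.1 hn.2 h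

theorem pow_notMem_zeroElts (ha : a ∉ zeroElts M) (n : ℕ) : a ^ n ∉ zeroElts M :=
  (nonzeroElts M).pow_mem ha n

theorem notMem_zeroElts_of_dvd (h : a ∣ b) (hb : b ∉ zeroElts M) : a ∉ zeroElts M := by
  obtain ⟨c, rfl⟩ := h
  exact fun ha => hb (mul_mem_zeroElts_left ha)

theorem dvd_of_mem_zeroElts (hz : z ∈ zeroElts M) : a ∣ z := ⟨z, by rw [mul_comm, hz a]⟩

theorem mem_zeroElts_of_dvd (h : a ∣ b) (ha : a ∈ zeroElts M) : b ∈ zeroElts M := by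
  obtain ⟨c, rfl⟩ := h
  exact mul_mem_zeroElts_left ha

theorem cancel (ha : a ∉ zeroElts M) (h : a * b = a * c) : b = c :=
  IsCancelOffZero.mul_left_cancel_of_notMem a ha _ _ h

theorem dvd_cancel (ha : a ∉ zeroElts M) (h : a * b ∣ a * c) : b ∣ c := by
  obtain ⟨d, hd⟩ := h
  exact ⟨d, cancel ha (by rw [hd, mul_assoc])⟩

theorem zeroElts_ring {R : Type*} [CommRing R] : zeroElts R = {0} := by
  ext x
  refine ⟨fun h => ?_, ?_⟩
  · have := h 0
    rw [mul_zero] at this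
    exact this.symm
  · rintro rfl x
    exact zero_mul x

theorem zeroElts_cancel {H : Type*} [CancelCommMonoid H] [Nontrivial H] : zeroElts H = ∅ := by
  refine Set.eq_empty_of_forall_notMem fun z hz => ?_
  obtain ⟨x, y, hxy⟩ := exists_pair_ne H
  exact hxy (mul_left_cancel ((hz x).trans (hz y).symm))

end Zero

/-! ### The `w`-system in terms of divisibility -/

section GV

variable {M : Type*} [CommMonoid M] [IsCancelOffZero M]

/-- A finite set `E` with `E⁻¹ = M`, expressed through divisibility in `M`. -/
def IsGV (E : Set M) : Prop :=
  (∃ e ∈ E, e ∉ zeroElts M) ∧ ∀ y b : M, (∀ e ∈ E, b ∣ y * e) → b ∣ y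

theorem toQuot_injective : Function.Injective (toQuot M) := by
  intro x y h
  obtain ⟨c, hc⟩ := (Localization.monoidOf (nonzeroElts M)).eq_iff_exists.1 h
  exact cancel c.2 hc

theorem exists_toQuot_mul (q : QuotMonoid M) :
    ∃ y b : M, b ∉ zeroElts M ∧ q * toQuot M b = toQuot M y := by
  obtain ⟨⟨y, b⟩, h⟩ := (Localization.monoidOf (nonzeroElts M)).surj q
  exact ⟨y, b, b.2, h⟩

theorem exists_mul_toQuot (y : M) {b : M} (hb : b ∉ zeroElts M) :
    ∃ q : QuotMonoid M, q * toQuot M b = toQuot M y :=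
  ⟨(Localization.monoidOf (nonzeroElts M)).mk' y ⟨b, hb⟩,
    (Localization.monoidOf (nonzeroElts M)).mk'_spec y ⟨b, hb⟩⟩

theorem toQuot_cancel {b : M} (hb : b ∉ zeroElts M) {p q : QuotMonoid M}
    (h : p * toQuot M b = q * toQuot M b) : p = q :=
  ((Localization.monoidOf (nonzeroElts M)).map_units ⟨b, hb⟩).mul_right_cancel h

theorem mem_range_iff_dvd {q : QuotMonoid M} {y b e : M} (hb : b ∉ zeroElts M)
    (h : q * toQuot M b = toQuot M y) : q * toQuot M e ∈ Set.range (toQuot M) ↔ b ∣ y * e := by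
  have key : q * toQuot M e * toQuot M b = toQuot M (y * e) := by
    rw [map_mul, ← h, mul_right_comm]
  refine ⟨?_, ?_⟩
  · rintro ⟨c, hc⟩
    refine ⟨c, toQuot_injective ?_⟩
    rw [← key, ← hc, map_mul, mul_comm]
  · rintro ⟨c, hc⟩
    refine ⟨c, toQuot_cancel hb ?_⟩
    rw [key, hc, map_mul, mul_comm]

theorem vSys_eq_univ {E : Set M} (hE : IsGV E) : vSys E = Set.univ := by
  obtain ⟨⟨e, he, hez⟩, hE⟩ := hE
  unfold vSys
  split_ifs with h1 h2
  · exact absurd (h2 he) hez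
  · rfl
  · refine Set.eq_univ_of_forall fun x q hq => ?_
    obtain ⟨y, b, hb, hyb⟩ := exists_toQuot_mul q
    obtain ⟨c, rfl⟩ := hE y b fun e he =>
      (mem_range_iff_dvd hb hyb).1 (hq _ (Set.mem_image_of_mem _ he))
    have : q = toQuot M c := toQuot_cancel hb (by rw [hyb, map_mul, mul_comm])
    exact ⟨x * c, by rw [this, map_mul]⟩

/-- If `M` is its own quotient monoid, every nonzero element is a unit and divides everything.
Otherwise `1 ∈ E_v` says `E⁻¹ ⊆ M`, which is tested on the fraction `y / b`. -/
theorem isGV_of_one_mem_vSys {E : Set M} (h1 : (1 : M) ∈ vSys E) : IsGV E := by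
  unfold vSys at h1
  split_ifs at h1 with hs hE
  · exact absurd h1 one_notMem_zeroElts
  · rw [Set.not_subset] at hE
    refine ⟨hE, fun y b hb => ?_⟩
    by_cases hbz : b ∈ zeroElts M
    · obtain ⟨e, he, hez⟩ := hE
      have := mem_zeroElts_of_dvd (hb e he) hbz
      exact dvd_of_mem_zeroElts ((mul_mem_zeroElts_iff.1 this).resolve_right hez)
    · obtain ⟨q, hq⟩ := exists_mul_toQuot 1 hbz
      obtain ⟨c, rfl⟩ := hs q
      rw [← map_mul] at hq
      have := toQuot_injective hq
      exact ⟨c * y, by rw [← mul_assoc, mul_comm b, this, one_mul]⟩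
  -- A set of zero elements would have all of `Q` as its inverse, and then `Q ⊆ M`.
  · have h : ∃ e ∈ E, e ∉ zeroElts M := by
      by_contra! hn
      refine hs fun q => ?_
      have := h1 q (by
        rintro _ ⟨e, he, rfl⟩
        obtain ⟨y, b, hb, hyb⟩ := exists_toQuot_mul q
        exact (mem_range_iff_dvd hb hyb).2
          (dvd_of_mem_zeroElts (mul_mem_zeroElts_right (hn e he))))
      rwa [map_one, one_mul] at this
    refine ⟨h, fun y b hb => ?_⟩
    by_cases hbz : b ∈ zeroElts M
    · obtain ⟨e, he, hez⟩ := h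
      have := mem_zeroElts_of_dvd (hb e he) hbz
      exact dvd_of_mem_zeroElts ((mul_mem_zeroElts_iff.1 this).resolve_right hez)
    · obtain ⟨q, hq⟩ := exists_mul_toQuot y hbz
      have := h1 q (by
        rintro _ ⟨e, he, rfl⟩
        exact (mem_range_iff_dvd hbz hq).2 (hb e he))
      rw [mul_comm] at this
      have := (mem_range_iff_dvd hbz hq).1 this
      rwa [mul_one] at this

theorem tSys_eq_univ_iff {F : Set M} :
    tSys F = Set.univ ↔ ∃ E ⊆ F, E.Finite ∧ IsGV E := by
  refine ⟨fun h => ?_, ?_⟩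
  · obtain ⟨E, hE, hf, h1⟩ : (1 : M) ∈ tSys F := h ▸ Set.mem_univ _
    exact ⟨E, hE, hf, isGV_of_one_mem_vSys h1⟩
  · rintro ⟨E, hE, hf, h⟩
    exact Set.eq_univ_of_forall fun x => ⟨E, hE, hf, vSys_eq_univ h ▸ Set.mem_univ _⟩

/-- `F_t = M` is already witnessed by a finite subset of `F`, the one whose `v`-closure contains
`1`. -/
theorem mem_wSys_iff {X : Set M} {x : M} :
    x ∈ wSys X ↔ ∃ E : Set M, E.Finite ∧ IsGV E ∧ ∀ e ∈ E, x * e ∈ sSys X := by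
  refine ⟨?_, ?_⟩
  · rintro ⟨F, hF, h⟩
    obtain ⟨E, hE, hf, hgv⟩ := tSys_eq_univ_iff.1 h
    exact ⟨E, hf, hgv, fun e he => hF e (hE he)⟩
  · rintro ⟨E, hf, hgv, h⟩
    exact ⟨E, h, tSys_eq_univ_iff.2 ⟨E, subset_rfl, hf, hgv⟩⟩

theorem mem_sSys_iff {X : Set M} {x : M} :
    x ∈ sSys X ↔ (∃ y ∈ X, y ∣ x) ∨ x ∈ zeroElts M := by
  simp only [sSys, Set.mem_union, Set.mem_mul, Set.mem_univ, true_and]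
  refine or_congr_left ?_
  refine exists_congr fun y => and_congr_right fun _ => ?_
  exact ⟨fun ⟨c, h⟩ => ⟨c, h.symm⟩, fun ⟨c, h⟩ => ⟨c, h.symm⟩⟩

theorem isGV_singleton_one : IsGV ({1} : Set M) :=
  ⟨⟨1, rfl, one_notMem_zeroElts⟩, fun y b h => by simpa using h⟩

theorem IsGV.mul {E F : Set M} (hE : IsGV E) (hF : IsGV F) : IsGV (E * F) := by
  obtain ⟨⟨e, he, hez⟩, hE⟩ := hE
  obtain ⟨⟨f, hf, hfz⟩, hF⟩ := hF
  refine ⟨⟨e * f, Set.mul_mem_mul he hf, mul_notMem_zeroElts hez hfz⟩, fun y b h => ?_⟩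
  refine hE _ _ fun e he => hF _ _ fun f hf => ?_
  rw [mul_assoc]
  exact h _ (Set.mul_mem_mul he hf)

theorem zeroElts_subset_wSys {X : Set M} : zeroElts M ⊆ wSys X := fun _ hx =>
  mem_wSys_iff.2 ⟨{1}, Set.finite_singleton _, isGV_singleton_one, fun _ _ =>
    Or.inr (mul_mem_zeroElts_left hx)⟩

theorem subset_wSys {X : Set M} : X ⊆ wSys X := fun x hx =>
  mem_wSys_iff.2 ⟨{1}, Set.finite_singleton _, isGV_singleton_one, fun _ _ =>
    mem_sSys_iff.2 (Or.inl ⟨x, hx, dvd_mul_right _ _⟩)⟩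

theorem wSys_mono {X Y : Set M} (h : X ⊆ Y) : wSys X ⊆ wSys Y := fun x hx => by
  obtain ⟨E, hf, hE, hx⟩ := mem_wSys_iff.1 hx
  refine mem_wSys_iff.2 ⟨E, hf, hE, fun e he => mem_sSys_iff.2 ?_⟩
  exact (mem_sSys_iff.1 (hx e he)).imp_left fun ⟨y, hy, hd⟩ => ⟨y, h hy, hd⟩

theorem mul_mem_wSys {X : Set M} {x : M} (hx : x ∈ wSys X) (y : M) : x * y ∈ wSys X := by
  obtain ⟨E, hf, hE, hx⟩ := mem_wSys_iff.1 hx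
  refine mem_wSys_iff.2 ⟨E, hf, hE, fun e he => mem_sSys_iff.2 ?_⟩
  rw [mul_right_comm]
  exact (mem_sSys_iff.1 (hx e he)).imp (fun ⟨y, hy, hd⟩ => ⟨y, hy, hd.mul_right _⟩)
    mul_mem_zeroElts_left

/-- To be a `w`-ideal it suffices to be a semigroup ideal, to contain the zero elements, and to be
closed under the defining condition of the `w`-system. -/
theorem isRIdeal_wSys_of {X : Set M} (hz : zeroElts M ⊆ X) (hX : ∀ x ∈ X, ∀ y, x * y ∈ X)
    (h : ∀ E : Set M, E.Finite → IsGV E → ∀ x, (∀ e ∈ E, x * e ∈ X) → x ∈ X) :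
    IsRIdeal wSys X := by
  refine Set.Subset.antisymm (fun x hx => ?_) subset_wSys
  obtain ⟨E, hf, hE, hx⟩ := mem_wSys_iff.1 hx
  refine h E hf hE x fun e he => ?_
  obtain ⟨y, hy, c, hc⟩ | h0 := mem_sSys_iff.1 (hx e he)
  · rw [hc]; exact hX y hy c
  · exact hz h0

theorem IsRIdeal.mul_mem {X : Set M} (h : IsRIdeal wSys X) {x : M} (hx : x ∈ X) (y : M) :
    x * y ∈ X := by
  rw [← show wSys X = X from h] at hx ⊢
  exact mul_mem_wSys hx y

theorem IsRIdeal.zero_subset {X : Set M} (h : IsRIdeal wSys X) : zeroElts M ⊆ X := by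
  rw [← show wSys X = X from h]
  exact zeroElts_subset_wSys

theorem isRIdeal_zeroElts : IsRIdeal wSys (zeroElts M) :=
  isRIdeal_wSys_of subset_rfl (fun _ hx _ => mul_mem_zeroElts_left hx) fun E _ hE x hx => by
    obtain ⟨⟨e, he, hez⟩, -⟩ := hE
    exact (mul_mem_zeroElts_iff.1 (hx e he)).resolve_right hez

end GV

/-! ### Valuation families and the calculus of representable divisors -/

section DivFamily

variable {M : Type*} [CommMonoid M] [IsCancelOffZero M]

/-- A function on a family of valuations that is the minimum over a nonempty finite set of nonzero
elements. -/
def Rep (V : Set (M → ℕ∞)) (φ : (M → ℕ∞) → ℕ∞) : Prop :=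
  ∃ T : Finset M, T.Nonempty ∧ (∀ t ∈ T, t ∉ zeroElts M) ∧ ∀ v ∈ V, T.inf v = φ v

/-- A family of discrete valuations on `M` that defines divisibility, and for which the divisors
represented by finite sets are closed under truncated subtraction. -/
structure PreDivFamily (V : Set (M → ℕ∞)) : Prop where
  map_mul : ∀ v ∈ V, ∀ x y, v (x * y) = v x + v y
  eq_top : ∀ v ∈ V, ∀ x, v x = ⊤ ↔ x ∈ zeroElts M
  dvd_of_le : ∀ a b, a ∉ zeroElts M → (∀ v ∈ V, v a ≤ v b) → a ∣ b
  rep_tsub : ∀ a b, a ∉ zeroElts M → b ∉ zeroElts M → Rep V fun v => v a - v b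

/-- A family as in `PreDivFamily` such that in addition the support of a divisor is represented by
a finite set, and every nonzero element has bounded values. -/
structure DivFamily (V : Set (M → ℕ∞)) : Prop extends PreDivFamily V where
  rep_min_one : ∀ a, a ∉ zeroElts M → Rep V fun v => min (v a) 1
  bounded : ∀ a, a ∉ zeroElts M → ∃ n : ℕ, ∀ v ∈ V, v a ≤ n

namespace Rep

variable {V : Set (M → ℕ∞)} {φ ψ : (M → ℕ∞) → ℕ∞}

theorem congr (h : Rep V φ) (he : ∀ v ∈ V, φ v = ψ v) : Rep V ψ := by
  obtain ⟨T, hT, h0, h⟩ := h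
  exact ⟨T, hT, h0, fun v hv => (h v hv).trans (he v hv)⟩

theorem eval {a : M} (ha : a ∉ zeroElts M) : Rep V fun v => v a :=
  ⟨{a}, by simp, by simpa using ha, by simp⟩

theorem min (hφ : Rep V φ) (hψ : Rep V ψ) : Rep V fun v => Min.min (φ v) (ψ v) := by
  classical
  obtain ⟨T, hT, h0, h⟩ := hφ
  obtain ⟨T', hT', h0', h'⟩ := hψ
  refine ⟨T ∪ T', hT.inl, ?_, fun v hv => ?_⟩
  · intro t ht
    exact (Finset.mem_union.1 ht).elim (h0 t) (h0' t)
  · rw [Finset.inf_union, h v hv, h' v hv]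

/-- Induction principle: a property of divisors that is stable under minima and holds for
the values of elements holds for every divisor. -/
theorem induction {P : ((M → ℕ∞) → ℕ∞) → Prop} (hφ : Rep V φ)
    (hcongr : ∀ φ ψ, (∀ v ∈ V, φ v = ψ v) → P φ → P ψ)
    (heval : ∀ a, a ∉ zeroElts M → P fun v => v a)
    (hmin : ∀ φ ψ, Rep V φ → Rep V ψ → P φ → P ψ → P fun v => Min.min (φ v) (ψ v)) : P φ := by
  classical
  obtain ⟨T, hT, h0, h⟩ := hφ
  refine hcongr (fun v => T.inf v) φ h ?_
  clear h
  induction hT using Finset.Nonempty.cons_induction with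
  | singleton a => simpa using heval a (h0 a (by simp))
  | cons a s ha hs ih =>
    have h0' : ∀ t ∈ s, t ∉ zeroElts M := fun t ht => h0 t (by simp [ht])
    have := hmin _ _ (Rep.eval (h0 a (by simp))) ⟨s, hs, h0', fun v _ => rfl⟩
      (heval a (h0 a (by simp))) (ih h0')
    simpa using this

end Rep

namespace PreDivFamily

variable {V : Set (M → ℕ∞)} (hV : PreDivFamily V) {φ ψ : (M → ℕ∞) → ℕ∞}
include hV

theorem map_one {v : M → ℕ∞} (hv : v ∈ V) : v 1 = 0 := by
  have h := hV.map_mul v hv 1 1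
  rw [mul_one] at h
  have ht : v 1 ≠ ⊤ := fun h => one_notMem_zeroElts ((hV.eq_top v hv 1).1 h)
  lift v 1 to ℕ using ht with n hn
  norm_cast at h ⊢
  omega

theorem ne_top {v : M → ℕ∞} (hv : v ∈ V) {a : M} (ha : a ∉ zeroElts M) : v a ≠ ⊤ :=
  fun h => ha ((hV.eq_top v hv a).1 h)

theorem le_of_dvd {v : M → ℕ∞} (hv : v ∈ V) {a b : M} (h : a ∣ b) : v a ≤ v b := by
  obtain ⟨c, rfl⟩ := h
  rw [hV.map_mul v hv]
  exact le_self_add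

theorem map_pow {v : M → ℕ∞} (hv : v ∈ V) (a : M) (n : ℕ) : v (a ^ n) = n * v a := by
  induction n with
  | zero => simpa using hV.map_one hv
  | succ n ih => rw [pow_succ, hV.map_mul v hv, ih]; push_cast; ring

theorem rep_zero : Rep V fun _ => 0 :=
  (Rep.eval one_notMem_zeroElts).congr fun _ hv => hV.map_one hv

/-- Addition distributes over minima in both arguments, so the claim reduces to products of two
elements. -/
theorem rep_add (hφ : Rep V φ) (hψ : Rep V ψ) : Rep V fun v => φ v + ψ v := by
  refine hφ.induction (P := fun φ => Rep V fun v => φ v + ψ v) ?_ ?_ ?_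
  · intro φ φ' h h'
    exact h'.congr fun v hv => by rw [h v hv]
  · intro a ha
    refine hψ.induction (P := fun ψ => Rep V fun v => v a + ψ v) ?_ ?_ ?_
    · intro φ φ' h h'
      exact h'.congr fun v hv => by rw [h v hv]
    · intro b hb
      exact (Rep.eval (mul_notMem_zeroElts ha hb)).congr fun v hv => hV.map_mul v hv a b
    · intro φ ψ _ _ h h'
      exact (h.min h').congr fun v hv => min_add_add_left _ _ _
  · intro φ φ' _ _ h h'
    exact (h.min h').congr fun v hv => min_add_add_right _ _ _

theorem rep_max (hφ : Rep V φ) (hψ : Rep V ψ) : Rep V fun v => max (φ v) (ψ v) := by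
  refine hφ.induction (P := fun φ => Rep V fun v => max (φ v) (ψ v)) ?_ ?_ ?_
  · intro φ φ' h h'
    exact h'.congr fun v hv => by rw [h v hv]
  · intro a ha
    refine hψ.induction (P := fun ψ => Rep V fun v => max (v a) (ψ v)) ?_ ?_ ?_
    · intro φ φ' h h'
      exact h'.congr fun v hv => by rw [h v hv]
    · intro b hb
      -- The maximum of `x` and `y` is `(x - y) + y`.
      refine (hV.rep_add (hV.rep_tsub a b ha hb) (Rep.eval hb)).congr fun v hv => ?_
      exact tsub_add_eq_max
    · intro φ ψ _ _ h h'
      exact (h.min h').congr fun v hv => (max_min_distrib_left _ _ _).symm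
  · intro φ φ' _ _ h h'
    exact (h.min h').congr fun v hv => (max_min_distrib_right _ _ _).symm

/-- Subtraction is antitone in its second argument and turns minima there into maxima, which is why
`rep_max` is needed first. -/
theorem rep_sub (hφ : Rep V φ) (hψ : Rep V ψ) : Rep V fun v => φ v - ψ v := by
  refine hφ.induction (P := fun φ => Rep V fun v => φ v - ψ v) ?_ ?_ ?_
  · intro φ φ' h h'
    exact h'.congr fun v hv => by rw [h v hv]
  · intro a ha
    refine hψ.induction (P := fun ψ => Rep V fun v => v a - ψ v) ?_ ?_ ?_
    · intro φ φ' h h'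
      exact h'.congr fun v hv => by rw [h v hv]
    · intro b hb
      exact hV.rep_tsub a b ha hb
    · intro φ ψ _ _ h h'
      refine (hV.rep_max h h').congr fun v hv => ?_
      exact (antitone_const_tsub.map_min (f := fun x => v a - x)).symm
  · intro φ φ' _ _ h h'
    refine (h.min h').congr fun v hv => ?_
    have hm : Monotone fun x : ℕ∞ => x - ψ v := fun x y h => tsub_le_tsub_right h _
    exact hm.map_min.symm

end PreDivFamily

namespace DivFamily

variable {V : Set (M → ℕ∞)} (hV : DivFamily V) {φ ψ : (M → ℕ∞) → ℕ∞}
include hV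

theorem rep_minOne (hφ : Rep V φ) : Rep V fun v => min (φ v) 1 := by
  refine hφ.induction (P := fun φ => Rep V fun v => min (φ v) 1) ?_ ?_ ?_
  · intro φ φ' h h'
    exact h'.congr fun v hv => by rw [h v hv]
  · exact fun a ha => hV.rep_min_one a ha
  · intro φ φ' _ _ h h'
    refine (h.min h').congr fun v hv => ?_
    rw [min_assoc, min_left_comm 1, min_self, ← min_assoc]

theorem rep_bounded (hφ : Rep V φ) : ∃ n : ℕ, ∀ v ∈ V, φ v ≤ n := by
  obtain ⟨T, ⟨t, ht⟩, h0, h⟩ := hφ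
  obtain ⟨n, hn⟩ := hV.bounded t (h0 t ht)
  exact ⟨n, fun v hv => (h v hv).symm.trans_le ((Finset.inf_le ht).trans (hn v hv))⟩

theorem rep_sub_nat (hφ : Rep V φ) (k : ℕ) : Rep V fun v => φ v - k := by
  induction k with
  | zero => simpa using hφ
  | succ k ih =>
    -- The constant `1` need not be representable, but `x - 1 = x - min x 1`.
    refine (hV.rep_sub ih (hV.rep_minOne ih)).congr fun v hv => ?_
    rw [Nat.cast_succ, ← tsub_tsub]
    generalize φ v - k = x
    rcases le_total x 1 with h | h
    · rw [min_eq_left h, tsub_eq_zero_of_le h, tsub_eq_zero_of_le le_rfl]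
    · rw [min_eq_right h]

omit hV in
-- The `k`-th summand is `1` for `k < x` and `0` afterwards. This decomposition into layers of
-- height one is the source of all the radical factorizations.
theorem _root_.WSP.sum_min_sub_one (x : ℕ∞) {n : ℕ} (hx : x ≤ n) :
    ∑ k ∈ Finset.range n, min (x - k) 1 = x := by
  lift x to ℕ using ne_top_of_le_ne_top (ENat.natCast_ne_top n) hx
  norm_cast at hx
  have : ∀ m : ℕ, ∑ k ∈ Finset.range m, min (x - k) 1 = min x m := by
    intro m
    induction m with
    | zero => simp
    | succ m ih => rw [Finset.sum_range_succ, ih]; omega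
  have h := this n
  rw [min_eq_left hx] at h
  calc _ = ((∑ k ∈ Finset.range n, min (x - k) 1 : ℕ) : ℕ∞) := by push_cast; rfl
    _ = x := by rw [h]

/-- Values on a set of generators detect `IsGV`. -/
theorem isGV_of_inf_eq_zero {T : Finset M} (h0 : ∃ t ∈ T, t ∉ zeroElts M)
    (h : ∀ v ∈ V, T.inf v = 0) : IsGV (T : Set M) := by
  refine ⟨by simpa using h0, fun y b hb => ?_⟩
  by_cases hbz : b ∈ zeroElts M
  · obtain ⟨t, ht, htz⟩ := h0
    have := mem_zeroElts_of_dvd (hb t ht) hbz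
    exact dvd_of_mem_zeroElts ((mul_mem_zeroElts_iff.1 this).resolve_right htz)
  · refine hV.dvd_of_le b y hbz fun v hv => ?_
    obtain ⟨t, ht⟩ := h0
    obtain ⟨t, ht, hte⟩ := Finset.exists_mem_eq_inf T ⟨t, ht.1⟩ v
    have := hV.le_of_dvd hv (hb t ht)
    rwa [hV.map_mul v hv, ← hte, h v hv, add_zero] at this

/-- The divisor of a finite set determines which elements divide all its multiples. -/
theorem dvd_iff_le {φ : (M → ℕ∞) → ℕ∞} {T : Finset M} (hT : T.Nonempty)
    (h : ∀ v ∈ V, T.inf v = φ v) {y b : M} (hb : b ∉ zeroElts M) :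
    (∀ t ∈ T, b ∣ y * t) ↔ ∀ v ∈ V, v b ≤ v y + φ v := by
  refine ⟨fun hd v hv => ?_, fun hle t ht => ?_⟩
  · obtain ⟨t, ht, hte⟩ := Finset.exists_mem_eq_inf T hT v
    rw [← h v hv, hte, ← hV.map_mul v hv]
    exact hV.le_of_dvd hv (hd t ht)
  · refine hV.dvd_of_le _ _ hb fun v hv => (hle v hv).trans ?_
    rw [hV.map_mul v hv, ← h v hv]
    gcongr
    exact Finset.inf_le ht

/-- Let `S` represent `v e₀ - min v(T)`. Then `e₀` divides `s * e` for all `s ∈ S` and `e ∈ E`,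
hence divides `s`. So `v e₀ ≤ v e₀ - min v(T)` with `v e₀` finite and at least the minimum, which
forces the minimum to be zero. -/
theorem exists_eq_zero_of_isGV {E : Set M} (hf : E.Finite) (hE : IsGV E) {v : M → ℕ∞}
    (hv : v ∈ V) : ∃ e ∈ E, v e = 0 := by
  classical
  obtain ⟨⟨e₀, he₀, he₀z⟩, hE⟩ := hE
  set T : Finset M := hf.toFinset.filter (· ∉ zeroElts M) with hTdef
  have hT : T.Nonempty := ⟨e₀, by simp [hTdef, he₀, he₀z]⟩
  have h0 : ∀ t ∈ T, t ∉ zeroElts M := fun t ht => by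
    simp only [hTdef, Finset.mem_filter] at ht; exact ht.2
  have hR : Rep V fun v => T.inf v := ⟨T, hT, h0, fun _ _ => rfl⟩
  obtain ⟨S, hS, hS0, hSv⟩ := hV.rep_sub (Rep.eval he₀z) hR
  have key : ∀ s ∈ S, e₀ ∣ s := fun s hs => hE s e₀ fun e he => by
    by_cases hez : e ∈ zeroElts M
    · exact dvd_of_mem_zeroElts (mul_mem_zeroElts_right hez)
    · refine hV.dvd_of_le _ _ he₀z fun w hw => ?_
      rw [hV.map_mul w hw]
      have h1 : S.inf w ≤ w s := Finset.inf_le hs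
      have h2 : T.inf w ≤ w e := Finset.inf_le (by simp [hTdef, he, hez])
      rw [hSv w hw] at h1
      exact (le_tsub_add (a := T.inf w)).trans (add_le_add h1 h2)
  have h1 : v e₀ ≤ v e₀ - T.inf v := by
    refine le_of_le_of_eq ?_ (hSv v hv)
    exact Finset.le_inf fun s hs => hV.le_of_dvd hv (key s hs)
  obtain ⟨t, ht, hte⟩ := Finset.exists_mem_eq_inf T hT v
  have h2 : v t ≤ v e₀ := hte ▸ Finset.inf_le (by simp [hTdef, he₀, he₀z])
  refine ⟨t, by simp only [hTdef, Finset.mem_filter, Set.Finite.mem_toFinset] at ht; exact ht.1, ?_⟩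
  rw [hte] at h1
  have h3 := hV.ne_top hv (h0 t ht)
  have h4 := hV.ne_top hv he₀z
  lift v t to ℕ using h3 with n
  lift v e₀ to ℕ using h4 with m
  norm_cast at h1 h2 ⊢
  omega

/-- The `w`-closure of a finite set in terms of values. -/
theorem mem_wSys_iff_le {T : Finset M} (hT : T.Nonempty) (h0 : ∀ t ∈ T, t ∉ zeroElts M) {x : M} :
    x ∈ wSys (T : Set M) ↔ ∀ v ∈ V, T.inf v ≤ v x := by
  classical
  refine ⟨fun hx v hv => ?_, fun h => ?_⟩
  · obtain ⟨E, hf, hE, hx⟩ := mem_wSys_iff.1 hx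
    obtain ⟨e, he, hev⟩ := hV.exists_eq_zero_of_isGV hf hE hv
    obtain ⟨t, ht, hd⟩ | hz := mem_sSys_iff.1 (hx e he)
    · have := hV.le_of_dvd hv hd
      rw [hV.map_mul v hv, hev, add_zero] at this
      exact (Finset.inf_le (Finset.mem_coe.1 ht)).trans this
    · have := (hV.eq_top v hv _).2 hz
      rw [hV.map_mul v hv, hev, add_zero] at this
      rw [this]; exact le_top
  · by_cases hxz : x ∈ zeroElts M
    · exact zeroElts_subset_wSys hxz
    -- Every `s ∈ S t` satisfies `t ∣ x * s`. For each `v` some `t` has `v t ≤ v x`, so the union of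
    -- the sets `S t` has minimum zero everywhere and witnesses `x ∈ T_w`.
    have hR : ∀ t ∈ T, Rep V fun v => v t - v x := fun t ht => hV.rep_tsub t x (h0 t ht) hxz
    choose! S hS hS0 hSv using hR
    have hSS : ∀ s ∈ T.biUnion S, s ∉ zeroElts M := by
      intro s hs
      obtain ⟨t, ht, hs⟩ := Finset.mem_biUnion.1 hs
      exact hS0 t ht s hs
    refine mem_wSys_iff.2 ⟨(T.biUnion S : Finset M), Finset.finite_toSet _,
      hV.isGV_of_inf_eq_zero ?_ fun v hv => ?_, fun e he => ?_⟩
    · obtain ⟨t, ht⟩ := hT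
      obtain ⟨s, hs⟩ := hS t ht
      have := Finset.mem_biUnion.2 ⟨t, ht, hs⟩
      exact ⟨s, this, hSS s this⟩
    · obtain ⟨t, ht, hte⟩ := Finset.exists_mem_eq_inf T hT v
      rw [Finset.inf_biUnion]
      refine le_antisymm ((Finset.inf_le ht).trans ?_) zero_le
      exact ((hSv t ht v hv).trans (tsub_eq_zero_of_le (hte ▸ h v hv))).le
    · obtain ⟨t, ht, hs⟩ := Finset.mem_biUnion.1 (Finset.mem_coe.1 he)
      refine mem_sSys_iff.2 (Or.inl ⟨t, ht, hV.dvd_of_le _ _ (h0 t ht) fun v hv => ?_⟩)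
      have h1 : (S t).inf v ≤ v e := Finset.inf_le hs
      rw [hSv t ht v hv, tsub_le_iff_left] at h1
      rwa [hV.map_mul v hv]

end DivFamily

end DivFamily

/-! ### Divisor families give radical factorizations; the `w`-Bézout criterion -/

variable {M : Type*} [CommMonoid M] [IsCancelOffZero M]

namespace DivFamily

variable {V : Set (M → ℕ∞)} (hV : DivFamily V)
include hV

theorem inf_mul [DecidableEq M] {v : M → ℕ∞} (hv : v ∈ V) {S T : Finset M} (hS : S.Nonempty)
    (hT : T.Nonempty) : (S * T).inf v = S.inf v + T.inf v := by
  refine le_antisymm ?_ (Finset.le_inf fun x hx => ?_)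
  · obtain ⟨s, hs, hse⟩ := Finset.exists_mem_eq_inf S hS v
    obtain ⟨t, ht, hte⟩ := Finset.exists_mem_eq_inf T hT v
    rw [hse, hte, ← hV.map_mul v hv]
    exact Finset.inf_le (Finset.mul_mem_mul hs ht)
  · obtain ⟨s, hs, t, ht, rfl⟩ := Finset.mem_mul.1 hx
    rw [hV.map_mul v hv]
    exact add_le_add (Finset.inf_le hs) (Finset.inf_le ht)

/-- The radical ideal of all elements whose value is positive wherever the value of some finite
subset of `J` exceeds `k`. -/
def layer (V : Set (M → ℕ∞)) (J : Set M) (k : ℕ) : Set M :=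
  {x | ∃ F : Finset M, F.Nonempty ∧ ↑F ⊆ J ∧ ∀ v ∈ V, min (F.inf v - k) 1 ≤ v x}

theorem isRIdeal_layer {J : Set M} (hJ : J.Nonempty) (k : ℕ) :
    IsRIdeal wSys (layer V J k) := by
  classical
  obtain ⟨a, ha⟩ := hJ
  refine isRIdeal_wSys_of (fun z hz => ⟨{a}, by simp, by simpa using ha, fun v hv => ?_⟩) ?_ ?_
  · rw [(hV.eq_top v hv z).2 hz]; exact le_top
  · rintro x ⟨F, hF, hFJ, h⟩ y
    exact ⟨F, hF, hFJ, fun v hv => (h v hv).trans (hV.le_of_dvd hv (dvd_mul_right _ _))⟩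
  · intro E hf hE x hx
    choose! F hF hFJ h using hx
    obtain ⟨e₀, he₀, -⟩ := hE.1
    -- Enlarging the finite set only lowers the required bound. At each `v` some `e ∈ E` has value
    -- zero, so the bound known for `x * e` holds for `x`.
    refine ⟨hf.toFinset.biUnion F, ?_, ?_, fun v hv => ?_⟩
    · obtain ⟨y, hy⟩ := hF e₀ he₀
      exact ⟨y, Finset.mem_biUnion.2 ⟨e₀, by simpa using he₀, hy⟩⟩
    · intro y hy
      obtain ⟨e, he, hy⟩ := Finset.mem_biUnion.1 (Finset.mem_coe.1 hy)
      exact hFJ e (by simpa using he) hy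
    · obtain ⟨e, he, hev⟩ := hV.exists_eq_zero_of_isGV hf hE hv
      have := h e he v hv
      rw [hV.map_mul v hv, hev, add_zero] at this
      refine le_trans ?_ this
      gcongr
      exact Finset.subset_biUnion_of_mem F (by simpa using he)

/-- The required bound never exceeds one, so it only asks where `v x` is positive, and this is the
same for `x` and its powers. -/
theorem isRadicalSet_layer (J : Set M) (k : ℕ) : IsRadicalSet (layer V J k) := by
  refine Set.Subset.antisymm ?_ fun x hx => ⟨1, le_rfl, by simpa using hx⟩
  rintro x ⟨m, hm, F, hF, hFJ, h⟩
  refine ⟨F, hF, hFJ, fun v hv => ?_⟩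
  have := h v hv
  rw [hV.map_pow hv] at this
  rcases eq_or_ne (v x) 0 with h0 | h0
  · rw [h0, mul_zero] at this
    rwa [h0]
  · exact (min_le_right _ _).trans (Order.one_le_iff_pos.2 (pos_iff_ne_zero.2 h0))

/-- A set representing `min (F.inf v - k) 1` lies in the `k`-th layer, and minima add up in
products. For large `m` the sum is `F.inf v`, which puts `F` into the `w`-closure of the product of
the layers. -/
theorem exists_finset_subset_prod_layer {J : Set M} {F : Finset M} (hF : F.Nonempty)
    (hFJ : ↑F ⊆ J) (h0 : ∀ f ∈ F, f ∉ zeroElts M) (m : ℕ) :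
    ∃ P : Finset M, P.Nonempty ∧ (∀ p ∈ P, p ∉ zeroElts M) ∧
      ↑P ⊆ ((List.range m).map (layer V J)).prod ∧
      ∀ v ∈ V, P.inf v = ∑ k ∈ Finset.range m, min (F.inf v - k) 1 := by
  classical
  induction m with
  | zero =>
    exact ⟨{1}, by simp, by simpa using one_notMem_zeroElts, by simp, fun v hv => by
      simpa using hV.map_one hv⟩
  | succ m ih =>
    obtain ⟨P, hP, hP0, hPs, hPv⟩ := ih
    have hR : Rep V fun v => F.inf v := ⟨F, hF, h0, fun _ _ => rfl⟩
    obtain ⟨T, hT, hT0, hTv⟩ := hV.rep_minOne (hV.rep_sub_nat hR m)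
    refine ⟨P * T, hP.mul hT, ?_, ?_, fun v hv => ?_⟩
    · intro x hx
      obtain ⟨p, hp, t, ht, rfl⟩ := Finset.mem_mul.1 hx
      exact mul_notMem_zeroElts (hP0 p hp) (hT0 t ht)
    · rw [List.range_succ, List.map_append, List.prod_append, Finset.coe_mul]
      refine Set.mul_subset_mul hPs ?_
      simp only [List.map_cons, List.map_nil, List.prod_cons, List.prod_nil, mul_one]
      intro t ht
      exact ⟨F, hF, hFJ, fun v hv => (hTv v hv).symm.trans_le (Finset.inf_le (by simpa using ht))⟩
    · rw [hV.inf_mul hv hP hT, Finset.sum_range_succ, hPv v hv]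
      exact congrArg _ (hTv v hv)

/-- The finite sets witnessing membership in the individual layers are merged into one. Keeping `a`
in it bounds its minima by the values of `a`, so that the layer sum can later be evaluated. -/
theorem exists_finset_of_mem_prod_layer {J : Set M} {a : M} (ha : a ∈ J) (m : ℕ) {y : M}
    (hy : y ∈ ((List.range m).map (layer V J)).prod) :
    ∃ F : Finset M, a ∈ F ∧ ↑F ⊆ J ∧
      ∀ v ∈ V, ∑ k ∈ Finset.range m, min (F.inf v - k) 1 ≤ v y := by
  classical
  induction m generalizing y with
  | zero => exact ⟨{a}, by simp, by simpa using ha, fun v hv => by simp⟩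
  | succ m ih =>
    rw [List.range_succ, List.map_append, List.prod_append] at hy
    simp only [List.map_cons, List.map_nil, List.prod_cons, List.prod_nil, mul_one] at hy
    obtain ⟨p, hp, t, ⟨F', hF', hFJ', hFv'⟩, rfl⟩ := hy
    obtain ⟨F, haF, hFJ, hFv⟩ := ih hp
    refine ⟨F ∪ F', Finset.mem_union_left _ haF, ?_, fun v hv => ?_⟩
    · rw [Finset.coe_union]; exact Set.union_subset hFJ hFJ'
    · rw [Finset.sum_range_succ, hV.map_mul v hv]
      refine add_le_add (le_trans (Finset.sum_le_sum fun k _ => ?_) (hFv v hv))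
        (le_trans ?_ (hFv' v hv))
      · gcongr; exact Finset.subset_union_left
      · gcongr; exact Finset.subset_union_right

omit hV in
theorem wSys_subset_of_finset {J : Set M} (hJ : IsRIdeal wSys J) {F : Finset M} (hFJ : ↑F ⊆ J) :
    wSys (F : Set M) ⊆ J := by
  have := wSys_mono hFJ
  rwa [show wSys J = J from hJ] at this

omit hV in
theorem sSys_diff_zeroElts (X : Set M) : sSys (X \ zeroElts M) = sSys X := by
  ext x
  rw [mem_sSys_iff, mem_sSys_iff]
  refine ⟨Or.imp_left fun ⟨y, hy, hd⟩ => ⟨y, hy.1, hd⟩, ?_⟩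
  rintro (⟨y, hy, hd⟩ | h)
  · by_cases hz : y ∈ zeroElts M
    · exact Or.inr (mem_zeroElts_of_dvd hd hz)
    · exact Or.inl ⟨y, ⟨hy, hz⟩, hd⟩
  · exact Or.inr h

omit hV in
theorem wSys_diff_zeroElts (X : Set M) : wSys (X \ zeroElts M) = wSys X := by
  ext x
  rw [mem_wSys_iff, mem_wSys_iff, sSys_diff_zeroElts]

/-- A monoid with a family of valuations as in `DivFamily` is a `w`-SP-monoid. -/
theorem isWSP : IsWSP M := by
  classical
  intro J hJ
  by_cases hz : J ⊆ zeroElts M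
  · refine ⟨[J], by simp, ?_, by simpa using hJ.symm⟩
    have : J = zeroElts M := hz.antisymm hJ.zero_subset
    simp only [List.mem_singleton, forall_eq]
    refine ⟨hJ, Set.Subset.antisymm ?_ fun x hx => ⟨1, le_rfl, by simpa using hx⟩⟩
    rintro x ⟨n, hn, hx⟩
    rw [this] at hx ⊢
    by_contra h
    exact pow_notMem_zeroElts h n hx
  · obtain ⟨a, ha, haz⟩ := Set.not_subset.1 hz
    obtain ⟨n, hn⟩ := hV.bounded a haz
    have hn' : ∀ F : Finset M, a ∈ F → ∀ v ∈ V, F.inf v ≤ (n + 1 : ℕ) := fun F haF v hv =>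
      (Finset.inf_le haF).trans ((hn v hv).trans (by exact_mod_cast n.le_succ))
    -- Here `n` bounds the values of `a`; the extra layer keeps the list nonempty when `n = 0`.
    refine ⟨(List.range (n + 1)).map (layer V J), by simp, ?_, ?_⟩
    · intro I hI
      obtain ⟨k, -, rfl⟩ := List.mem_map.1 hI
      exact ⟨hV.isRIdeal_layer ⟨a, ha⟩ k, hV.isRadicalSet_layer J k⟩
    · refine Set.Subset.antisymm (fun x hx => ?_) ?_
      · by_cases hxz : x ∈ zeroElts M
        · exact zeroElts_subset_wSys hxz
        -- The values of `x` may exceed `n`, but the minimum over `{x, a}` does not, and this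
        -- minimum is at most `v x`.
        · have hFJ : (({x, a} : Finset M) : Set M) ⊆ J := by
            intro y hy
            simp only [Finset.coe_insert, Finset.coe_singleton, Set.mem_insert_iff,
              Set.mem_singleton_iff] at hy
            rcases hy with rfl | rfl <;> assumption
          obtain ⟨P, hP, hP0, hPs, hPv⟩ := hV.exists_finset_subset_prod_layer (J := J)
            (F := {x, a}) (by simp) hFJ
            (by simp [hxz, haz]) (n + 1)
          refine wSys_mono hPs ((hV.mem_wSys_iff_le hP hP0).2 fun v hv => ?_)
          rw [hPv v hv, sum_min_sub_one _ (hn' _ (by simp) v hv)]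
          exact Finset.inf_le (by simp)
      · refine Set.Subset.trans (wSys_mono fun y hy => ?_) (show wSys J = J from hJ).subset
        obtain ⟨F, haF, hFJ, hFv⟩ := hV.exists_finset_of_mem_prod_layer ha _ hy
        refine wSys_subset_of_finset hJ (F := F.filter (· ∉ zeroElts M))
          (fun x hx => hFJ (by simp only [Finset.coe_filter, Set.mem_ofPred_eq] at hx; exact hx.1)) ?_
        have e : ((F.filter (· ∉ zeroElts M) : Finset M) : Set M) = ↑F \ zeroElts M := by
          ext; simp
        refine (hV.mem_wSys_iff_le ⟨a, by simp [haF, haz]⟩ (by simp)).2 fun v hv => ?_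
        have h1 := hFv v hv
        rw [sum_min_sub_one _ (hn' F haF v hv)] at h1
        refine le_trans (le_of_eq ?_) h1
        refine le_antisymm (Finset.le_inf fun f hf => ?_) (Finset.inf_mono (Finset.filter_subset _ _))
        by_cases hfz : f ∈ zeroElts M
        · rw [(hV.eq_top v hv f).2 hfz]; exact le_top
        · exact Finset.inf_le (by simp [hf, hfz])

theorem isRIdeal_wSys_finset {T : Finset M} (hT : T.Nonempty) (h0 : ∀ t ∈ T, t ∉ zeroElts M) :
    IsRIdeal wSys (wSys (T : Set M)) := by
  refine isRIdeal_wSys_of zeroElts_subset_wSys (fun x hx y => mul_mem_wSys hx y) ?_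
  intro E hf hE x hx
  refine (hV.mem_wSys_iff_le hT h0).2 fun v hv => ?_
  obtain ⟨e, he, hev⟩ := hV.exists_eq_zero_of_isGV hf hE hv
  have := (hV.mem_wSys_iff_le hT h0).1 (hx e he) v hv
  rwa [hV.map_mul v hv, hev, add_zero] at this

/-- Under a `DivFamily`, being `w`-Bézout means that minima of values are values of elements. -/
theorem isWBezout_iff : IsWBezout M ↔ ∀ a b, a ∉ zeroElts M → b ∉ zeroElts M →
    ∃ d, d ∉ zeroElts M ∧ ∀ v ∈ V, v d = min (v a) (v b) := by
  classical
  refine ⟨fun h a b ha hb => ?_, fun h I hI hzI => ?_⟩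
  · have h0 : ∀ t ∈ ({a, b} : Finset M), t ∉ zeroElts M := by simp [ha, hb]
    have hT : ({a, b} : Finset M).Nonempty := by simp
    have hmem := fun x => hV.mem_wSys_iff_le hT h0 (x := x)
    have haI : a ∈ wSys ((({a, b} : Finset M)) : Set M) := subset_wSys (by simp)
    have hbI : b ∈ wSys ((({a, b} : Finset M)) : Set M) := subset_wSys (by simp)
    obtain ⟨A, hA, hI⟩ := h (wSys ((({a, b} : Finset M)) : Set M))
      ⟨hV.isRIdeal_wSys_finset hT h0, _, subset_wSys, Finset.finite_toSet _, rfl⟩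
      ⟨zeroElts_subset_wSys, fun hs => ha (hs haI)⟩
    have key : ∀ x ∈ wSys ((({a, b} : Finset M)) : Set M), x ∉ zeroElts M → ∃ d ∈ A, d ∣ x := by
      intro x hx hxz
      rw [hI] at hx
      exact (mem_sSys_iff.1 (show x ∈ sSys A from hx)).resolve_right hxz
    obtain ⟨d, hd, hda⟩ := key a haI ha
    obtain ⟨d', hd', hdb⟩ := key b hbI hb
    -- A principal ideal has at most one generator, so the generators dividing `a` and `b` coincide.
    obtain rfl := hA hd hd'
    have hdI : d ∈ wSys ((({a, b} : Finset M)) : Set M) := by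
      rw [hI]; exact mem_sSys_iff.2 (Or.inl ⟨d, hd, dvd_rfl⟩)
    refine ⟨d, notMem_zeroElts_of_dvd hda ha, fun v hv => le_antisymm ?_ ?_⟩
    · exact le_min (hV.le_of_dvd hv hda) (hV.le_of_dvd hv hdb)
    · simpa using (hmem d).1 hdI v hv
  · obtain ⟨hIr, E, hEI, hEf, rfl⟩ := hI
    set T : Finset M := hEf.toFinset.filter (· ∉ zeroElts M) with hTdef
    have hTE : (T : Set M) = E \ zeroElts M := by ext; simp [hTdef]
    have hT : T.Nonempty := by
      by_contra hn
      rw [Finset.not_nonempty_iff_eq_empty] at hn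
      rw [hn, Finset.coe_empty] at hTE
      refine hzI.2 ?_
      have : E ⊆ zeroElts M := Set.sdiff_eq_empty.1 hTE.symm
      have h2 := wSys_mono this
      rwa [show wSys (zeroElts M) = zeroElts M from isRIdeal_zeroElts] at h2
    have h0 : ∀ t ∈ T, t ∉ zeroElts M := by simp [hTdef]
    have hd : ∃ d, d ∉ zeroElts M ∧ ∀ v ∈ V, v d = T.inf v := by
      refine Rep.induction (φ := fun v => T.inf v) (V := V) ⟨T, hT, h0, fun _ _ => rfl⟩
        (P := fun φ => ∃ d, d ∉ zeroElts M ∧ ∀ v ∈ V, v d = φ v) ?_ ?_ ?_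
      · rintro φ ψ he ⟨d, hd0, hd⟩
        exact ⟨d, hd0, fun v hv => (hd v hv).trans (he v hv)⟩
      · exact fun a ha => ⟨a, ha, fun _ _ => rfl⟩
      · rintro φ ψ - - ⟨d, hd0, hd⟩ ⟨e, he0, he⟩
        obtain ⟨c, hc0, hc⟩ := h d e hd0 he0
        exact ⟨c, hc0, fun v hv => by rw [hc v hv, hd v hv, he v hv]⟩
    obtain ⟨d, hd0, hd⟩ := hd
    refine ⟨{d}, Set.subsingleton_singleton, ?_⟩
    change wSys E = sSys {d}
    rw [← wSys_diff_zeroElts E, ← hTE]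
    ext x
    rw [hV.mem_wSys_iff_le hT h0, mem_sSys_iff]
    constructor
    · intro hx
      exact Or.inl ⟨d, rfl, hV.dvd_of_le _ _ hd0 fun v hv => (hd v hv).trans_le (hx v hv)⟩
    · rintro (⟨_, rfl, hdx⟩ | hz) v hv
      · exact (hd v hv).symm.trans_le (hV.le_of_dvd hv hdx)
      · rw [(hV.eq_top v hv x).2 hz]; exact le_top

end DivFamily

/-! ### Primes without finite `IsGV` sets and their valuations -/

variable {M : Type*} [CommMonoid M] [IsCancelOffZero M]

/-- A proper prime semigroup ideal. -/
structure IsPrimeSet (P : Set M) : Prop where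
  mul_mem : ∀ x ∈ P, ∀ y, x * y ∈ P
  one_notMem : (1 : M) ∉ P
  mem_or_mem : ∀ x y, x * y ∈ P → x ∈ P ∨ y ∈ P

namespace IsPrimeSet

variable {P : Set M} (hP : IsPrimeSet P) {x y : M}
include hP

theorem mul_notMem (hx : x ∉ P) (hy : y ∉ P) : x * y ∉ P := fun h =>
  (hP.mem_or_mem x y h).elim hx hy

theorem mul_mem' (hy : y ∈ P) : x * y ∈ P := mul_comm y x ▸ hP.mul_mem y hy x

theorem mem_of_dvd (hx : x ∈ P) (h : x ∣ y) : y ∈ P := by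
  obtain ⟨c, rfl⟩ := h
  exact hP.mul_mem x hx c

theorem mem_of_pow_mem {n : ℕ} (h : x ^ n ∈ P) : x ∈ P := by
  induction n with
  | zero => exact absurd (by simpa using h) hP.one_notMem
  | succ n ih =>
    rw [pow_succ] at h
    exact (hP.mem_or_mem _ _ h).elim ih id

theorem zeroElts_subset (hx : x ∈ P) : zeroElts M ⊆ P := fun z hz => by
  rw [← hz x]; exact hP.mul_mem' hx

end IsPrimeSet

/-- A set containing no finite `IsGV` set. -/
def GVFree (P : Set M) : Prop := ∀ E : Set M, E.Finite → IsGV E → ¬ E ⊆ P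

theorem GVFree.mono {P Q : Set M} (hQ : GVFree Q) (h : P ⊆ Q) : GVFree P :=
  fun E hf hE hs => hQ E hf hE (hs.trans h)

/-- A maximal `GVFree` semigroup ideal `P` is prime: if `x` and `y` lie outside, `P ∪ xM` and `P ∪
yM` contain finite `IsGV` sets `E` and `F`, and `x * y ∈ P` would put the `IsGV` set `E * F` into
`P`. Finiteness of the sets makes Zorn's lemma applicable. -/
theorem exists_isPrimeSet_of_gvFree {I : Set M} (hI : ∀ x ∈ I, ∀ y, x * y ∈ I) (hg : GVFree I) :
    ∃ P, I ⊆ P ∧ IsPrimeSet P ∧ GVFree P := by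
  obtain ⟨P, hIP, hP⟩ := zorn_subset_nonempty
    {J : Set M | (∀ x ∈ J, ∀ y, x * y ∈ J) ∧ GVFree J} (by
      intro c hc hcc hcn
      refine ⟨⋃₀ c, ⟨?_, ?_⟩, fun s hs => Set.subset_sUnion_of_mem hs⟩
      · rintro x ⟨J, hJ, hx⟩ y
        exact ⟨J, hJ, (hc hJ).1 x hx y⟩
      · intro E hf hE hs
        obtain ⟨J, hJ, hEJ⟩ := DirectedOn.exists_mem_subset_of_finite_of_subset_sUnion
          hcn hcc.directedOn hf hs
        exact (hc hJ).2 E hf hE hEJ) I ⟨hI, hg⟩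
  have hPi := hP.prop.1
  have hext : ∀ x ∉ P, ∃ E : Set M, E.Finite ∧ IsGV E ∧ ∀ e ∈ E, e ∈ P ∨ x ∣ e := by
    intro x hx
    by_contra! hn
    refine hx (hP.le_of_ge (y := P ∪ {e | x ∣ e}) ⟨?_, ?_⟩ Set.subset_union_left
      (Or.inr dvd_rfl))
    · rintro e (he | he) y
      · exact Or.inl (hPi e he y)
      · exact Or.inr (Dvd.dvd.mul_right he y)
    · intro E hf hE hs
      obtain ⟨e, he, h1, h2⟩ := hn E hf hE
      exact (hs he).elim h1 h2
  refine ⟨P, hIP, ⟨hPi, fun h1 => ?_, fun x y hxy => ?_⟩, hP.prop.2⟩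
  · exact hP.prop.2 {1} (Set.finite_singleton _) isGV_singleton_one (by simpa using h1)
  · by_contra! hn
    obtain ⟨E, hEf, hE, hEx⟩ := hext x hn.1
    obtain ⟨F, hFf, hF, hFy⟩ := hext y hn.2
    refine hP.prop.2 (E * F) (hEf.mul hFf) (hE.mul hF) ?_
    rintro _ ⟨e, he, f, hf, rfl⟩
    rcases hEx e he with h | h
    · exact hPi e h f
    rcases hFy f hf with h' | h'
    · change e * f ∈ P
      rw [mul_comm]; exact hPi f h' e
    · obtain ⟨c, hc⟩ := mul_dvd_mul h h'
      change e * f ∈ P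
      rw [hc]; exact hPi _ hxy c

/-- `v` is the discrete valuation of the localization of `M` at the prime `P`. -/
structure IsVal (P : Set M) (v : M → ℕ∞) : Prop where
  map_mul : ∀ x y, v (x * y) = v x + v y
  eq_top : ∀ x, v x = ⊤ ↔ x ∈ zeroElts M
  eq_zero : ∀ x, v x = 0 ↔ x ∉ P
  dvd_of_le : ∀ x y, x ∉ zeroElts M → v x ≤ v y → ∃ s ∉ P, x ∣ s * y
  exists_eq_one : ∃ π, v π = 1

/-- Locally at `P` the element `π` generates `P`, and every nonzero element divides a power of `π`.
Hence every nonzero element is locally a unit times a unique power of `π`, whose exponent is its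
value. -/
theorem exists_isVal {P : Set M} (hP : IsPrimeSet P) {π : M} (hπ : π ∈ P) (hπz : π ∉ zeroElts M)
    (h1 : ∀ x ∈ P, ∃ s ∉ P, π ∣ s * x)
    (h2 : ∀ a ∉ zeroElts M, ∃ n : ℕ, ∃ t ∉ P, a ∣ t * π ^ n) : ∃ v, IsVal P v := by
  classical
  have hzP := hP.zeroElts_subset hπ
  -- As long as `a` lies in `P`, one factor `π` can be split off; the exponent `n` bounds how often.
  have key : ∀ n : ℕ, ∀ a ∉ zeroElts M, (∃ t ∉ P, a ∣ t * π ^ n) →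
      ∃ k : ℕ, ∃ s ∉ P, ∃ u ∉ P, s * a = u * π ^ k := by
    intro n
    induction n with
    | zero =>
      rintro a ha ⟨t, ht, hd⟩
      refine ⟨0, 1, hP.one_notMem, a, fun haP => ht ?_, by simp⟩
      have := hP.mem_of_dvd haP hd
      simpa using this
    | succ n ih =>
      rintro a ha ⟨t, ht, c, hc⟩
      by_cases haP : a ∈ P
      · obtain ⟨s, hs, a', ha'⟩ := h1 a haP
        have hsz : s ∉ zeroElts M := fun h => hs (hzP h)
        have ha'z : a' ∉ zeroElts M := fun h => mul_notMem_zeroElts hsz ha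
          (ha' ▸ mul_mem_zeroElts_right h)
        obtain ⟨k, s', hs', u, hu, he⟩ := ih a' ha'z ⟨s * t, hP.mul_notMem hs ht, c, by
          refine cancel hπz ?_
          calc π * (s * t * π ^ n) = s * (t * π ^ (n + 1)) := by rw [pow_succ]; ac_rfl
            _ = (s * a) * c := by rw [hc]; ac_rfl
            _ = π * (a' * c) := by rw [ha']; ac_rfl⟩
        refine ⟨k + 1, s' * s, hP.mul_notMem hs' hs, u, hu, ?_⟩
        calc s' * s * a = s' * (s * a) := by ac_rfl
          _ = (s' * a') * π := by rw [ha']; ac_rfl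
          _ = u * π ^ (k + 1) := by rw [he, pow_succ]; ac_rfl
      · exact ⟨0, 1, hP.one_notMem, a, haP, by simp⟩
  have hex : ∀ a, a ∉ zeroElts M → ∃ k : ℕ, ∃ s ∉ P, ∃ u ∉ P, s * a = u * π ^ k := fun a ha =>
    (h2 a ha).elim fun n h => key n a ha h
  -- If the exponents differed, cancelling powers of `π` would leave a multiple of `π` outside `P`.
  have hle : ∀ a s s' u u' : M, ∀ k l : ℕ, s' ∉ P → u ∉ P → s * a = u * π ^ k →
      s' * a = u' * π ^ l → l ≤ k := by
    intro a s s' u u' k l hs' hu he he'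
    by_contra! hkl
    obtain ⟨m, rfl⟩ := Nat.exists_eq_add_of_lt hkl
    refine hP.mul_notMem hs' hu ?_
    have : s' * u = s * u' * π ^ m * π := by
      refine cancel (pow_notMem_zeroElts hπz k) ?_
      calc π ^ k * (s' * u) = s' * (u * π ^ k) := by ac_rfl
        _ = s * (s' * a) := by rw [← he]; ac_rfl
        _ = π ^ k * (s * u' * π ^ m * π) := by rw [he', pow_succ, pow_add]; ac_rfl
    rw [this]
    exact hP.mul_mem' hπ
  choose! k s hs u hu he using hex
  have huniq : ∀ a ∉ zeroElts M, ∀ s' ∉ P, ∀ u' ∉ P, ∀ l, s' * a = u' * π ^ l → k a = l := by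
    intro a ha s' hs' u' hu' l h
    exact le_antisymm (hle a s' (s a) u' (u a) l (k a) (hs a ha) hu' h (he a ha))
      (hle a (s a) s' (u a) u' (k a) l hs' (hu a ha) (he a ha) h)
  refine ⟨fun a => if a ∈ zeroElts M then ⊤ else (k a : ℕ∞), ⟨fun x y => ?_, fun x => ?_,
    fun x => ?_, fun x y hx hxy => ?_, ⟨π, ?_⟩⟩⟩
  · by_cases hx : x ∈ zeroElts M
    · simp [hx, mul_mem_zeroElts_iff]
    by_cases hy : y ∈ zeroElts M
    · simp [hy, mul_mem_zeroElts_iff]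
    have hxy := mul_notMem_zeroElts hx hy
    simp only [hx, hy, hxy, if_false]
    norm_cast
    refine huniq _ hxy _ (hP.mul_notMem (hs x hx) (hs y hy)) _
      (hP.mul_notMem (hu x hx) (hu y hy)) _ ?_
    calc s x * s y * (x * y) = (s x * x) * (s y * y) := by ac_rfl
      _ = u x * u y * π ^ (k x + k y) := by rw [he x hx, he y hy, pow_add]; ac_rfl
  · by_cases hx : x ∈ zeroElts M <;> simp [hx]
  · by_cases hx : x ∈ zeroElts M
    · simpa [hx] using hzP hx
    simp only [hx, if_false]
    norm_cast
    refine ⟨fun h hxP => ?_, fun h => ?_⟩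
    · have := he x hx
      rw [h, pow_zero, mul_one] at this
      exact hu x hx (this ▸ hP.mul_mem' hxP)
    · exact huniq x hx 1 hP.one_notMem x h 0 (by simp)
  · by_cases hy : y ∈ zeroElts M
    · exact ⟨1, hP.one_notMem, dvd_of_mem_zeroElts (mul_mem_zeroElts_right hy)⟩
    simp only [hx, hy, if_false, Nat.cast_le] at hxy
    obtain ⟨m, hm⟩ := Nat.exists_eq_add_of_le hxy
    refine ⟨u x * s y, hP.mul_notMem (hu x hx) (hs y hy), s x * u y * π ^ m, ?_⟩
    calc u x * s y * y = u x * (s y * y) := by ac_rfl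
      _ = (u x * π ^ k x) * (u y * π ^ m) := by rw [he y hy, hm, pow_add]; ac_rfl
      _ = x * (s x * u y * π ^ m) := by rw [← he x hx]; ac_rfl
  · simp only [hπz, if_false]
    norm_cast
    exact huniq π hπz 1 hP.one_notMem 1 hP.one_notMem 1 (by simp)

/-! ### From local valuations to divisor families -/

variable (M) in
/-- The valuations of `M` at the primes containing no finite `IsGV` set. -/
def valSet : Set (M → ℕ∞) := {v | ∃ P, IsPrimeSet P ∧ GVFree P ∧ IsVal P v}

theorem exists_valSet_of_gvFree
    (h : ∀ P : Set M, IsPrimeSet P → GVFree P → (∃ a ∈ P, a ∉ zeroElts M) → ∃ v, IsVal P v)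
    {I : Set M} (hI : ∀ x ∈ I, ∀ y, x * y ∈ I) (hg : GVFree I) (ha : ∃ a ∈ I, a ∉ zeroElts M) :
    ∃ P v, I ⊆ P ∧ v ∈ valSet M ∧ IsVal P v := by
  obtain ⟨P, hIP, hP, hPg⟩ := exists_isPrimeSet_of_gvFree hI hg
  obtain ⟨a, haI, ha⟩ := ha
  obtain ⟨v, hv⟩ := h P hP hPg ⟨a, hIP haI, ha⟩
  exact ⟨P, v, hIP, ⟨P, hP, hPg, hv⟩, hv⟩

/-- Local-to-global principle: an ideal not contained in any of these primes contains a finite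
`IsGV` set. It is applied to `{s | a ∣ s * b}` for divisibility and to `{s | a ∣ s * b ∨ b ∣ s * a}`
for truncated differences. -/
theorem preDivFamily_valSet
    (h : ∀ P : Set M, IsPrimeSet P → GVFree P → (∃ a ∈ P, a ∉ zeroElts M) → ∃ v, IsVal P v) :
    PreDivFamily (valSet M) where
  map_mul := by rintro v ⟨P, -, -, hv⟩; exact hv.map_mul
  eq_top := by rintro v ⟨P, -, -, hv⟩; exact hv.eq_top
  dvd_of_le := by
    intro a b ha hab
    by_contra hn
    obtain ⟨P, v, hIP, hvV, hv⟩ := exists_valSet_of_gvFree h (I := {s | a ∣ s * b})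
      (fun s hs t => by
        change a ∣ s * t * b
        rw [mul_right_comm]
        exact Dvd.dvd.mul_right hs t)
      (fun E hf hE hs => hn (hE.2 b a fun e he => mul_comm e b ▸ hs he))
      ⟨a, dvd_mul_right a b, ha⟩
    obtain ⟨s, hs, hd⟩ := hv.dvd_of_le a b ha (hab v hvV)
    exact hs (hIP hd)
  rep_tsub := by
    classical
    intro a b ha hb
    obtain ⟨E, hf, hE, hEI⟩ : ∃ E : Set M, E.Finite ∧ IsGV E ∧
        ∀ e ∈ E, a ∣ e * b ∨ b ∣ e * a := by
      by_contra! hn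
      obtain ⟨P, v, hIP, hvV, hv⟩ := exists_valSet_of_gvFree h
        (I := {s | a ∣ s * b ∨ b ∣ s * a})
        (fun s hs t => by
          refine Or.imp (fun h => ?_) (fun h => ?_) hs
          · rw [mul_right_comm]; exact Dvd.dvd.mul_right h t
          · rw [mul_right_comm]; exact Dvd.dvd.mul_right h t)
        (fun E hf hE hs => by
          obtain ⟨e, he, h1, h2⟩ := hn E hf hE
          exact (hs he).elim h1 h2)
        ⟨a, Or.inl (dvd_mul_right a b), ha⟩
      rcases le_total (v a) (v b) with hab | hab
      · obtain ⟨s, hs, hd⟩ := hv.dvd_of_le a b ha hab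
        exact hs (hIP (Or.inl hd))
      · obtain ⟨s, hs, hd⟩ := hv.dvd_of_le b a hb hab
        exact hs (hIP (Or.inr hd))
    -- Either way `v a - v b ≤ v t`, with equality as soon as `v e = 0`; such an `e` exists for each
    -- `v`, since `E` is not contained in the prime of `v`.
    have hc : ∀ e ∈ E, e ∉ zeroElts M → ∃ t, t ∉ zeroElts M ∧ (a ∣ e * b ∧ t = e ∨ e * a = b * t) := by
      intro e he hez
      rcases hEI e he with hd | ⟨t, ht⟩
      · exact ⟨e, hez, Or.inl ⟨hd, rfl⟩⟩
      · refine ⟨t, fun htz => ?_, Or.inr ht⟩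
        exact mul_notMem_zeroElts hez ha (ht ▸ mul_mem_zeroElts_right htz)
    choose! f hf0 hfe using hc
    obtain ⟨e₀, he₀, he₀z⟩ := hE.1
    refine ⟨(hf.toFinset.filter (· ∉ zeroElts M)).image f, ?_, ?_, ?_⟩
    · exact ⟨f e₀, Finset.mem_image_of_mem f (by simp [he₀, he₀z])⟩
    · intro t ht
      obtain ⟨e, he, rfl⟩ := Finset.mem_image.1 ht
      simp only [Finset.mem_filter, Set.Finite.mem_toFinset] at he
      exact hf0 e he.1 he.2
    · rintro v ⟨P, hP, hg, hv⟩
      have hane : v a ≠ ⊤ := fun h => ha ((hv.eq_top a).1 h)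
      refine le_antisymm ?_ (Finset.le_inf fun t ht => ?_)
      · obtain ⟨e, he, heP⟩ := Set.not_subset.1 (hg E hf hE)
        have hev := (hv.eq_zero e).2 heP
        have hez : e ∉ zeroElts M := fun hz => by
          rw [(hv.eq_top e).2 hz] at hev; simp at hev
        refine (Finset.inf_le (Finset.mem_image_of_mem f (a := e) (by simp [he, hez]))).trans ?_
        rcases hfe e he hez with ⟨-, h2⟩ | h2
        · rw [h2, hev]; exact zero_le
        · have := congrArg v h2
          rw [hv.map_mul, hv.map_mul, hev, zero_add] at this
          change v (f e) ≤ v a - v b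
          rw [this, add_comm]
          refine ENat.le_sub_of_add_le_right (fun h => hb ((hv.eq_top b).1 h)) le_rfl
      · obtain ⟨e, he, rfl⟩ := Finset.mem_image.1 ht
        simp only [Finset.mem_filter, Set.Finite.mem_toFinset] at he
        change v a - v b ≤ v (f e)
        rw [tsub_le_iff_right]
        rcases hfe e he.1 he.2 with ⟨⟨c, hc⟩, h2⟩ | h2
        · rw [h2, ← hv.map_mul, hc, hv.map_mul]
          exact le_self_add
        · rw [add_comm, ← hv.map_mul, ← h2, hv.map_mul]
          exact le_add_self

/-- For summands with values in `{0, 1}`, the truncation of their sum at one is their maximum, which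
is representable. The number of summands bounds the values. -/
theorem PreDivFamily.divFamily {V : Set (M → ℕ∞)} (hV : PreDivFamily V)
    (h : ∀ a ∉ zeroElts M, ∃ L : List ((M → ℕ∞) → ℕ∞), (∀ φ ∈ L, Rep V φ ∧ ∀ v ∈ V, φ v ≤ 1) ∧
      ∀ v ∈ V, v a = (L.map (· v)).sum) : DivFamily V where
  toPreDivFamily := hV
  rep_min_one := by
    intro a ha
    obtain ⟨L, hL, hs⟩ := h a ha
    refine Rep.congr (φ := fun v => min ((L.map (· v)).sum) 1) ?_ fun v hv => by rw [hs v hv]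
    clear hs
    induction L with
    | nil => simpa using hV.rep_zero
    | cons φ L ih =>
      have := hV.rep_max (hL φ (by simp)).1 (ih fun ψ hψ => hL ψ (by simp [hψ]))
      refine this.congr fun v hv => ?_
      have h1 := (hL φ (by simp)).2 v hv
      simp only [List.map_cons, List.sum_cons]
      generalize (L.map (· v)).sum = x
      rcases eq_or_ne (φ v) 0 with h0 | h0
      · simp [h0]
      · have : φ v = 1 := le_antisymm h1 (Order.one_le_iff_pos.2 (pos_iff_ne_zero.2 h0))
        rw [this, min_eq_right (le_self_add), max_eq_left (min_le_right _ _)]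
  bounded := by
    intro a ha
    obtain ⟨L, hL, hs⟩ := h a ha
    refine ⟨L.length, fun v hv => (hs v hv).trans_le ?_⟩
    clear hs
    induction L with
    | nil => simp
    | cons φ L ih =>
      simp only [List.map_cons, List.sum_cons, List.length_cons]
      push_cast
      rw [add_comm (L.length : ℕ∞)]
      exact add_le_add ((hL φ (by simp)).2 v hv) (ih fun ψ hψ => hL ψ (by simp [hψ]))

/-- A set that is closed under multiplication by `M` and radical takes a value at most one. -/
theorem IsVal.exists_le_one {P : Set M} {v : M → ℕ∞} (hv : IsVal P v) (hP : IsPrimeSet P)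
    {I : Set M} (hI : ∀ x ∈ I, ∀ y, x * y ∈ I) (hrad : ∀ x : M, ∀ n, 1 ≤ n → x ^ n ∈ I → x ∈ I)
    {x : M} (hx : x ∈ I) (hxz : x ∉ zeroElts M) : ∃ y ∈ I, v y ≤ 1 := by
  obtain ⟨π, hπ⟩ := hv.exists_eq_one
  have hne : v x ≠ ⊤ := fun h => hxz ((hv.eq_top x).1 h)
  obtain ⟨m, hm⟩ := ENat.ne_top_iff_exists.1 hne
  have hpow : ∀ n : ℕ, v (π ^ n) = n := by
    intro n
    induction n with
    | zero => simpa using (hv.eq_zero 1).2 hP.one_notMem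
    | succ n ih => rw [pow_succ, hv.map_mul, ih, hπ]; simp
  -- With `m = v x`, some `s ∉ P` puts `s * π ^ (m + 1)` into `I`, and radicality yields `s * π ∈
  -- I`, of value one. The exponent `m + 1` stays positive when `m = 0`.
  obtain ⟨s, hs, c, hc⟩ := hv.dvd_of_le x (π ^ (m + 1)) hxz (by
    rw [hpow, ← hm]; exact_mod_cast m.le_succ)
  refine ⟨s * π, hrad (s * π) (m + 1) (by omega) ?_, ?_⟩
  · rw [mul_pow, pow_succ s, mul_assoc, hc, mul_left_comm]
    exact hI x hx _
  · rw [hv.map_mul, hπ, (hv.eq_zero s).2 hs, zero_add]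

/-! ### Localizing `w`-SP factorizations at a prime -/

variable {M : Type*} [CommMonoid M] [IsCancelOffZero M]

/-- A radical semigroup ideal that is saturated with respect to the complement of `P`. -/
structure IsSatRadical (P I : Set M) : Prop where
  mul_mem : ∀ x ∈ I, ∀ y, x * y ∈ I
  rad : ∀ x : M, ∀ n, 1 ≤ n → x ^ n ∈ I → x ∈ I
  sat : ∀ s ∉ P, ∀ x, s * x ∈ I → x ∈ I

theorem IsRadicalSet.mem_of_pow_mem {I : Set M} (h : IsRadicalSet I) {x : M} {n : ℕ} (hn : 1 ≤ n)
    (hx : x ^ n ∈ I) : x ∈ I := by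
  rw [← show _ = I from h]
  exact ⟨n, hn, hx⟩

theorem IsSatRadical.mem_of_dvd {P I : Set M} (hI : IsSatRadical P I) {x y : M} (hx : x ∈ I)
    (h : x ∣ y) : y ∈ I := by
  obtain ⟨c, rfl⟩ := h
  exact hI.mul_mem x hx c

theorem IsSatRadical.subset_of_one_notMem {P I : Set M} (hI : IsSatRadical P I)
    (h1 : (1 : M) ∉ I) : I ⊆ P := fun x hx => by
  by_contra hn
  exact h1 (hI.sat x hn 1 (by rwa [mul_one]))

theorem list_prod_subset {L : List (Set M)} {I : Set M} (hI : I ∈ L)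
    (h : ∀ x ∈ I, ∀ y, x * y ∈ I) : L.prod ⊆ I := by
  classical
  rw [← List.prod_erase hI]
  rintro _ ⟨x, hx, y, -, rfl⟩
  exact h x hx y

theorem mul_mem_list_prod {L : List (Set M)} (hL : L ≠ [])
    (h : ∀ I ∈ L, ∀ x ∈ I, ∀ y, x * y ∈ I) {x : M} (hx : x ∈ L.prod) (y : M) :
    x * y ∈ L.prod := by
  obtain ⟨I, L, rfl⟩ := List.exists_cons_of_ne_nil hL
  rw [List.prod_cons] at hx ⊢
  obtain ⟨i, hi, l, hl, rfl⟩ := hx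
  exact ⟨i * y, h I (by simp) i hi y, l, hl, by simp only; ac_rfl⟩

theorem zeroElts_subset_list_prod {L : List (Set M)} (hL : L ≠ [])
    (h : ∀ I ∈ L, zeroElts M ⊆ I) : zeroElts M ⊆ L.prod := by
  intro z hz
  have hne : ∀ L : List (Set M), (∀ I ∈ L, zeroElts M ⊆ I) → L.prod.Nonempty := by
    intro L
    induction L with
    | nil => intro _; exact ⟨1, by simp⟩
    | cons I L ih =>
      intro h
      rw [List.prod_cons]
      exact Set.Nonempty.mul ⟨z, h I (by simp) hz⟩ (ih fun J hJ => h J (by simp [hJ]))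
  obtain ⟨I, L, rfl⟩ := List.exists_cons_of_ne_nil hL
  obtain ⟨l, hl⟩ := hne L fun J hJ => h J (by simp [hJ])
  rw [List.prod_cons]
  exact ⟨z, h I (by simp) hz, l, hl, hz l⟩

/-- In a `w`-SP-monoid, every ideal that is saturated with respect to a prime without finite `IsGV`
sets is locally a product of radical saturated ideals. -/
theorem IsWSP.exists_local_product (hM : IsWSP M) {P : Set M} (hP : IsPrimeSet P) (hg : GVFree P)
    {J : Set M} (hz : zeroElts M ⊆ J) (hJ : ∀ x ∈ J, ∀ y, x * y ∈ J)
    (hs : ∀ s ∉ P, ∀ x, s * x ∈ J → x ∈ J) :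
    ∃ L : List (Set M), (∀ I ∈ L, IsSatRadical P I) ∧ L.prod ⊆ J ∧
      ∀ x ∈ J, ∃ s ∉ P, s * x ∈ L.prod := by
  -- Some `e ∈ E` lies outside `P`, and saturation removes it from `x * e ∈ J`.
  have hJw : IsRIdeal wSys J := isRIdeal_wSys_of hz hJ fun E hf hE x hx => by
    obtain ⟨e, he, heP⟩ := Set.not_subset.1 (hg E hf hE)
    exact hs e heP x (mul_comm x e ▸ hx e he)
  obtain ⟨L, hL, hLI, hJL⟩ := hM J hJw
  let loc : Set M → Set M := fun I => {x | ∃ s ∉ P, s * x ∈ I}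
  have hsub : ∀ I, I ⊆ loc I := fun I x hx => ⟨1, hP.one_notMem, by rwa [one_mul]⟩
  refine ⟨L.map loc, ?_, ?_, ?_⟩
  · intro I' hI'
    obtain ⟨I, hI, rfl⟩ := List.mem_map.1 hI'
    obtain ⟨hIw, hIr⟩ := hLI I hI
    refine ⟨?_, ?_, ?_⟩
    · rintro x ⟨s, hs, hx⟩ y
      exact ⟨s, hs, by rw [← mul_assoc]; exact hIw.mul_mem hx y⟩
    · rintro x n hn ⟨s, hs, hx⟩
      refine ⟨s, hs, hIr.mem_of_pow_mem hn ?_⟩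
      obtain ⟨m, rfl⟩ := Nat.exists_eq_add_of_le' hn
      rw [mul_pow, pow_succ s, mul_assoc, mul_comm]
      exact hIw.mul_mem hx _
    · rintro s hs x ⟨t, ht, hx⟩
      exact ⟨t * s, hP.mul_notMem ht hs, by rwa [mul_assoc]⟩
  · have key : ∀ L : List (Set M), ∀ x ∈ (L.map loc).prod, ∃ s ∉ P, s * x ∈ L.prod := by
      intro L
      induction L with
      | nil => intro x hx; exact ⟨1, hP.one_notMem, by simpa using hx⟩
      | cons I L ih =>
        intro x hx
        rw [List.map_cons, List.prod_cons] at hx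
        obtain ⟨i, ⟨s, hs, hi⟩, l, hl, rfl⟩ := hx
        obtain ⟨t, ht, hl⟩ := ih l hl
        refine ⟨s * t, hP.mul_notMem hs ht, ?_⟩
        rw [List.prod_cons]
        exact ⟨s * i, hi, t * l, hl, by simp only; ac_rfl⟩
    intro x hx
    obtain ⟨s, hsP, hx⟩ := key L x hx
    refine hs s hsP x ?_
    rw [hJL]
    exact subset_wSys hx
  · intro x hx
    rw [hJL] at hx
    obtain ⟨E, hf, hE, hx⟩ := mem_wSys_iff.1 hx
    obtain ⟨e, he, heP⟩ := Set.not_subset.1 (hg E hf hE)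
    have hLs : ∀ L : List (Set M), L.prod ⊆ (L.map loc).prod := by
      intro L
      induction L with
      | nil => simp
      | cons I L ih =>
        rw [List.map_cons, List.prod_cons, List.prod_cons]
        exact Set.mul_subset_mul (hsub I) ih
    refine ⟨e, heP, hLs L ?_⟩
    rw [mul_comm]
    rcases mem_sSys_iff.1 (hx e he) with ⟨y, hy, c, hc⟩ | h0
    · rw [hc]
      exact mul_mem_list_prod hL (fun I hI x hx y => (hLI I hI).1.mul_mem hx y) hy c
    · exact zeroElts_subset_list_prod hL (fun I hI => (hLI I hI).1.zero_subset) h0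

/-- Local factorization of an element into locally principal radical ideals. -/
theorem IsWSP.exists_local_factorization (hM : IsWSP M) {P : Set M} (hP : IsPrimeSet P)
    (hg : GVFree P) {a : M} (ha : a ∉ zeroElts M) (hzP : zeroElts M ⊆ P) :
    ∃ L : List (Set M), (∀ I ∈ L, IsSatRadical P I ∧ a ∈ I ∧
        ∃ x ∈ I, (∀ y ∈ I, ∃ t ∉ P, x ∣ t * y) ∧ ∃ s ∉ P, x ∣ s * a) ∧
      ∀ w ∈ L.prod, ∃ t ∉ P, a ∣ t * w := by
  classical
  obtain ⟨L, hL, hLa, haL⟩ := hM.exists_local_product hP hg (J := {x | ∃ t ∉ P, a ∣ t * x})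
    (fun z hz => ⟨1, hP.one_notMem, dvd_of_mem_zeroElts (by rwa [one_mul])⟩)
    (by
      rintro x ⟨t, ht, hx⟩ y
      exact ⟨t, ht, by rw [← mul_assoc]; exact Dvd.dvd.mul_right hx y⟩)
    (by
      rintro s hs x ⟨t, ht, hx⟩
      exact ⟨t * s, hP.mul_notMem ht hs, by rwa [mul_assoc]⟩)
  obtain ⟨s, hs, hsa⟩ := haL a ⟨1, hP.one_notMem, by rw [one_mul]⟩
  refine ⟨L, fun I hI => ⟨hL I hI, (hL I hI).sat s hs a
    (list_prod_subset hI (hL I hI).mul_mem hsa), ?_⟩, hLa⟩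
  rw [← List.prod_erase hI] at hsa hLa
  -- Here `x ∈ I`, and `b` lies in the product of the other factors. Every `y * b` with `y ∈ I` is
  -- locally a multiple of `a`, hence of `x * b`; cancelling `b` shows that `x` generates `I`
  -- locally.
  obtain ⟨x, hx, b, hb, hxb⟩ := hsa
  simp only at hxb
  have hbz : b ∉ zeroElts M := fun h => mul_notMem_zeroElts (fun h => hs (hzP h)) ha
    (hxb ▸ mul_mem_zeroElts_right h)
  refine ⟨x, hx, fun y hy => ?_, s, hs, b, hxb.symm⟩
  obtain ⟨t, ht, c, hc⟩ := hLa (Set.mul_mem_mul hy hb)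
  refine ⟨s * t, hP.mul_notMem hs ht, c, cancel hbz ?_⟩
  calc b * (s * t * y) = s * (t * (y * b)) := by ac_rfl
    _ = (s * a) * c := by rw [hc]; ac_rfl
    _ = b * (x * c) := by rw [← hxb]; ac_rfl

/-! ### Minimal primes over elements: local principality and maximality -/

/-- `L` is a minimal prime over `I`. -/
structure IsMinOver (L I : Set M) : Prop extends IsPrimeSet L where
  subset : I ⊆ L
  exists_mul_pow_mem : ∀ y ∈ L, ∃ s ∉ L, ∃ n : ℕ, s * y ^ n ∈ I

/-- Take the complement of a submonoid `S` maximal among those containing the complement of `P` and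
avoiding `I`. Adjoining any `y ∉ S` must meet `I`, which gives `s * y ^ n ∈ I` with `s ∈ S`. -/
theorem exists_isMinOver {P I : Set M} (hP : IsPrimeSet P) (hI : ∀ x ∈ I, ∀ y, x * y ∈ I)
    (hIP : I ⊆ P) : ∃ L ⊆ P, IsMinOver L I := by
  let C : Submonoid M :=
    { carrier := Pᶜ, one_mem' := hP.one_notMem, mul_mem' := fun h h' => hP.mul_notMem h h' }
  obtain ⟨S, hCS, hS⟩ := zorn_le_nonempty₀ {S : Submonoid M | ∀ x ∈ S, x ∉ I} (by
    intro c hc hcc S hSc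
    refine ⟨sSup c, fun x hx => ?_, fun T hT => le_sSup hT⟩
    obtain ⟨T, hT, hxT⟩ := (Submonoid.mem_sSup_of_directedOn ⟨S, hSc⟩ hcc.directedOn).1 hx
    exact hc hT x hxT) C (fun x hx hxI => hx (hIP hxI))
  have key : ∀ y ∉ S, ∃ s ∈ S, ∃ n : ℕ, s * y ^ n ∈ I := by
    intro y hy
    by_contra! hn
    refine hy (hS.le_of_ge (y := S ⊔ Submonoid.powers y) ?_ le_sup_left
      ((le_sup_right : Submonoid.powers y ≤ _) (Submonoid.mem_powers y)))
    intro x hx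
    obtain ⟨s, hs, w, ⟨n, rfl⟩, rfl⟩ := Submonoid.mem_sup.1 hx
    exact hn s hs n
  refine ⟨(S : Set M)ᶜ, fun x hx => ?_, ⟨⟨?_, ?_, ?_⟩, ?_, ?_⟩⟩
  · by_contra h
    exact hx (hCS h)
  · intro x hx y hxy
    obtain ⟨s, hs, n, hsx⟩ := key x hx
    refine hS.prop (s * (x * y) ^ n) (S.mul_mem hs (S.pow_mem hxy n)) ?_
    rw [mul_pow, ← mul_assoc]
    exact hI _ hsx _
  · exact fun h => h S.one_mem
  · intro x y hxy
    by_contra! hn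
    simp only [Set.mem_compl_iff, not_not] at hn
    exact hxy (S.mul_mem hn.1 hn.2)
  · exact fun x hx hxS => hS.prop x hxS hx
  · intro y hy
    obtain ⟨s, hs, n, h⟩ := key y hy
    exact ⟨s, fun h => h hs, n, h⟩

theorem pow_length_mem_list_prod {L : List (Set M)} {x : M} (h : ∀ I ∈ L, x ∈ I) :
    x ^ L.length ∈ L.prod := by
  induction L with
  | nil => simp
  | cons I L ih =>
    rw [List.length_cons, pow_succ', List.prod_cons]
    exact Set.mul_mem_mul (h I (by simp)) (ih fun J hJ => h J (by simp [hJ]))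

theorem IsPrimeSet.exists_subset_of_list_prod {L : List (Set M)} {Q : Set M} (hQ : IsPrimeSet Q)
    (h : L.prod ⊆ Q) : ∃ I ∈ L, I ⊆ Q := by
  by_contra! hn
  suffices ∃ w ∈ L.prod, w ∉ Q by
    obtain ⟨w, hw, hwQ⟩ := this
    exact hwQ (h hw)
  clear h
  induction L with
  | nil => exact ⟨1, by simp, hQ.one_notMem⟩
  | cons I L ih =>
    obtain ⟨w, hw, hwQ⟩ := ih fun J hJ => hn J (by simp [hJ])
    obtain ⟨i, hi, hiQ⟩ := Set.not_subset.1 (hn I (by simp))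
    rw [List.prod_cons]
    exact ⟨i * w, Set.mul_mem_mul hi hw, hQ.mul_notMem hiQ hwQ⟩

/-- From `s * y ^ n ∈ I₀ ⊆ I` with `s ∉ P`, saturation removes `s` and radicality removes the
exponent; for `n = 0` the ideal `I` is everything. -/
theorem IsMinOver.subset_of_isSatRadical {P I I₀ : Set M} (hP : IsMinOver P I₀)
    (hI : IsSatRadical P I) (h : I₀ ⊆ I) : P ⊆ I := fun y hy => by
  obtain ⟨s, hs, n, hsy⟩ := hP.exists_mul_pow_mem y hy
  have h1 := hI.sat s hs _ (h hsy)
  rcases Nat.eq_zero_or_pos n with rfl | hn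
  · rw [pow_zero] at h1
    rw [← one_mul y]
    exact hI.mul_mem 1 h1 y
  · exact hI.rad y n hn h1

/-- A minimal prime over an element is locally principal. -/
theorem IsWSP.exists_uniformizer (hM : IsWSP M) {P : Set M} (hg : GVFree P) {a : M}
    (ha : a ∉ zeroElts M) (hP : IsMinOver P {x | a ∣ x}) :
    ∃ π ∈ P, (∀ y ∈ P, ∃ t ∉ P, π ∣ t * y) ∧ ∃ n : ℕ, ∃ t ∉ P, a ∣ t * π ^ n := by
  have haP : a ∈ P := hP.subset (dvd_refl a)
  obtain ⟨L, hL, hLa⟩ := hM.exists_local_factorization hP.toIsPrimeSet hg ha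
    (hP.zeroElts_subset haP)
  have hPI : ∀ I ∈ L, P ⊆ I := fun I hI =>
    hP.subset_of_isSatRadical (hL I hI).1 fun x hx =>
      (hL I hI).1.mem_of_dvd (hL I hI).2.1 hx
  -- All factors contain `P`, and one of them is contained in `P` because their product is locally
  -- contained in `aM`. That factor is `P`, and it is locally principal.
  obtain ⟨I, hI, hIP⟩ := hP.toIsPrimeSet.exists_subset_of_list_prod (L := L) fun w hw => by
    obtain ⟨t, ht, hd⟩ := hLa w hw
    exact (hP.mem_or_mem _ _ (hP.mem_of_dvd haP hd)).resolve_left ht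
  obtain ⟨-, -, π, hπ, hπI, -⟩ := hL I hI
  refine ⟨π, hIP hπ, fun y hy => hπI y (hPI I hI hy), L.length, ?_⟩
  exact hLa _ (pow_length_mem_list_prod fun J hJ => hPI J hJ (hIP hπ))

/-- Up to multiples, each factor is `P` or the whole monoid; `j` counts factors contained in `P`. -/
theorem exists_pow_of_list {P : Set M} {L : List (Set M)}
    (h : ∀ I ∈ L, P ⊆ I ∧ ((1 : M) ∈ I ∨ I ⊆ P)) :
    ∃ j : ℕ, (∀ x ∈ L.prod, ∃ w ∈ P ^ j, w ∣ x) ∧ ∀ w ∈ P ^ j, ∃ u ∈ L.prod, u ∣ w := by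
  induction L with
  | nil =>
    exact ⟨0, fun x hx => ⟨x, by simpa using hx, dvd_rfl⟩,
      fun w hw => ⟨w, by simpa using hw, dvd_rfl⟩⟩
  | cons I L ih =>
    obtain ⟨j, h1, h2⟩ := ih fun J hJ => h J (by simp [hJ])
    rw [List.prod_cons]
    rcases h I (by simp) with ⟨hPI, h | h⟩
    · refine ⟨j, ?_, fun w hw => ?_⟩
      · rintro _ ⟨i, hi, l, hl, rfl⟩
        obtain ⟨w, hw, hd⟩ := h1 l hl
        exact ⟨w, hw, Dvd.dvd.mul_left hd i⟩
      · obtain ⟨u, hu, hd⟩ := h2 w hw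
        exact ⟨1 * u, Set.mul_mem_mul h hu, by rwa [one_mul]⟩
    · refine ⟨j + 1, ?_, fun w hw => ?_⟩
      · rintro _ ⟨i, hi, l, hl, rfl⟩
        obtain ⟨w, hw, hd⟩ := h1 l hl
        exact ⟨i * w, pow_succ' P j ▸ Set.mul_mem_mul (h hi) hw, mul_dvd_mul_left i hd⟩
      · rw [pow_succ'] at hw
        obtain ⟨p, hp, w, hw, rfl⟩ := hw
        obtain ⟨u, hu, hd⟩ := h2 w hw
        exact ⟨p * u, Set.mul_mem_mul (hPI hp) hu, mul_dvd_mul_left p hd⟩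

/-- Minimal primes over elements are maximal among the primes without finite `IsGV` sets. -/
theorem IsWSP.subset_of_isMinOver (hM : IsWSP M) {P₀ : Set M} (hP₀ : IsPrimeSet P₀)
    (hg₀ : GVFree P₀) {a : M} (ha : a ∉ zeroElts M) {L : Set M} (hLP₀ : L ⊆ P₀)
    (hL : IsMinOver L {x | a ∣ x}) : P₀ ⊆ L := by
  by_contra hne
  obtain ⟨b, hbP₀, hbL⟩ := Set.not_subset.1 hne
  have haL : a ∈ L := hL.subset (dvd_refl a)
  -- Taking `P` minimal over `L` and `b` ensures that every saturated radical ideal containing both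
  -- also contains `P`.
  obtain ⟨P, hPP₀, hP⟩ := exists_isMinOver hP₀ (I := L ∪ {x | b ∣ x})
    (by
      rintro x (hx | hx) y
      · exact Or.inl (hL.mul_mem x hx y)
      · exact Or.inr (Dvd.dvd.mul_right hx y))
    (Set.union_subset hLP₀ fun x hx => hP₀.mem_of_dvd hbP₀ hx)
  have hg := hg₀.mono hPP₀
  have hLP : L ⊆ P := fun x hx => hP.subset (Or.inl hx)
  have hbP : b ∈ P := hP.subset (Or.inr (dvd_refl b))
  have hzL := hL.zeroElts_subset haL
  have hLc : ∀ s ∉ P, s ∉ L := fun s hs h => hs (hLP h)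
  -- the saturated ideals generated by `L` and the powers of `b` are powers of `P`
  let J : ℕ → Set M := fun m => {x | ∃ s ∉ P, s * x ∈ L ∨ b ^ m ∣ s * x}
  let Q : ℕ → Set M := fun j => {x | ∃ s ∉ P, ∃ w ∈ P ^ j, w ∣ s * x}
  have hLJ : ∀ m, L ⊆ J m := fun m x hx => ⟨1, hP.one_notMem, Or.inl (by rwa [one_mul])⟩
  -- Each radical factor of `J (m + 1)` contains `L` and, being radical, `b`; so it contains `P` and
  -- is either `P` or everything.
  have hJQ : ∀ m, ∃ j, J (m + 1) = Q j := by
    intro m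
    obtain ⟨K, hK, hKJ, hJK⟩ := hM.exists_local_product hP.toIsPrimeSet hg (J := J (m + 1))
      (fun z hz => hLJ _ (hzL hz))
      (by
        rintro x ⟨s, hs, h⟩ y
        refine ⟨s, hs, ?_⟩
        rw [← mul_assoc]
        exact h.imp (fun h => hL.mul_mem _ h y) fun h => Dvd.dvd.mul_right h y)
      (by
        rintro s hs x ⟨t, ht, h⟩
        exact ⟨t * s, hP.mul_notMem ht hs, by rwa [mul_assoc]⟩)
    have hJI : ∀ I ∈ K, J (m + 1) ⊆ I := fun I hI x hx => by
      obtain ⟨s, hs, h⟩ := hJK x hx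
      exact (hK I hI).sat s hs x (list_prod_subset hI (hK I hI).mul_mem h)
    obtain ⟨j, h1, h2⟩ := exists_pow_of_list (P := P) (L := K) fun I hI => by
      refine ⟨hP.subset_of_isSatRadical (hK I hI) (Set.union_subset ?_ ?_), ?_⟩
      · exact (hLJ _).trans (hJI I hI)
      · intro x hx
        refine (hK I hI).mem_of_dvd ((hK I hI).rad b (m + 1) (by omega) (hJI I hI ?_)) hx
        exact ⟨1, hP.one_notMem, Or.inr (by rw [one_mul])⟩
      · by_cases h1 : (1 : M) ∈ I
        · exact Or.inl h1
        · exact Or.inr ((hK I hI).subset_of_one_notMem h1)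
    refine ⟨j, Set.Subset.antisymm (fun x hx => ?_) ?_⟩
    · obtain ⟨s, hs, h⟩ := hJK x hx
      obtain ⟨w, hw, hd⟩ := h1 _ h
      exact ⟨s, hs, w, hw, hd⟩
    · rintro x ⟨s, hs, w, hw, hd⟩
      obtain ⟨u, hu, hd'⟩ := h2 w hw
      obtain ⟨t, ht, h⟩ := hKJ hu
      obtain ⟨c, hc⟩ := hd'.trans hd
      refine ⟨t * s, hP.mul_notMem ht hs, ?_⟩
      rw [mul_assoc, hc, ← mul_assoc]
      exact h.imp (fun h => hL.mul_mem _ h c) fun h => Dvd.dvd.mul_right h c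
  choose j hj using hJQ
  have hQ : ∀ k l, k ≤ l → Q l ⊆ Q k := by
    rintro k l hkl x ⟨s, hs, w, hw, hd⟩
    obtain ⟨m, rfl⟩ := Nat.exists_eq_add_of_le hkl
    rw [pow_add] at hw
    obtain ⟨w₁, hw₁, w₂, hw₂, rfl⟩ := hw
    exact ⟨s, hs, w₁, hw₁, (dvd_mul_right w₁ w₂).trans hd⟩
  have hbz : b ∉ zeroElts M := fun h => hbL (hzL h)
  -- Otherwise `b ^ (m + 1)` would lie in `J (m + 2)`. As `b ∉ L`, this makes `b ^ (m + 2)` divide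
  -- `s * b ^ (m + 1)` for some `s ∉ P`, so `b ∣ s`. Strict growth gives `m ≤ j m`, hence `L` lies
  -- in every `Q m`.
  have hmono : StrictMono j := strictMono_nat_of_lt_succ fun m => by
    by_contra! hle
    have h1 : b ^ (m + 1) ∈ J (m + 1 + 1) := by
      rw [hj (m + 1)]
      refine hQ _ _ hle ?_
      rw [← hj m]
      exact ⟨1, hP.one_notMem, Or.inr (by rw [one_mul])⟩
    obtain ⟨s, hs, h | h⟩ := h1
    · rcases hL.mem_or_mem _ _ h with h | h
      · exact hLc s hs h
      · exact hbL (hL.mem_of_pow_mem h)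
    · rw [pow_succ, mul_comm s] at h
      exact hs (hP.mem_of_dvd hbP (dvd_cancel (pow_notMem_zeroElts hbz _) h))
  have hLQ : ∀ m, L ⊆ Q m := fun m x hx => by
    refine hQ m (j m) (hmono.le_apply) ?_
    rw [← hj m]
    exact hLJ _ hx
  -- an element of `L` that locally generates a radical ideal
  obtain ⟨K, hK, hKa⟩ := hM.exists_local_factorization hP.toIsPrimeSet hg ha (hzL.trans hLP)
  obtain ⟨I, hIK, hIL⟩ := hL.toIsPrimeSet.exists_subset_of_list_prod (L := K) fun w hw => by
    obtain ⟨t, ht, hd⟩ := hKa w hw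
    exact (hL.mem_or_mem _ _ (hL.mem_of_dvd haL hd)).resolve_left (hLc t ht)
  obtain ⟨hI, haI, r, hrI, hIr, s₀, hs₀, hrs₀⟩ := hK I hIK
  have hrz : r ∉ zeroElts M := notMem_zeroElts_of_dvd hrs₀
    (mul_notMem_zeroElts (fun h => hs₀ (hLP (hzL h))) ha)
  have hrL : r ∈ L := hIL hrI
  -- Minimality of `L` over `a ∈ I` brings a multiple of `y` by an element outside `L` into the
  -- radical ideal `I`, which `r` generates locally.
  have hLr : ∀ y ∈ L, ∃ u ∉ L, r ∣ u * y := by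
    intro y hy
    obtain ⟨u, hu, n, hn⟩ := hL.exists_mul_pow_mem y hy
    have h1 := hI.mem_of_dvd haI hn
    rcases Nat.eq_zero_or_pos n with rfl | hn
    · rw [pow_zero, mul_one] at h1
      exact absurd (hIL h1) hu
    · have h2 : (u * y) ^ n ∈ I := by
        obtain ⟨m, rfl⟩ := Nat.exists_eq_add_of_le' (show 1 ≤ n from hn)
        rw [mul_pow, pow_succ u, mul_assoc, mul_comm]
        exact hI.mul_mem _ h1 _
      obtain ⟨t, ht, hd⟩ := hIr _ (hI.rad _ n hn h2)
      exact ⟨t * u, hL.mul_notMem (hLc t ht) hu, by rwa [mul_assoc]⟩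
  -- If `y ∉ L`, then `t * y = b ^ 2 * d` with `t ∉ P`. The square of `x * b * d` is a multiple of
  -- `r`, so `x * b * d ∈ I` is locally divisible by `r`. Multiplying by `b` and cancelling `r`
  -- gives a multiple of `b` outside `P`.
  have h_factor : ∀ s ∉ P, ∀ x y, y ∈ J (1 + 1) → s * r = x * y → y ∈ L := by
    rintro s hs x y ⟨t, ht, hy⟩ he
    by_contra hyL
    obtain ⟨d, hd⟩ := hy.resolve_left (hL.mul_notMem (hLc t ht) hyL)
    have e1 : t * s * r = x * (b ^ (1 + 1) * d) := by rw [← hd, mul_assoc, he]; ac_rfl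
    have e2 : b ^ (1 + 1) = b * b := pow_two b
    have hq : (x * b * d) ^ 2 ∈ I := by
      have : (x * b * d) ^ 2 = r * (t * s * x * d) := by
        calc (x * b * d) ^ 2 = x * (b * b * d) * (x * d) := by rw [pow_two]; ac_rfl
          _ = r * (t * s * x * d) := by rw [← e2, ← e1]; ac_rfl
      rw [this]
      exact hI.mul_mem r hrI _
    obtain ⟨u, hu, e, hue⟩ := hIr _ (hI.rad _ 2 (by omega) hq)
    refine hP.mul_notMem hu (hP.mul_notMem ht hs) ?_
    have : u * (t * s) = b * e := by
      refine cancel hrz ?_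
      calc r * (u * (t * s)) = u * (t * s * r) := by ac_rfl
        _ = (u * (x * b * d)) * b := by rw [e1, e2]; ac_rfl
        _ = r * (b * e) := by rw [hue]; ac_rfl
    rw [this]
    exact hP.mul_mem b hbP e
  -- The exponent `j 1 + j 1` splits `s * r` into two factors from `P ^ j 1`, both contained in `J
  -- 2`. So both lie in `L`, and locally at `L` each is divisible by `r`: then `r ^ 2` divides `r`
  -- times an element outside `L`.
  obtain ⟨s, hs, w, hw, c, hc⟩ := hLQ (j 1 + j 1) hrL
  rw [pow_add] at hw
  obtain ⟨x, hx, y, hy, rfl⟩ := hw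
  simp only at hc
  have hQJ : ∀ x ∈ P ^ j 1, x ∈ J (1 + 1) := fun x hx => by
    rw [hj 1]
    exact ⟨1, hP.one_notMem, x, hx, by rw [one_mul]⟩
  have hyL := h_factor s hs (x * c) y (hQJ y hy) (by rw [hc]; ac_rfl)
  have hxL := h_factor s hs (y * c) x (hQJ x hx) (by rw [hc]; ac_rfl)
  obtain ⟨u, hu, x', hx'⟩ := hLr x hxL
  obtain ⟨u', hu', y', hy'⟩ := hLr y hyL
  refine hL.mul_notMem (hL.mul_notMem hu hu') (hLc s hs) ?_
  have : u * u' * s = r * (x' * y' * c) := by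
    refine cancel hrz ?_
    calc r * (u * u' * s) = u * u' * (s * r) := by ac_rfl
      _ = (u * x) * (u' * y) * c := by rw [hc]; ac_rfl
      _ = r * (r * (x' * y' * c)) := by rw [hx', hy']; ac_rfl
  rw [this]
  exact hL.mul_mem r hrL _

/-- By maximality of minimal primes, `P` is minimal over each of its nonzero elements, so each of
them comes with a local generator of `P` having a power it locally divides. All these generators are
compared with one fixed `π`. -/
theorem IsWSP.exists_isVal (hM : IsWSP M) {P : Set M} (hP : IsPrimeSet P) (hg : GVFree P)
    (h : ∃ a ∈ P, a ∉ zeroElts M) : ∃ v, IsVal P v := by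
  have key : ∀ a ∈ P, a ∉ zeroElts M → IsMinOver P {x | a ∣ x} := by
    intro a haP ha
    obtain ⟨L, hLP, hL⟩ := exists_isMinOver hP (I := {x | a ∣ x})
      (fun x hx y => Dvd.dvd.mul_right hx y) (fun x hx => hP.mem_of_dvd haP hx)
    rwa [(hM.subset_of_isMinOver hP hg ha hLP hL).antisymm hLP]
  obtain ⟨a, haP, ha⟩ := h
  obtain ⟨π, hπ, hπP, n, t, ht, hd⟩ := hM.exists_uniformizer hg ha (key a haP ha)
  have hzP := hP.zeroElts_subset haP
  have hπz : π ∉ zeroElts M := by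
    obtain ⟨s, hs, hd⟩ := hπP a haP
    exact notMem_zeroElts_of_dvd hd (mul_notMem_zeroElts (fun h => hs (hzP h)) ha)
  refine WSP.exists_isVal hP hπ hπz hπP fun a ha => ?_
  by_cases haP : a ∈ P
  · obtain ⟨π', hπ', hπP', n, t, ht, hd⟩ := hM.exists_uniformizer hg ha (key a haP ha)
    obtain ⟨s, hs, hπ⟩ := hπP' π hπ
    refine ⟨n, t * s ^ n, hP.mul_notMem ht fun h => hs (hP.mem_of_pow_mem h), hd.trans ?_⟩
    rw [mul_assoc, ← mul_pow]
    exact mul_dvd_mul_left _ (pow_dvd_pow_of_dvd hπ n)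
  · exact ⟨0, a, haP, by simp⟩

/-! ### Factorization of values -/

section Values

variable {v : M → ℕ∞} (hmul : ∀ x y, v (x * y) = v x + v y) (h1 : v 1 = 0)
include hmul h1

theorem exists_mem_list_prod_eq_sum {Ts : List (Finset M)} {L : List (Set M)}
    (h : List.Forall₂ (fun (T : Finset M) (I : Set M) => T.Nonempty ∧ (T : Set M) ⊆ I) Ts L) :
    ∃ w ∈ L.prod, v w = (Ts.map fun T => T.inf v).sum := by
  induction h with
  | nil => exact ⟨1, by simp, by simpa using h1⟩
  | @cons T I Ts L hTI _ ih =>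
    obtain ⟨w, hw, hvw⟩ := ih
    obtain ⟨t, ht, hvt⟩ := Finset.exists_mem_eq_inf T hTI.1 v
    rw [List.prod_cons]
    refine ⟨t * w, Set.mul_mem_mul (hTI.2 (Finset.mem_coe.2 ht)) hw, ?_⟩
    rw [hmul, List.map_cons, List.sum_cons, hvt, hvw]

/-- Swapping the minimal element of one `T` for some `y ∈ I` with `v y ≤ 1` gives another element of
the product, whose value may not drop below `C`; hence `T.inf v ≤ v y`. The offset `D` collects the
minima of the factors already passed in the induction. -/
theorem forall_inf_le_one {Ts : List (Finset M)} {L : List (Set M)}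
    (h : List.Forall₂ (fun (T : Finset M) (I : Set M) => T.Nonempty ∧ (T : Set M) ⊆ I) Ts L)
    (hI : ∀ I ∈ L, ∃ y ∈ I, v y ≤ 1) {C D : ℕ∞} (hC : C ≠ ⊤) (hL : ∀ w ∈ L.prod, C ≤ v w + D)
    (hs : (Ts.map fun T => T.inf v).sum + D ≤ C) : ∀ T ∈ Ts, T.inf v ≤ 1 := by
  induction h generalizing D with
  | nil => simp
  | @cons T I Ts L hTI hTL ih =>
    rw [List.map_cons, List.sum_cons] at hs
    intro T' hT'
    rcases List.mem_cons.1 hT' with rfl | hT'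
    · obtain ⟨w, hw, hvw⟩ := exists_mem_list_prod_eq_sum hmul h1 hTL
      obtain ⟨y, hy, hvy⟩ := hI I (by simp)
      have h3 := hL (y * w) (by rw [List.prod_cons]; exact Set.mul_mem_mul hy hw)
      have h4 := hs.trans h3
      rw [hmul, hvw, add_assoc, add_assoc] at h4
      refine le_trans ?_ hvy
      refine (ENat.add_le_add_iff_right ?_).1 h4
      intro htop
      refine hC (top_le_iff.1 (le_trans ?_ hs))
      rw [add_assoc, htop, add_top]
    · refine ih (D := T.inf v + D) (fun J hJ => hI J (by simp [hJ])) (fun w hw => ?_) ?_ T' hT'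
      · obtain ⟨t, ht, hvt⟩ := Finset.exists_mem_eq_inf T hTI.1 v
        have h3 := hL (t * w) (by
          rw [List.prod_cons]; exact Set.mul_mem_mul (hTI.2 (Finset.mem_coe.2 ht)) hw)
        rw [hmul, ← hvt] at h3
        calc C ≤ _ := h3
          _ = _ := by ring
      · calc _ = T.inf v + (Ts.map fun T => T.inf v).sum + D := by ring
          _ ≤ C := hs

end Values

/-- Write each `w ∈ W` as a product along `L`, and let each `T` collect the components in one
factor. -/
theorem exists_forall₂_of_subset_list_prod {L : List (Set M)} {W : Finset M} (hW : W.Nonempty)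
    (h0 : ∀ w ∈ W, w ∉ zeroElts M) (hWL : (W : Set M) ⊆ L.prod) :
    ∃ Ts : List (Finset M), List.Forall₂ (fun (T : Finset M) (I : Set M) => T.Nonempty ∧ (T : Set M) ⊆ I) Ts L ∧
      (∀ T ∈ Ts, ∀ t ∈ T, t ∉ zeroElts M) ∧
      ∀ v : M → ℕ∞, (∀ x y, v (x * y) = v x + v y) →
        (Ts.map fun T => T.inf v).sum ≤ W.inf v := by
  classical
  induction L generalizing W with
  | nil => exact ⟨[], by simp, by simp, by simp⟩
  | cons I L ih =>
    rw [List.prod_cons] at hWL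
    have : ∀ w ∈ W, ∃ i l, i ∈ I ∧ l ∈ L.prod ∧ i * l = w := fun w hw => by
      obtain ⟨i, hi, l, hl, h⟩ := hWL (Finset.mem_coe.2 hw)
      exact ⟨i, l, hi, hl, h⟩
    choose! i l hi hl he using this
    obtain ⟨Ts, hTs, hTs0, hTsv⟩ := ih (W := W.image l) (hW.image l)
      (by
        intro w' hw'
        obtain ⟨w, hw, rfl⟩ := Finset.mem_image.1 hw'
        exact notMem_zeroElts_of_dvd ⟨i w, by rw [mul_comm]; exact (he w hw).symm⟩ (h0 w hw))
      (by
        intro w' hw'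
        obtain ⟨w, hw, rfl⟩ := Finset.mem_image.1 (Finset.mem_coe.1 hw')
        exact hl w hw)
    refine ⟨W.image i :: Ts, List.Forall₂.cons ⟨hW.image i, ?_⟩ hTs, ?_, fun v hv => ?_⟩
    · intro w' hw'
      obtain ⟨w, hw, rfl⟩ := Finset.mem_image.1 (Finset.mem_coe.1 hw')
      exact hi w hw
    · intro T hT
      rcases List.mem_cons.1 hT with rfl | hT
      · intro t ht
        obtain ⟨w, hw, rfl⟩ := Finset.mem_image.1 ht
        exact notMem_zeroElts_of_dvd ⟨l w, (he w hw).symm⟩ (h0 w hw)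
      · exact hTs0 T hT
    · rw [List.map_cons, List.sum_cons]
      refine Finset.le_inf fun w hw => ?_
      rw [← he w hw, hv]
      exact add_le_add (Finset.inf_le (Finset.mem_image_of_mem i hw))
        ((hTsv v hv).trans (Finset.inf_le (Finset.mem_image_of_mem l hw)))

/-- A `w`-SP-monoid has a family of valuations as in `DivFamily`. -/
theorem IsWSP.divFamily (hM : IsWSP M) : DivFamily (valSet M) := by
  classical
  have hV := preDivFamily_valSet fun P hP hg h => hM.exists_isVal hP hg h
  refine hV.divFamily fun a ha => ?_
  obtain ⟨L, hL, hLI, haL⟩ := hM {x | a ∣ x} (isRIdeal_wSys_of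
    (fun z hz => dvd_of_mem_zeroElts hz) (fun x hx y => Dvd.dvd.mul_right hx y)
    fun E hf hE x hx => hE.2 x a hx)
  have haw : a ∈ wSys L.prod := haL ▸ dvd_refl a
  have hLa : ∀ w ∈ L.prod, a ∣ w := fun w hw => by
    have : w ∈ {x | a ∣ x} := haL ▸ subset_wSys hw
    exact this
  obtain ⟨E, hf, hE, hEL⟩ := mem_wSys_iff.1 haw
  have : ∀ e ∈ E, e ∉ zeroElts M → ∃ w ∈ L.prod, w ∣ a * e := fun e he hez =>
    (mem_sSys_iff.1 (hEL e he)).resolve_right (mul_notMem_zeroElts ha hez)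
  choose! w hw hwd using this
  obtain ⟨e₀, he₀, he₀z⟩ := hE.1
  obtain ⟨Ts, hTs, hTs0, hTsv⟩ := exists_forall₂_of_subset_list_prod (L := L)
    (W := (hf.toFinset.filter (· ∉ zeroElts M)).image w)
    ⟨w e₀, Finset.mem_image_of_mem w (by simp [he₀, he₀z])⟩
    (by
      intro x hx
      obtain ⟨e, he, rfl⟩ := Finset.mem_image.1 hx
      simp only [Finset.mem_filter, Set.Finite.mem_toFinset] at he
      exact notMem_zeroElts_of_dvd (hwd e he.1 he.2) (mul_notMem_zeroElts ha he.2))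
    (by
      intro x hx
      obtain ⟨e, he, rfl⟩ := Finset.mem_image.1 (Finset.mem_coe.1 hx)
      simp only [Finset.mem_filter, Set.Finite.mem_toFinset] at he
      exact hw e he.1 he.2)
  -- The element `a` divides every member of `L.prod`, which gives `≤`. Conversely, an `e ∈ E`
  -- outside the prime has value zero, and the element `w e` divides `a * e`.
  have hsum : ∀ v ∈ valSet M, v a = (Ts.map fun T => T.inf v).sum := by
    rintro v ⟨P, hP, hg, hv⟩
    have hv1 : v 1 = 0 := (hv.eq_zero 1).2 hP.one_notMem
    refine le_antisymm ?_ ?_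
    · obtain ⟨x, hx, hvx⟩ := exists_mem_list_prod_eq_sum hv.map_mul hv1 hTs
      rw [← hvx]
      obtain ⟨c, rfl⟩ := hLa x hx
      rw [hv.map_mul]
      exact le_self_add
    · obtain ⟨e, he, heP⟩ := Set.not_subset.1 (hg E hf hE)
      have hev := (hv.eq_zero e).2 heP
      have hez : e ∉ zeroElts M := fun hz => by
        rw [(hv.eq_top e).2 hz] at hev; simp at hev
      refine (hTsv v hv.map_mul).trans ((Finset.inf_le (Finset.mem_image_of_mem w (a := e)
        (by simp [he, hez]))).trans ?_)
      obtain ⟨c, hc⟩ := hwd e he hez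
      have := congrArg v hc
      rw [hv.map_mul, hv.map_mul, hev, add_zero] at this
      rw [this]
      exact le_self_add
  have hmem : ∀ T ∈ Ts, T.Nonempty ∧ ∃ I ∈ L, (T : Set M) ⊆ I := by
    clear hsum hTsv hTs0 haw hLa hEL hw hwd haL hLI hL
    induction hTs with
    | nil => simp
    | cons h _ ih =>
      intro T hT
      rcases List.mem_cons.1 hT with rfl | hT
      · exact ⟨h.1, _, by simp, h.2⟩
      · obtain ⟨h1, I, hI, h2⟩ := ih T hT
        exact ⟨h1, I, by simp [hI], h2⟩
  have hex : ∀ I ∈ L, ∃ x ∈ I, x ∉ zeroElts M := by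
    intro I hI
    by_contra! hn
    have h1 : L.prod ⊆ zeroElts M :=
      (list_prod_subset hI fun x hx y => (hLI I hI).1.mul_mem hx y).trans hn
    have h2 := wSys_mono h1 haw
    rw [show wSys (zeroElts M) = zeroElts M from isRIdeal_zeroElts] at h2
    exact ha h2
  refine ⟨Ts.map fun T v => T.inf v, ?_, fun v hv => ?_⟩
  · intro φ hφ
    obtain ⟨T, hT, rfl⟩ := List.mem_map.1 hφ
    refine ⟨⟨T, (hmem T hT).1, hTs0 T hT, fun _ _ => rfl⟩, ?_⟩
    intro v hvV
    obtain ⟨P, hP, hg, hv⟩ := id hvV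
    have hv1 : v 1 = 0 := (hv.eq_zero 1).2 hP.one_notMem
    refine forall_inf_le_one hv.map_mul hv1 hTs (C := v a) (D := 0) (fun I hI => ?_)
      (fun h => ha ((hv.eq_top a).1 h)) (fun x hx => ?_) ?_ T hT
    · obtain ⟨x, hx, hxz⟩ := hex I hI
      exact hv.exists_le_one hP (fun x hx y => (hLI I hI).1.mul_mem hx y)
        (fun x n hn h => (hLI I hI).2.mem_of_pow_mem hn h) hx hxz
    · rw [add_zero]
      obtain ⟨c, rfl⟩ := hLa x hx
      rw [hv.map_mul]
      exact le_self_add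
    · rw [add_zero, hsum v hvV]
  · rw [hsum v hv, List.map_map]
    rfl

/-! ### Stable greatest common divisors -/

section Gcd

variable {M : Type*} [CommMonoid M] [IsCancelOffZero M]

/-- `d` is a stable greatest common divisor of `T`: for all `y`, the common divisors of `y * T` are
the divisors of `y * d`. -/
def IsSG (T : Set M) (d : M) : Prop := ∀ y b : M, (∀ t ∈ T, b ∣ y * t) ↔ b ∣ y * d

namespace IsSG

variable {S T : Set M} {d e : M}

theorem mul (hS : IsSG S d) (hT : IsSG T e) : IsSG (S * T) (d * e) := by
  intro y b
  rw [← mul_assoc, ← hT (y * d) b]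
  constructor
  · intro h t ht
    rw [mul_right_comm, ← hS]
    intro s hs
    rw [mul_right_comm, mul_assoc]
    exact h _ (Set.mul_mem_mul hs ht)
  · rintro h _ ⟨s, hs, t, ht, rfl⟩
    have := h t ht
    rw [mul_right_comm, ← hS] at this
    simpa only [mul_assoc, mul_comm, mul_left_comm] using this s hs

theorem dvd (hT : IsSG T d) {t : M} (ht : t ∈ T) : d ∣ t := by
  simpa using (hT 1 d).2 (by simp) t ht

theorem dvd_of_isSG (hT : IsSG T d) (hT' : IsSG T e) : d ∣ e := by
  have := (hT' 1 d).1 fun t ht => by simpa using hT.dvd ht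
  simpa using this

theorem one : IsSG ({1} : Set M) 1 := by
  intro y b
  simp

end IsSG

/-- Stable greatest common divisors of pairs of nonzero elements exist. -/
def HasSG (M : Type*) [CommMonoid M] : Prop :=
  ∀ a b : M, a ∉ zeroElts M → b ∉ zeroElts M → ∃ d, IsSG {a, b} d

theorem IsSG.notMem_zeroElts {T : Set M} {d : M} (hT : IsSG T d) {t : M} (ht : t ∈ T)
    (htz : t ∉ zeroElts M) : d ∉ zeroElts M :=
  notMem_zeroElts_of_dvd (hT.dvd ht) htz

theorem HasSG.exists_isSG (h : HasSG M) {T : Finset M} (hT : T.Nonempty)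
    (h0 : ∀ t ∈ T, t ∉ zeroElts M) : ∃ d, d ∉ zeroElts M ∧ IsSG (T : Set M) d := by
  induction hT using Finset.Nonempty.cons_induction with
  | singleton a => exact ⟨a, h0 a (by simp), fun y b => by simp⟩
  | cons a s ha hs ih =>
    obtain ⟨d, hd0, hd⟩ := ih fun t ht => h0 t (by simp [ht])
    have ha0 := h0 a (by simp)
    obtain ⟨e, he⟩ := h a d ha0 hd0
    refine ⟨e, he.notMem_zeroElts (t := a) (by simp) ha0, fun y b => ?_⟩
    rw [← he y b, Finset.coe_cons]
    simp only [Set.mem_insert_iff, forall_eq_or_imp, Set.mem_singleton_iff, forall_eq, hd y b]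

theorem IsSG.exists_isGV {a b d : M} (ha : a ∉ zeroElts M) (h : IsSG {a, b} d) :
    ∃ a' b', a = d * a' ∧ b = d * b' ∧ IsGV {a', b'} := by
  have hd0 : d ∉ zeroElts M := h.notMem_zeroElts (t := a) (by simp) ha
  obtain ⟨a', rfl⟩ := h.dvd (t := a) (by simp)
  obtain ⟨b', rfl⟩ := h.dvd (t := b) (by simp)
  refine ⟨a', b', rfl, rfl, ⟨a', by simp, fun hz => ha (mul_mem_zeroElts_right hz)⟩, ?_⟩
  intro y c hc
  refine dvd_cancel hd0 ?_
  rw [mul_comm d y, ← h]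
  intro t ht
  simp only [Set.mem_insert_iff, Set.mem_singleton_iff] at ht
  rcases ht with rfl | rfl
  · rw [mul_left_comm]; exact mul_dvd_mul_left d (hc a' (by simp))
  · rw [mul_left_comm]; exact mul_dvd_mul_left d (hc b' (by simp))

namespace DivFamily

variable {V : Set (M → ℕ∞)} (hV : DivFamily V)
include hV

theorem isSG {T : Finset M} (hT : T.Nonempty) (h0 : ∀ t ∈ T, t ∉ zeroElts M) {d : M}
    (hd : d ∉ zeroElts M) (h : ∀ v ∈ V, T.inf v = v d) : IsSG (T : Set M) d := by
  intro y b
  by_cases hb : b ∈ zeroElts M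
  · have key : ∀ t, t ∉ zeroElts M → (b ∣ y * t ↔ y ∈ zeroElts M) := by
      refine fun t ht => ⟨fun h => ?_, fun h => dvd_of_mem_zeroElts (mul_mem_zeroElts_left h)⟩
      exact (mul_mem_zeroElts_iff.1 (mem_zeroElts_of_dvd h hb)).resolve_right ht
    rw [key d hd]
    obtain ⟨t, ht⟩ := hT
    exact ⟨fun h => (key t (h0 t ht)).1 (h t ht), fun h t ht => (key t (h0 t ht)).2 h⟩
  · refine (hV.dvd_iff_le hT (φ := fun v => v d) h hb).trans ?_
    refine ⟨fun hle => hV.dvd_of_le _ _ hb fun v hv => ?_, fun hbd v hv => ?_⟩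
    · rw [hV.map_mul v hv]; exact hle v hv
    · rw [← hV.map_mul v hv]; exact hV.le_of_dvd hv hbd

/-- If `S` represents `v t - T.inf v`, then `t` divides `s * u` for all `s ∈ S` and `u ∈ T`.
Stability of the gcd under the multiplier `s` gives `t ∣ s * d`, and a minimal `s` shows `T.inf v ≤
v d`. -/
theorem inf_eq_of_isSG {T : Finset M} (hT : T.Nonempty) (h0 : ∀ t ∈ T, t ∉ zeroElts M) {d : M}
    (hd : IsSG (T : Set M) d) {v : M → ℕ∞} (hv : v ∈ V) : T.inf v = v d := by
  refine le_antisymm ?_ (Finset.le_inf fun t ht => hV.le_of_dvd hv (hd.dvd (by simpa using ht)))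
  obtain ⟨t, ht⟩ := hT
  have hR : Rep V fun v => T.inf v := ⟨T, ⟨t, ht⟩, h0, fun _ _ => rfl⟩
  obtain ⟨S, hS, hS0, hSv⟩ := hV.rep_sub (Rep.eval (h0 t ht)) hR
  have key : ∀ s ∈ S, t ∣ s * d := fun s hs => by
    rw [← hd]
    intro u hu
    refine hV.dvd_of_le _ _ (h0 t ht) fun w hw => ?_
    rw [hV.map_mul w hw]
    have h1 : w t - T.inf w ≤ w s := (hSv w hw).symm.trans_le (Finset.inf_le hs)
    have h2 : T.inf w ≤ w u := Finset.inf_le (by simpa using hu)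
    exact le_tsub_add.trans (add_le_add h1 h2)
  obtain ⟨s, hs, hse⟩ := Finset.exists_mem_eq_inf S hS v
  have h1 := hV.le_of_dvd hv (key s hs)
  rw [hV.map_mul v hv, ← hse] at h1
  have h2 : S.inf v = v t - T.inf v := hSv v hv
  have h3 : T.inf v ≤ v t := Finset.inf_le ht
  have h4 := hV.ne_top hv (h0 t ht)
  rw [h2] at h1
  have h5 : v t - T.inf v ≠ ⊤ := ne_top_of_le_ne_top h4 tsub_le_self
  refine (ENat.add_le_add_iff_left h5).1 (le_trans (le_of_eq ?_) h1)
  exact tsub_add_cancel_of_le h3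

end DivFamily

end Gcd

/-! ### Localizations and radical factorizations of their elements -/

section Localization

variable {A B : Type*} [CommMonoid A] [IsCancelOffZero A] [CommMonoid B] [IsCancelOffZero B]

/-- `ι` is a localization of `A` at `S`. -/
structure IsLoc (S : Submonoid A) (ι : A →* B) : Prop where
  injective : Function.Injective ι
  isUnit : ∀ s ∈ S, IsUnit (ι s)
  surj : ∀ q, ∃ s ∈ S, ∃ a, ι s * q = ι a

namespace IsLoc

variable {S : Submonoid A} {ι : A →* B} (h : IsLoc S ι)
include h

theorem mem_zeroElts_iff {a : A} : ι a ∈ zeroElts B ↔ a ∈ zeroElts A := by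
  refine ⟨fun ha x => h.injective ?_, fun ha q => ?_⟩
  · rw [map_mul, ha]
  · obtain ⟨s, hs, x, hx⟩ := h.surj q
    refine (h.isUnit s hs).mul_left_cancel ?_
    rw [mul_left_comm, hx, ← map_mul, ha x, ← map_mul, mul_comm s, ha s]

theorem dvd_iff {a b : A} : ι a ∣ ι b ↔ ∃ s ∈ S, a ∣ s * b := by
  constructor
  · rintro ⟨q, hq⟩
    obtain ⟨s, hs, x, hx⟩ := h.surj q
    refine ⟨s, hs, x, h.injective ?_⟩
    rw [map_mul, map_mul, hq, mul_left_comm, hx]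
  · rintro ⟨s, hs, hd⟩
    have := map_dvd ι hd
    rw [map_mul] at this
    exact (h.isUnit s hs).dvd_mul_left.1 this

theorem exists_associated (q : B) : ∃ a, Associated q (ι a) := by
  obtain ⟨s, hs, a, ha⟩ := h.surj q
  obtain ⟨u, hu⟩ := h.isUnit s hs
  exact ⟨a, u, by rw [hu, mul_comm, ha]⟩

theorem exists_forall_dvd {T : Finset A} {a x : A} (hd : ∀ t ∈ T, ι a ∣ ι (x * t)) :
    ∃ s ∈ S, ∀ t ∈ T, a ∣ s * x * t := by
  classical
  have : ∀ t ∈ T, ∃ s ∈ S, a ∣ s * (x * t) := fun t ht => h.dvd_iff.1 (hd t ht)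
  choose! s hs hd using this
  refine ⟨∏ t ∈ T, s t, S.prod_mem fun t ht => hs t ht, fun t ht => ?_⟩
  rw [mul_assoc]
  exact (hd t ht).trans (mul_dvd_mul_right (Finset.dvd_prod_of_mem s ht) _)

/-- Finiteness of `T` provides a common denominator, after which the multiplier in the definition of
`IsSG` absorbs it. -/
theorem isSG_image {T : Finset A} {d : A} (hT : IsSG (T : Set A) d) :
    IsSG (ι '' (T : Set A)) (ι d) := by
  intro y b
  obtain ⟨y', hy⟩ := h.exists_associated y
  obtain ⟨b', hb⟩ := h.exists_associated b
  have key : ∀ x, b ∣ y * ι x ↔ ι b' ∣ ι (y' * x) := fun x => by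
    rw [map_mul]
    exact hb.dvd_iff_dvd_left.trans (hy.mul_right (ι x)).dvd_iff_dvd_right
  rw [Set.forall_mem_image, key]
  simp only [key]
  constructor
  · intro hd
    obtain ⟨s, hs, hd⟩ := h.exists_forall_dvd (T := T) (x := y') fun t ht => hd ht
    rw [h.dvd_iff]
    refine ⟨s, hs, ?_⟩
    rw [← mul_assoc]
    exact (hT _ _).1 fun t ht => hd t (by simpa using ht)
  · intro hd t ht
    refine hd.trans ?_
    rw [map_mul, map_mul]
    exact mul_dvd_mul_left _ (map_dvd ι (hT.dvd ht))

end IsLoc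

/-- The principal ideal of `r` is radical. -/
def IsRadElt {M : Type*} [CommMonoid M] (r : M) : Prop := ∀ x : M, ∀ n, 1 ≤ n → r ∣ x ^ n → r ∣ x

namespace DivFamily

variable {V : Set (A → ℕ∞)} (hV : DivFamily V) {S : Submonoid A} {ι : A →* B} (hι : IsLoc S ι)
  (hB : HasSG B)
include hV hι hB

/-- Complement `T` by a set `U` representing `v t₀ - T.inf v`, so that `T * U` has stable gcd `t₀`.
If `u` is the gcd of `ι '' U`, then `r * u` is associated to `ι t₀`, and `r ∣ ι x` becomes
divisibility of `ι x * u` by `ι t₀`, which values in `A` control. -/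
theorem dvd_map_iff {T : Finset A} (hT : T.Nonempty) (h0 : ∀ t ∈ T, t ∉ zeroElts A) {r : B}
    (hr : IsSG (ι '' (T : Set A)) r) (x : A) :
    r ∣ ι x ↔ ∃ s ∈ S, ∀ v ∈ V, T.inf v ≤ v (s * x) := by
  classical
  obtain ⟨t₀, ht₀⟩ := id hT
  have ht₀z := h0 t₀ ht₀
  have hR : Rep V fun v => T.inf v := ⟨T, hT, h0, fun _ _ => rfl⟩
  obtain ⟨U, hU, hU0, hUv⟩ := hV.rep_sub (Rep.eval ht₀z) hR
  have hsum : ∀ v ∈ V, T.inf v + U.inf v = v t₀ := fun v hv => by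
    rw [show U.inf v = v t₀ - T.inf v from hUv v hv]
    exact add_tsub_cancel_of_le (Finset.inf_le ht₀)
  have h1 : IsSG ((T * U : Finset A) : Set A) t₀ := hV.isSG (hT.mul hU)
    (fun x hx => by
      obtain ⟨t, ht, u, hu, rfl⟩ := Finset.mem_mul.1 hx
      exact mul_notMem_zeroElts (h0 t ht) (hU0 u hu)) ht₀z
    fun v hv => by rw [hV.inf_mul hv hT hU, hsum v hv]
  have h2 := hι.isSG_image h1
  rw [Finset.coe_mul, Set.image_mul] at h2
  obtain ⟨u, hu0, hu⟩ := hB.exists_isSG (T := U.image ι) (hU.image ι) (by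
    intro b hb
    obtain ⟨x, hx, rfl⟩ := Finset.mem_image.1 hb
    exact fun h => hU0 x hx (hι.mem_zeroElts_iff.1 h))
  rw [Finset.coe_image] at hu
  have h3 := hr.mul hu
  have h4 := h2.dvd_of_isSG h3
  have h5 := h3.dvd_of_isSG h2
  have h6 : r ∣ ι x ↔ ι t₀ ∣ ι x * u := by
    constructor
    · exact fun h => h4.trans (mul_dvd_mul_right h u)
    · intro h
      have := h5.trans h
      rw [mul_comm r, mul_comm (ι x)] at this
      exact dvd_cancel hu0 this
  rw [h6, ← hu (ι x), Set.forall_mem_image]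
  have h7 : ∀ s : A, (∀ t ∈ U, t₀ ∣ s * x * t) ↔ ∀ v ∈ V, T.inf v ≤ v (s * x) := by
    intro s
    rw [hV.dvd_iff_le hU hUv ht₀z]
    refine forall₂_congr fun v hv => ?_
    rw [show v t₀ - T.inf v = U.inf v from (hUv v hv).symm, ← hsum v hv]
    have hne : U.inf v ≠ ⊤ := fun h => hV.ne_top hv ht₀z (by rw [← hsum v hv, h, add_top])
    exact ENat.add_le_add_iff_right hne
  constructor
  · intro h
    obtain ⟨s, hs, h⟩ := hι.exists_forall_dvd (T := U) (a := t₀) (x := x) fun t ht => by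
      rw [map_mul]; exact h (by simpa using ht)
    exact ⟨s, hs, (h7 s).1 h⟩
  · rintro ⟨s, hs, h⟩ t ht
    rw [← map_mul, hι.dvd_iff]
    exact ⟨s, hs, by rw [← mul_assoc]; exact (h7 s).2 h t (by simpa using ht)⟩

theorem isRadElt_of_le_one {T : Finset A} (hT : T.Nonempty) (h0 : ∀ t ∈ T, t ∉ zeroElts A)
    (h1 : ∀ v ∈ V, T.inf v ≤ 1) {r : B} (hr : IsSG (ι '' (T : Set A)) r) : IsRadElt r := by
  intro y n hn hd
  obtain ⟨x, hx⟩ := hι.exists_associated y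
  rw [hx.dvd_iff_dvd_right, hV.dvd_map_iff hι hB hT h0 hr]
  rw [(hx.pow_pow (n := n)).dvd_iff_dvd_right, ← map_pow,
    hV.dvd_map_iff hι hB hT h0 hr] at hd
  obtain ⟨s, hs, hd⟩ := hd
  refine ⟨s, hs, fun v hv => ?_⟩
  have := hd v hv
  rw [hV.map_mul v hv, hV.map_pow hv] at this
  rw [hV.map_mul v hv]
  rcases eq_or_ne (v x) 0 with h | h
  · rw [h, mul_zero] at this
    rwa [h]
  · exact (h1 v hv).trans ((Order.one_le_iff_pos.2 (pos_iff_ne_zero.2 h)).trans le_add_self)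

/-- Localizations with stable greatest common divisors factor into radical elements. -/
theorem exists_radElt_factorization {f : B} (hf : f ∉ zeroElts B) :
    ∃ L : List B, (∀ r ∈ L, IsRadElt r) ∧ L.prod ∣ f ∧ f ∣ L.prod := by
  classical
  obtain ⟨a, ha⟩ := hι.exists_associated f
  have haz : a ∉ zeroElts A := fun h =>
    hf (mem_zeroElts_of_dvd ha.symm.dvd (hι.mem_zeroElts_iff.2 h))
  obtain ⟨n, hn⟩ := hV.bounded a haz
  -- The divisor of `a` is cut into layers of height at most one; the gcd in `B` of a set
  -- representing a layer is a radical element.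
  have key : ∀ m : ℕ, ∃ P : Finset A, P.Nonempty ∧ (∀ p ∈ P, p ∉ zeroElts A) ∧
      (∀ v ∈ V, P.inf v = ∑ k ∈ Finset.range m, min (v a - k) 1) ∧
      ∃ L : List B, (∀ r ∈ L, IsRadElt r) ∧ IsSG (ι '' (P : Set A)) L.prod := by
    intro m
    induction m with
    | zero =>
      refine ⟨{1}, by simp, by simpa using one_notMem_zeroElts, fun v hv => ?_, [], by simp, ?_⟩
      · simpa using hV.map_one hv
      · simpa using IsSG.one
    | succ m ih =>
      obtain ⟨P, hP, hP0, hPv, L, hL, hPL⟩ := ih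
      obtain ⟨T, hT, hT0, hTv⟩ := hV.rep_minOne (hV.rep_sub_nat (Rep.eval haz) m)
      obtain ⟨r, hr0, hr⟩ := hB.exists_isSG (T := T.image ι) (hT.image ι) (by
        intro b hb
        obtain ⟨x, hx, rfl⟩ := Finset.mem_image.1 hb
        exact fun h => hT0 x hx (hι.mem_zeroElts_iff.1 h))
      rw [Finset.coe_image] at hr
      refine ⟨P * T, hP.mul hT, ?_, fun v hv => ?_, r :: L, ?_, ?_⟩
      · intro x hx
        obtain ⟨p, hp, t, ht, rfl⟩ := Finset.mem_mul.1 hx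
        exact mul_notMem_zeroElts (hP0 p hp) (hT0 t ht)
      · rw [hV.inf_mul hv hP hT, Finset.sum_range_succ, hPv v hv]
        exact congrArg _ (hTv v hv)
      · intro x hx
        rcases List.mem_cons.1 hx with rfl | hx
        · exact hV.isRadElt_of_le_one hι hB hT hT0
            (fun v hv => (hTv v hv).trans_le (min_le_right _ _)) hr
        · exact hL x hx
      · rw [List.prod_cons, mul_comm r, Finset.coe_mul, Set.image_mul]
        exact hPL.mul hr
  obtain ⟨P, hP, hP0, hPv, L, hL, hPL⟩ := key n
  have h1 : IsSG (P : Set A) a := hV.isSG hP hP0 haz fun v hv => by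
    rw [hPv v hv, sum_min_sub_one _ (hn v hv)]
  have h2 := hι.isSG_image h1
  exact ⟨L, hL, (hPL.dvd_of_isSG h2).trans ha.symm.dvd, ha.dvd.trans (h2.dvd_of_isSG hPL)⟩

end DivFamily

end Localization

/-! ### Radical factorial monoids with stable gcds -/

section RadicalFactorial

variable {M : Type*} [CommMonoid M] [IsCancelOffZero M]

theorem isPrincipalIdeal_zeroElts : IsPrincipalIdeal (zeroElts M) :=
  ⟨∅, Set.subsingleton_empty, by simp⟩

theorem isPrincipalIdeal_dvd (a : M) : IsPrincipalIdeal {x | a ∣ x} := by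
  refine ⟨{a}, Set.subsingleton_singleton, ?_⟩
  change _ = sSys {a}
  ext x
  rw [mem_sSys_iff]
  simp only [Set.mem_singleton_iff, exists_eq_left]
  exact ⟨Or.inl, fun h => h.elim id dvd_of_mem_zeroElts⟩

theorem IsPrincipalIdeal.eq_or {J : Set M} (h : IsPrincipalIdeal J) :
    J = zeroElts M ∨ ∃ a ∉ zeroElts M, J = {x | a ∣ x} := by
  obtain ⟨A, hA, rfl⟩ := h
  rcases hA.eq_empty_or_singleton with rfl | ⟨a, rfl⟩
  · left; simp
  · by_cases ha : a ∈ zeroElts M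
    · left
      refine Set.union_eq_right.2 ?_
      rintro _ ⟨b, hb, c, -, rfl⟩
      rw [Set.mem_singleton_iff.1 hb]
      exact mul_mem_zeroElts_left ha
    · right
      refine ⟨a, ha, ?_⟩
      change sSys {a} = _
      ext x
      rw [mem_sSys_iff]
      simp only [Set.mem_singleton_iff, exists_eq_left]
      exact ⟨fun h => h.elim id dvd_of_mem_zeroElts, Or.inl⟩

theorem prod_mem_list_prod_dvd (L : List M) :
    L.prod ∈ (L.map fun r => {x | r ∣ x}).prod := by
  induction L with
  | nil => simp
  | cons r L ih =>
    rw [List.map_cons, List.prod_cons, List.prod_cons]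
    exact Set.mul_mem_mul (dvd_refl r) ih

theorem prod_dvd_of_mem_list_prod (L : List M) {x : M}
    (hx : x ∈ (L.map fun r => {x | r ∣ x}).prod) : L.prod ∣ x := by
  induction L generalizing x with
  | nil => simp
  | cons r L ih =>
    rw [List.map_cons, List.prod_cons] at hx
    obtain ⟨y, hy, z, hz, rfl⟩ := hx
    rw [List.prod_cons]
    exact mul_dvd_mul hy (ih hz)

theorem IsRadElt.isRadicalSet {r : M} (hr : IsRadElt r) : IsRadicalSet {x | r ∣ x} := by
  refine Set.Subset.antisymm ?_ fun x hx => ⟨1, le_rfl, by simpa using hx⟩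
  rintro x ⟨n, hn, hx⟩
  exact hr x n hn hx

theorem isRadicalSet_zeroElts : IsRadicalSet (zeroElts M) := by
  refine Set.Subset.antisymm ?_ fun x hx => ⟨1, le_rfl, by simpa using hx⟩
  rintro x ⟨n, hn, hx⟩
  by_contra h
  exact pow_notMem_zeroElts h n hx

/-- Radical factoriality in terms of elements. -/
theorem isRadicalFactorial_iff : IsRadicalFactorial M ↔
    ∀ a : M, a ∉ zeroElts M → ∃ L : List M, (∀ r ∈ L, IsRadElt r) ∧ L.prod ∣ a ∧ a ∣ L.prod := by
  refine ⟨fun h a ha => ?_, fun h J hJ => ?_⟩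
  · obtain ⟨L, hL, hLI, haL⟩ := h _ (isPrincipalIdeal_dvd a)
    have haP : a ∈ L.prod := haL ▸ dvd_refl a
    have hideal : ∀ I ∈ L, ∀ x ∈ I, ∀ y, x * y ∈ I := by
      intro I hI x hx y
      rcases (hLI I hI).1.eq_or with rfl | ⟨r, -, rfl⟩
      · exact mul_mem_zeroElts_left hx
      · exact Dvd.dvd.mul_right hx y
    have : ∀ I ∈ L, ∃ r, I = {x | r ∣ x} := by
      intro I hI
      rcases (hLI I hI).1.eq_or with rfl | ⟨r, -, h⟩
      · exact absurd (list_prod_subset hI (hideal _ hI) haP) ha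
      · exact ⟨r, h⟩
    choose! f hf using this
    have hLf : L = (L.map f).map fun r => {x | r ∣ x} := by
      rw [List.map_map]
      conv_lhs => rw [← List.map_id L]
      exact List.map_congr_left fun I hI => hf I hI
    refine ⟨L.map f, ?_, ?_, ?_⟩
    · intro r hr x n hn hx
      obtain ⟨I, hI, rfl⟩ := List.mem_map.1 hr
      have h1 : x ^ n ∈ I := by rw [hf I hI]; exact hx
      have h2 := (hLI I hI).2.mem_of_pow_mem hn h1
      rw [hf I hI] at h2
      exact h2
    · rw [hLf] at haP
      exact prod_dvd_of_mem_list_prod _ haP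
    · have := prod_mem_list_prod_dvd (L.map f)
      rw [← hLf, ← haL] at this
      exact this
  · rcases hJ.eq_or with rfl | ⟨a, ha, rfl⟩
    · exact ⟨[zeroElts M], by simp, by
        simpa using ⟨isPrincipalIdeal_zeroElts, isRadicalSet_zeroElts⟩, by simp⟩
    · obtain ⟨L, hL, h1, h2⟩ := h a ha
      -- The factor `1` keeps the list of ideals nonempty when `a` is a unit and `L = []`.
      refine ⟨((1 : M) :: L).map fun r => {x | r ∣ x}, by simp, ?_, ?_⟩
      · intro I hI
        obtain ⟨r, hr, rfl⟩ := List.mem_map.1 hI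
        refine ⟨isPrincipalIdeal_dvd r, IsRadElt.isRadicalSet ?_⟩
        rcases List.mem_cons.1 hr with rfl | hr
        · exact fun x n _ _ => one_dvd x
        · exact hL r hr
      · ext x
        constructor
        · intro hx
          obtain ⟨c, rfl⟩ := h1.trans (show a ∣ x from hx)
          refine mul_mem_list_prod (by simp) ?_ ?_ c
          · intro I hI x hx y
            obtain ⟨r, -, rfl⟩ := List.mem_map.1 hI
            exact Dvd.dvd.mul_right hx y
          · have := prod_mem_list_prod_dvd (1 :: L)
            rwa [List.prod_cons, one_mul] at this
        · intro hx
          have := prod_dvd_of_mem_list_prod _ hx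
          rw [List.prod_cons, one_mul] at this
          exact h2.trans this

/-- Cancelling gcds leaves a cofactor outside `P`. With `r = d * r'` and `x = d * x'`, suppose `r' ∈
P`, hence `d ∈ P`, and write `d = e * d'`, `r' = e * r''`. Then `r` divides the square of `e * d' *
r''`, hence `e * d' * r''` itself, so `e` is a unit and both `d'` and `r''` lie in `P`, a
contradiction. -/
theorem IsRadElt.dvd_of_isGV {r : M} (hr : IsRadElt r) (hrz : r ∉ zeroElts M) (hM : HasSG M)
    {P : Set M} (hP : IsPrimeSet P) (hg : GVFree P) {x : M} (hx : x ∈ P) :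
    ∃ s ∉ P, r ∣ s * x := by
  have hgv : ∀ a b : M, a ∉ zeroElts M → b ∉ zeroElts M → ∃ d a' b', a = d * a' ∧ b = d * b' ∧
      (a' ∉ P ∨ b' ∉ P) := by
    intro a b ha hb
    obtain ⟨d, hd⟩ := hM a b ha hb
    obtain ⟨a', b', h1, h2, h3⟩ := hd.exists_isGV ha
    refine ⟨d, a', b', h1, h2, ?_⟩
    by_contra! hn
    refine hg _ (by simp) h3 ?_
    rintro y (rfl | rfl)
    exacts [hn.1, hn.2]
  by_cases hxz : x ∈ zeroElts M
  · exact ⟨1, hP.one_notMem, dvd_of_mem_zeroElts (mul_mem_zeroElts_right hxz)⟩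
  obtain ⟨d, r', x', hr', hx', h⟩ := hgv r x hrz hxz
  by_cases hr'P : r' ∈ P
  · exfalso
    have hx'P := h.resolve_left fun h => h hr'P
    have hdP : d ∈ P := (hP.mem_or_mem d x' (hx' ▸ hx)).resolve_right hx'P
    have hdz : d ∉ zeroElts M := notMem_zeroElts_of_dvd ⟨r', hr'⟩ hrz
    have hr'z : r' ∉ zeroElts M := fun hz => hrz (hr' ▸ mul_mem_zeroElts_right hz)
    obtain ⟨e, d', r'', rfl, rfl, h'⟩ := hgv d r' hdz hr'z
    have hd1 : r ∣ (e * d' * r'') ^ 2 := ⟨d' * r'', by rw [hr', pow_two]; ac_rfl⟩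
    have hd2 := hr _ 2 (by omega) hd1
    have heP : e ∉ P := by
      intro heP
      have h3 : (e * d' * r'') * e ∣ (e * d' * r'') * 1 := by
        rw [mul_one]
        refine dvd_trans ?_ hd2
        rw [hr']
        exact dvd_of_eq (by ac_rfl)
      have h4 : e * d' * r'' ∉ zeroElts M := mul_notMem_zeroElts hdz
        fun hz => hr'z (mul_mem_zeroElts_right hz)
      exact hP.one_notMem (hP.mem_of_dvd heP (dvd_cancel h4 h3))
    have h5 := (hP.mem_or_mem _ _ hdP).resolve_left heP
    have h6 := (hP.mem_or_mem _ _ hr'P).resolve_left heP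
    exact h'.elim (fun h => h h5) fun h => h h6
  · exact ⟨r', hr'P, x', by rw [hr', hx']; ac_rfl⟩

/-- A radical factorial monoid with stable greatest common divisors has a family of valuations as
in `DivFamily`. -/
theorem HasSG.divFamily (hM : HasSG M) (hR : IsRadicalFactorial M) : DivFamily (valSet M) := by
  rw [isRadicalFactorial_iff] at hR
  have hmem : ∀ (L : List M) {P : Set M}, IsPrimeSet P → L.prod ∈ P → ∃ r ∈ L, r ∈ P := by
    intro L P hP
    induction L with
    | nil => exact fun h => absurd h hP.one_notMem
    | cons r L ih =>
      intro h
      rw [List.prod_cons] at h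
      rcases hP.mem_or_mem _ _ h with h | h
      · exact ⟨r, by simp, h⟩
      · obtain ⟨s, hs, h⟩ := ih h
        exact ⟨s, by simp [hs], h⟩
  have hLz : ∀ (L : List M), L.prod ∉ zeroElts M → ∀ r ∈ L, r ∉ zeroElts M := fun L hL r hr =>
    notMem_zeroElts_of_dvd (List.dvd_prod hr) hL
  have hval : ∀ P : Set M, IsPrimeSet P → GVFree P → (∃ a ∈ P, a ∉ zeroElts M) →
      ∃ v, IsVal P v := by
    rintro P hP hg ⟨a, haP, ha⟩
    obtain ⟨L, hL, h1, h2⟩ := hR a ha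
    obtain ⟨r, hrL, hrP⟩ := hmem L hP (hP.mem_of_dvd haP h2)
    have hrz := hLz L (notMem_zeroElts_of_dvd h1 ha) r hrL
    refine exists_isVal hP hrP hrz (fun x hx => (hL r hrL).dvd_of_isGV hrz hM hP hg hx) ?_
    intro b hb
    obtain ⟨K, hK, h3, h4⟩ := hR b hb
    have hKz := hLz K (notMem_zeroElts_of_dvd h3 hb)
    -- Each factor of `b` inside `P` locally divides `r`, and the factors outside `P` go into `t`.
    suffices ∃ n : ℕ, ∃ t ∉ P, K.prod ∣ t * r ^ n by
      obtain ⟨n, t, ht, hd⟩ := this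
      exact ⟨n, t, ht, h4.trans hd⟩
    clear h3 h4
    induction K with
    | nil => exact ⟨0, 1, hP.one_notMem, by simp⟩
    | cons k K ih =>
      obtain ⟨n, t, ht, hd⟩ := ih (fun r hr => hK r (by simp [hr])) fun r hr => hKz r (by simp [hr])
      rw [List.prod_cons]
      by_cases hkP : k ∈ P
      · obtain ⟨s, hs, hd'⟩ := (hK k (by simp)).dvd_of_isGV (hKz k (by simp)) hM hP hg hrP
        refine ⟨n + 1, s * t, hP.mul_notMem hs ht, (mul_dvd_mul hd' hd).trans (dvd_of_eq ?_)⟩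
        rw [pow_succ]; ac_rfl
      · refine ⟨n, k * t, hP.mul_notMem hkP ht, (mul_dvd_mul_left k hd).trans (dvd_of_eq ?_)⟩
        ac_rfl
  refine PreDivFamily.divFamily (preDivFamily_valSet hval) fun a ha => ?_
  obtain ⟨L, hL, h1, h2⟩ := hR a ha
  have hz := hLz L (notMem_zeroElts_of_dvd h1 ha)
  refine ⟨L.map fun r v => v r, ?_, ?_⟩
  · intro φ hφ
    obtain ⟨r, hr, rfl⟩ := List.mem_map.1 hφ
    refine ⟨Rep.eval (hz r hr), ?_⟩
    rintro v ⟨P, hP, hg, hv⟩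
    obtain ⟨y, hy, hvy⟩ := hv.exists_le_one hP (I := {x | r ∣ x})
      (fun x hx y => Dvd.dvd.mul_right hx y) (hL r hr) (dvd_refl r) (hz r hr)
    obtain ⟨c, rfl⟩ := hy
    rw [hv.map_mul] at hvy
    exact le_self_add.trans hvy
  · intro v hv
    have hV := preDivFamily_valSet hval
    have : v a = v L.prod := le_antisymm (hV.le_of_dvd hv h2) (hV.le_of_dvd hv h1)
    rw [this, List.map_map]
    clear this h1 h2 hL hz
    induction L with
    | nil => simpa using hV.map_one hv
    | cons r L ih =>
      rw [List.prod_cons, List.map_cons, List.sum_cons, hV.map_mul v hv, ih]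
      rfl

end RadicalFactorial

theorem notMem_zeroElts_ring {R : Type*} [CommRing R] {x : R} : x ∉ zeroElts R ↔ x ≠ 0 := by
  rw [zeroElts_ring, Set.mem_singleton_iff]

/-! ### The embedding of a monoid ring into a group ring -/

section Incl

variable {R H K G : Type*} [CommRing R] [AddCommMonoid H] [CommRing K] [AddCommGroup G]

/-- The map between monoid rings induced by maps of the coefficients and of the exponents. -/
noncomputable def incl (f : R →+* K) (φ : H →+ G) : AddMonoidAlgebra R H →+* AddMonoidAlgebra K G :=
  (AddMonoidAlgebra.mapDomainRingHom K φ).comp (AddMonoidAlgebra.mapRingHom H f)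

@[simp]
theorem incl_single (f : R →+* K) (φ : H →+ G) (h : H) (r : R) :
    incl f φ (AddMonoidAlgebra.single h r) = AddMonoidAlgebra.single (φ h) (f r) := by
  simp [incl]

theorem incl_injective {f : R →+* K} {φ : H →+ G} (hf : Function.Injective f)
    (hφ : Function.Injective φ) : Function.Injective (incl f φ) := by
  intro x y h
  simp only [incl, RingHom.comp_apply, AddMonoidAlgebra.mapDomainRingHom_apply] at h
  exact AddMonoidAlgebra.map_injective (f : R →+ K) hf (AddMonoidAlgebra.mapDomain_injective hφ h)

/-- The multiplicative set of monomials. -/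
def monomials (R H : Type*) [CommRing R] [IsDomain R] [AddCommMonoid H] :
    Submonoid (AddMonoidAlgebra R H) where
  carrier := {x | ∃ h : H, ∃ r : R, r ≠ 0 ∧ x = AddMonoidAlgebra.single h r}
  one_mem' := ⟨0, 1, one_ne_zero, rfl⟩
  mul_mem' := by
    rintro _ _ ⟨h, r, hr, rfl⟩ ⟨k, s, hs, rfl⟩
    exact ⟨h + k, r * s, mul_ne_zero hr hs, AddMonoidAlgebra.single_mul_single _ _ _ _⟩

end Incl

section IsLoc

variable {R H K G : Type*} [CommRing R] [IsDomain R] [AddCancelCommMonoid H] [IsAddTorsionFree H]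
  [Field K] [AddCommGroup G] [IsAddTorsionFree G]

theorem isLoc_incl {f : R →+* K} {φ : H →+ G} (hf : Function.Injective f)
    (hφ : Function.Injective φ) (hfs : ∀ c : K, ∃ r d : R, d ≠ 0 ∧ f d * c = f r)
    (hφs : ∀ g : G, ∃ h k : H, φ h + g = φ k) :
    IsLoc (monomials R H) (incl f φ : AddMonoidAlgebra R H →* AddMonoidAlgebra K G) where
  injective := incl_injective hf hφ
  isUnit := by
    rintro _ ⟨h, r, hr, rfl⟩
    have hr' : f r ≠ 0 := fun h0 => hr (hf (by rw [h0, map_zero]))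
    refine IsUnit.of_mul_eq_one (AddMonoidAlgebra.single (-φ h) (f r)⁻¹) ?_
    change incl f φ _ * _ = _
    rw [incl_single, AddMonoidAlgebra.single_mul_single, add_neg_cancel, mul_inv_cancel₀ hr']
    rfl
  surj := by
    intro q
    change ∃ s ∈ monomials R H, ∃ a, incl f φ s * q = incl f φ a
    induction q using AddMonoidAlgebra.induction_linear with
    | zero => exact ⟨1, one_mem _, 0, by simp⟩
    | add p q hp hq =>
      obtain ⟨s, hs, a, ha⟩ := hp
      obtain ⟨t, ht, b, hb⟩ := hq
      refine ⟨s * t, mul_mem hs ht, t * a + s * b, ?_⟩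
      rw [map_add, map_mul, map_mul, map_mul, ← ha, ← hb]
      ring
    | single g c =>
      obtain ⟨r, d, hd, hc⟩ := hfs c
      obtain ⟨h, k, hk⟩ := hφs g
      refine ⟨_, ⟨h, d, hd, rfl⟩, AddMonoidAlgebra.single k r, ?_⟩
      rw [incl_single, incl_single, AddMonoidAlgebra.single_mul_single, hc, hk]

end IsLoc

/-! ### Group rings over fields have stable greatest common divisors -/

theorem hasSG_of_uniqueFactorizationMonoid (A : Type*) [CommRing A] [IsDomain A]
    [UniqueFactorizationMonoid A] : HasSG A := by
  let _ := UniqueFactorizationMonoid.toGCDMonoid A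
  intro a b _ _
  refine ⟨gcd a b, fun y c => ?_⟩
  simp only [Set.mem_insert_iff, Set.mem_singleton_iff, forall_eq_or_imp, forall_eq]
  rw [← dvd_gcd_iff]
  exact (gcd_mul_left' y a b).dvd_iff_dvd_right

theorem IsLoc.hasSG {A B : Type*} [CommMonoid A] [IsCancelOffZero A] [CommMonoid B]
    [IsCancelOffZero B] {S : Submonoid A} {ι : A →* B} (h : IsLoc S ι) (hA : HasSG A) :
    HasSG B := by
  classical
  intro a b ha hb
  obtain ⟨a', ha'⟩ := h.exists_associated a
  obtain ⟨b', hb'⟩ := h.exists_associated b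
  have hz : ∀ {x : B} {x' : A}, Associated x (ι x') → x ∉ zeroElts B → x' ∉ zeroElts A :=
    fun hx hxz hx' => hxz (mem_zeroElts_of_dvd hx.symm.dvd (h.mem_zeroElts_iff.2 hx'))
  obtain ⟨d, hd⟩ := hA a' b' (hz ha' ha) (hz hb' hb)
  have hd' := h.isSG_image (T := {a', b'}) (by simpa using hd)
  refine ⟨ι d, fun y c => ?_⟩
  rw [← hd']
  simp only [Set.mem_insert_iff, Set.mem_singleton_iff, forall_eq_or_imp, forall_eq,
    Set.forall_mem_image, Finset.mem_coe, Finset.mem_insert, Finset.mem_singleton]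
  rw [(ha'.mul_left y).dvd_iff_dvd_right, (hb'.mul_left y).dvd_iff_dvd_right]

/-- If `y * d * a = c * p` and `y * d * b = c * q`, then `b * p = a * q`, so the hypothesis gives `a
∣ p` and `a` cancels. -/
theorem isSG_of_coprime {A : Type*} [CommRing A] [IsDomain A] {a b d : A} (ha : a ≠ 0)
    (h : ∀ x, a ∣ b * x → a ∣ x) : IsSG {d * a, d * b} d := by
  intro y c
  simp only [Set.mem_insert_iff, Set.mem_singleton_iff, forall_eq_or_imp, forall_eq]
  constructor
  · rintro ⟨⟨p, hp⟩, ⟨q, hq⟩⟩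
    rcases eq_or_ne c 0 with rfl | hc
    · rw [zero_mul, ← mul_assoc] at hp
      rw [(mul_eq_zero.1 hp).resolve_right ha]
    · obtain ⟨p', rfl⟩ := h p ⟨q, mul_left_cancel₀ hc (by
        calc c * (b * p) = (c * p) * b := by ring
          _ = y * (d * b) * a := by rw [← hp]; ring
          _ = c * (a * q) := by rw [hq]; ring)⟩
      exact ⟨p', mul_left_cancel₀ ha (by linear_combination hp)⟩
  · intro hc
    exact ⟨by rw [← mul_assoc]; exact hc.mul_right a, by rw [← mul_assoc]; exact hc.mul_right b⟩

/-! ### Group rings as modules over the group ring of a subgroup -/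

section Cosets

variable {K G : Type*} [Field K] [AddCommGroup G] (N : AddSubgroup G)

/-- The part of `x` supported on the coset of `g`, translated into the group ring of `N`. -/
noncomputable def cosetPart (g : G) (x : AddMonoidAlgebra K G) : AddMonoidAlgebra K N :=
  AddMonoidAlgebra.comapDomain (fun n : N => g + n)
    (fun _ _ h => Subtype.ext (add_left_cancel h)) x

theorem coeff_cosetPart (g : G) (x : AddMonoidAlgebra K G) (n : N) :
    (cosetPart N g x).coeff n = x.coeff (g + n) := rfl

/-- The inclusion of the group ring of a subgroup. -/
noncomputable abbrev subIncl (K : Type*) [Field K] : AddMonoidAlgebra K N →+* AddMonoidAlgebra K G :=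
  AddMonoidAlgebra.mapDomainRingHom K N.subtype

theorem cosetPart_mul (g : G) (f : AddMonoidAlgebra K N) (x : AddMonoidAlgebra K G) :
    cosetPart N g (subIncl N K f * x) = f * cosetPart N g x := by
  induction f using AddMonoidAlgebra.induction_linear with
  | zero => ext n; simp [coeff_cosetPart]
  | add p q hp hq =>
    rw [map_add, add_mul, add_mul, ← hp, ← hq]
    ext n
    simp [coeff_cosetPart]
  | single h c =>
    ext n
    simp only [coeff_cosetPart, AddMonoidAlgebra.mapDomainRingHom_apply,
      AddMonoidAlgebra.mapDomain_single, AddMonoidAlgebra.coeff_single_mul_apply]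
    congr 2
    simp only [AddSubgroup.coe_subtype, AddSubgroup.coe_add, NegMemClass.coe_neg]
    abel

theorem coeff_subIncl_of_mem (y : AddMonoidAlgebra K N) (n : N) :
    (subIncl N K y).coeff n = y.coeff n := by
  rw [AddMonoidAlgebra.mapDomainRingHom_apply]
  exact Finsupp.mapDomain_apply N.subtype_injective y.coeff n

theorem coeff_subIncl_of_notMem (y : AddMonoidAlgebra K N) {g : G} (hg : g ∉ N) :
    (subIncl N K y).coeff g = 0 := by
  rw [AddMonoidAlgebra.mapDomainRingHom_apply]
  refine Finsupp.mapDomain_of_notMem_range y.coeff g ?_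
  rintro ⟨n, rfl⟩
  exact hg n.2

/-- Divisibility statements in the group ring of a subgroup extend to the whole group ring. -/
theorem dvd_of_coprime_subgroup {a b : AddMonoidAlgebra K N} (h : ∀ x, a ∣ b * x → a ∣ x)
    (x : AddMonoidAlgebra K G) (hx : subIncl N K a ∣ subIncl N K b * x) : subIncl N K a ∣ x := by
  classical
  induction hn : x.coeff.support.card using Nat.strong_induction_on generalizing x with
  | _ n ih =>
    by_cases hx0 : x = 0
    · rw [hx0]; exact dvd_zero _
    obtain ⟨g, hg⟩ : x.coeff.support.Nonempty := by
      rw [Finsupp.support_nonempty_iff]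
      simpa using hx0
    obtain ⟨y, hy⟩ := hx
    obtain ⟨z, hz⟩ := h (cosetPart N g x) ⟨cosetPart N g y, by
      rw [← cosetPart_mul, ← cosetPart_mul, hy]⟩
    -- `p` is the component of `x` on the coset of `g`. Multiplication by elements of `K[N]`
    -- preserves cosets, so `p` is divisible by the image of `a`, and subtracting it shrinks the
    -- support.
    set p : AddMonoidAlgebra K G :=
      AddMonoidAlgebra.single g 1 * subIncl N K (cosetPart N g x) with hp
    have hdp : subIncl N K a ∣ p := by
      rw [hp, hz, map_mul]
      exact (dvd_mul_right _ _).mul_left _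
    have hpc : ∀ k, p.coeff k = if -g + k ∈ N then x.coeff k else 0 := by
      intro k
      rw [hp, AddMonoidAlgebra.coeff_single_mul_apply, one_mul]
      split_ifs with hk
      · rw [coeff_subIncl_of_mem N _ ⟨-g + k, hk⟩, coeff_cosetPart]
        simp
      · exact coeff_subIncl_of_notMem N _ hk
    have hxp : (x - p).coeff.support ⊂ x.coeff.support := by
      refine Finset.ssubset_iff_subset_ne.2 ⟨fun k hk => ?_, fun he => ?_⟩
      · rw [Finsupp.mem_support_iff] at hk ⊢
        intro h0
        refine hk ?_
        rw [AddMonoidAlgebra.coeff_sub, Finsupp.sub_apply, hpc, h0]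
        simp
      · rw [← he, Finsupp.mem_support_iff] at hg
        refine hg ?_
        rw [AddMonoidAlgebra.coeff_sub, Finsupp.sub_apply, hpc]
        simp
    have := ih _ (hn ▸ Finset.card_lt_card hxp) (x - p) (by
      rw [mul_sub]
      exact dvd_sub ⟨y, hy⟩ (hdp.mul_left _)) rfl
    have h2 := dvd_add this hdp
    rwa [sub_add_cancel] at h2

end Cosets

/-! ### Reduction to finitely generated subgroups -/

section FG

variable (K G : Type*) [Field K] [AddCommGroup G] [IsAddTorsionFree G]

variable {G} in
theorem hasSG_groupRing_of_monoid {H : Type*} [AddCancelCommMonoid H] [IsAddTorsionFree H]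
    (hH : HasSG (AddMonoidAlgebra K H)) (φ : H →+ G) (hφ : Function.Injective φ)
    (hφs : ∀ g : G, ∃ h k, φ h + g = φ k) : HasSG (AddMonoidAlgebra K G) :=
  (isLoc_incl (f := RingHom.id K) Function.injective_id hφ
    (fun c => ⟨c, 1, one_ne_zero, by simp⟩) hφs).hasSG hH

theorem hasSG_of_equiv {H : Type*} [AddCancelCommMonoid H] [IsAddTorsionFree H] {n : ℕ}
    (e : (Fin n →₀ ℕ) ≃+ H) : HasSG (AddMonoidAlgebra K H) := by
  have e' : MvPolynomial (Fin n) K ≃* AddMonoidAlgebra K H :=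
    (AddMonoidAlgebra.domCongr K K e).toMulEquiv
  have := e'.uniqueFactorizationMonoid inferInstance
  exact hasSG_of_uniqueFactorizationMonoid _

variable {G} in
-- This is a Laurent polynomial ring, a localization of the factorial polynomial ring; an exponent
-- is the difference of its positive and negative parts.
theorem hasSG_groupRing_of_basis {n : ℕ} (b : Module.Basis (Fin n) ℤ G) :
    HasSG (AddMonoidAlgebra K G) := by
  classical
  let φ : (Fin n →₀ ℕ) →+ G :=
    (b.repr.symm : (Fin n →₀ ℤ) →+ G).comp
      (Finsupp.mapRange.addMonoidHom (Nat.castAddMonoidHom ℤ))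
  have hr : ∀ x i, b.repr (φ x) i = x i := fun x i => by simp [φ]
  let _ : AddCancelCommMonoid (Fin n →₀ ℕ) :=
    { (inferInstance : AddCommMonoid (Fin n →₀ ℕ)) with
      add_left_cancel := fun _ _ _ h => add_left_cancel h }
  refine hasSG_groupRing_of_monoid K (hasSG_of_equiv K (AddEquiv.refl _)) φ ?_ ?_
  · intro x y h
    ext i
    have := hr x i
    rw [h, hr] at this
    exact_mod_cast this.symm
  · intro g
    refine ⟨(b.repr g).mapRange (fun z => (-z).toNat) (by simp),
      (b.repr g).mapRange Int.toNat (by simp), b.repr.injective ?_⟩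
    ext i
    rw [map_add, Finsupp.add_apply, hr, hr, Finsupp.mapRange_apply, Finsupp.mapRange_apply]
    omega

/-- Two elements lie in the group ring of the subgroup `N` generated by their supports, and `N` is
free of finite rank. Their gcd is taken there; coprimality of the cofactors passes to `K[G]` coset
by coset. -/
theorem hasSG_groupRing : HasSG (AddMonoidAlgebra K G) := by
  classical
  intro a b ha hb
  rw [notMem_zeroElts_ring] at ha hb
  let N : AddSubgroup G := AddSubgroup.closure (a.coeff.support ∪ b.coeff.support : Finset G)
  have hfin : Module.Finite ℤ N := by
    have : AddGroup.FG N := (AddGroup.fg_iff_addSubgroup_fg N).2 ⟨_, rfl⟩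
    exact Module.Finite.iff_addGroup_fg.2 this
  have hmem : ∀ x : AddMonoidAlgebra K G, (∀ g ∈ x.coeff.support, g ∈ N) →
      ∃ y, subIncl N K y = x := by
    intro x hx
    refine ⟨AddMonoidAlgebra.comapDomain N.subtype N.subtype_injective x, ?_⟩
    rw [AddMonoidAlgebra.mapDomainRingHom_apply]
    refine AddMonoidAlgebra.mapDomain_comapDomain ?_ _
    intro g hg
    exact ⟨⟨g, hx g hg⟩, rfl⟩
  obtain ⟨a₀, ha₀⟩ := hmem a fun g hg => AddSubgroup.subset_closure (by simp [hg])
  obtain ⟨b₀, hb₀⟩ := hmem b fun g hg => AddSubgroup.subset_closure (by simp [hg])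
  have ha₀' : a₀ ≠ 0 := by rintro rfl; exact ha (by rw [← ha₀, map_zero])
  have hb₀' : b₀ ≠ 0 := by rintro rfl; exact hb (by rw [← hb₀, map_zero])
  obtain ⟨d, hd⟩ := hasSG_groupRing_of_basis K (Module.finBasis ℤ N) a₀ b₀
    (notMem_zeroElts_ring.2 ha₀') (notMem_zeroElts_ring.2 hb₀')
  obtain ⟨a', b', ha', hb', hgv⟩ := hd.exists_isGV (notMem_zeroElts_ring.2 ha₀')
  refine ⟨subIncl N K d, ?_⟩
  rw [← ha₀, ← hb₀, ha', hb', map_mul, map_mul]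
  have h0 : subIncl N K a' ≠ 0 := by
    intro h
    rw [← ha₀, ha', map_mul, h, mul_zero] at ha
    exact ha rfl
  refine isSG_of_coprime h0 fun x hx => dvd_of_coprime_subgroup N (fun x hx => ?_) x hx
  refine hgv.2 x a' fun e he => ?_
  simp only [Set.mem_insert_iff, Set.mem_singleton_iff] at he
  rcases he with rfl | rfl
  · exact dvd_mul_left _ _
  · rwa [mul_comm]

end FG

/-! ### Families of valuations on rings -/

/-- The ultrametric inequality is not part of the definition. If `v b ≤ v a`, some `t` has `v t = 0`
and `b ∣ a * t`; then `b ∣ (a + b) * t`. -/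
theorem PreDivFamily.min_le_add {B : Type*} [CommRing B] [IsDomain B] {V : Set (B → ℕ∞)}
    (hV : PreDivFamily V) {v : B → ℕ∞} (hv : v ∈ V) (a b : B) : min (v a) (v b) ≤ v (a + b) := by
  have key : ∀ a b : B, v b ≤ v a → v b ≤ v (a + b) := by
    intro a b hab
    rcases eq_or_ne b 0 with rfl | hb
    · rw [add_zero]; exact hab
    rcases eq_or_ne a 0 with rfl | ha
    · rw [zero_add]
    obtain ⟨T, hT, h0, h⟩ := hV.rep_tsub b a (notMem_zeroElts_ring.2 hb)
      (notMem_zeroElts_ring.2 ha)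
    obtain ⟨t, ht, htv⟩ := Finset.exists_mem_eq_inf T hT fun t => v t
    have hdvd : b ∣ a * t := hV.dvd_of_le _ _ (notMem_zeroElts_ring.2 hb) fun w hw => by
      rw [hV.map_mul w hw, ← tsub_le_iff_left]
      exact (h w hw).ge.trans (Finset.inf_le ht)
    have h1 : v b ≤ v ((a + b) * t) := hV.le_of_dvd hv (by
      rw [add_mul]; exact dvd_add hdvd (dvd_mul_right _ _))
    have h2 : v t = 0 := by
      rw [← htv]
      exact (h v hv).trans (tsub_eq_zero_of_le hab)
    rwa [hV.map_mul v hv, h2, add_zero] at h1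
  rcases le_total (v a) (v b) with h | h
  · rw [min_eq_left h, add_comm]; exact key b a h
  · rw [min_eq_right h]; exact key a b h

theorem PreDivFamily.le_map_sum {B : Type*} [CommRing B] [IsDomain B] {V : Set (B → ℕ∞)}
    (hV : PreDivFamily V) {v : B → ℕ∞} (hv : v ∈ V) {ι : Type*} (s : Finset ι) (f : ι → B) (c : ℕ∞)
    (h : ∀ i ∈ s, c ≤ v (f i)) : c ≤ v (∑ i ∈ s, f i) := by
  classical
  induction s using Finset.induction_on with
  | empty => rw [Finset.sum_empty, (hV.eq_top v hv 0).2 (by simp [zeroElts_ring])]; exact le_top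
  | insert i s hi ih =>
    rw [Finset.sum_insert hi]
    exact le_trans (le_min (h i (by simp)) (ih fun j hj => h j (by simp [hj])))
      (hV.min_le_add hv _ _)

/-! ### Restricting divisor families to constants and exponents -/

section MonoidRing

variable {R H : Type*} [CommRing R] [AddCancelCommMonoid H]

/-- The constants of a monoid ring. -/
noncomputable abbrev monC (H : Type*) [AddCancelCommMonoid H] (r : R) : AddMonoidAlgebra R H :=
  AddMonoidAlgebra.single 0 r

/-- The monomials with coefficient one of a monoid ring. -/
noncomputable abbrev monX (R : Type*) [CommRing R] (h : H) : AddMonoidAlgebra R H :=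
  AddMonoidAlgebra.single h 1

theorem single_eq (h : H) (r : R) : AddMonoidAlgebra.single h r = monX R h * monC H r := by
  rw [AddMonoidAlgebra.single_mul_single, add_zero, one_mul]

theorem monC_mul (r s : R) : monC H (r * s) = monC H r * monC H s := by
  rw [AddMonoidAlgebra.single_mul_single, add_zero]

theorem monX_add (h k : H) : monX R (h + k) = monX R h * monX R k := by
  rw [AddMonoidAlgebra.single_mul_single, mul_one]

theorem coeff_monC_mul (r : R) (x : AddMonoidAlgebra R H) (h : H) :
    (monC H r * x).coeff h = r * x.coeff h :=
  AddMonoidAlgebra.coeff_single_zero_mul ..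

theorem coeff_monX_mul (h : H) (x : AddMonoidAlgebra R H) (k : H) :
    (monX R h * x).coeff (h + k) = x.coeff k := by
  rw [AddMonoidAlgebra.coeff_single_mul_eq_mul_coeff k, one_mul]
  intro m _
  exact ⟨fun h => add_left_cancel h, fun h => by rw [h]⟩

theorem monC_dvd_iff {r : R} {x : AddMonoidAlgebra R H} : monC H r ∣ x ↔ ∀ h, r ∣ x.coeff h := by
  constructor
  · rintro ⟨y, rfl⟩ h
    exact ⟨_, coeff_monC_mul _ _ _⟩
  · intro h
    rw [← AddMonoidAlgebra.sum_coeff_single x]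
    refine Finset.dvd_sum fun k _ => ?_
    obtain ⟨s, hs⟩ := h k
    rw [hs, single_eq, monC_mul]
    exact ((dvd_mul_right _ _).mul_left _)

theorem exists_of_monX_dvd {h : H} {x : AddMonoidAlgebra R H} (hx : monX R h ∣ x) {k : H}
    (hk : k ∈ x.coeff.support) : ∃ e, k = h + e := by
  classical
  obtain ⟨y, rfl⟩ := hx
  have := AddMonoidAlgebra.support_coeff_single_mul_subset y 1 h hk
  obtain ⟨e, -, he⟩ := Finset.mem_image.1 this
  exact ⟨e, he.symm⟩

theorem monX_dvd_of_forall {h : H} {x : AddMonoidAlgebra R H}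
    (hx : ∀ k ∈ x.coeff.support, ∃ e, k = h + e) : monX R h ∣ x := by
  rw [← AddMonoidAlgebra.sum_coeff_single x]
  refine Finset.dvd_sum fun k hk => ?_
  obtain ⟨e, rfl⟩ := hx k hk
  rw [single_eq, monX_add]
  exact (dvd_mul_right _ _).mul_right _

theorem monC_ne_zero {r : R} (hr : r ≠ 0) : monC H r ≠ 0 :=
  AddMonoidAlgebra.single_ne_zero.2 hr

theorem monX_ne_zero [Nontrivial R] (h : H) : monX R h ≠ 0 :=
  AddMonoidAlgebra.single_ne_zero.2 one_ne_zero

open Classical in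
/-- Deleting the monomials with exponent in a prime ideal is multiplicative. -/
noncomputable def outside (R : Type*) [CommRing R] (Q : Set H) (hz : 0 ∉ Q)
    (hadd : ∀ a b, a + b ∈ Q ↔ a ∈ Q ∨ b ∈ Q) : AddMonoidAlgebra R H →ₐ[R] AddMonoidAlgebra R H :=
  AddMonoidAlgebra.lift R _ H
    { toFun := fun h => if h.toAdd ∈ Q then 0 else monX R h.toAdd
      map_one' := by simp [hz, AddMonoidAlgebra.one_def]
      map_mul' := fun a b => by
        by_cases ha : a.toAdd ∈ Q <;> by_cases hb : b.toAdd ∈ Q <;>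
          simp [hadd, ha, hb, AddMonoidAlgebra.single_mul_single] }

open Classical in
theorem coeff_outside (Q : Set H) (hz : 0 ∉ Q) (hadd : ∀ a b, a + b ∈ Q ↔ a ∈ Q ∨ b ∈ Q)
    (x : AddMonoidAlgebra R H) (h : H) :
    (outside R Q hz hadd x).coeff h = if h ∈ Q then 0 else x.coeff h := by
  induction x using AddMonoidAlgebra.induction_linear with
  | zero => simp
  | add p q hp hq => 
    rw [map_add, AddMonoidAlgebra.coeff_add, Finsupp.add_apply, hp, hq]
    split_ifs <;> simp
  | single k r =>
    rw [outside, AddMonoidAlgebra.lift_single]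
    by_cases hk : k ∈ Q
    · by_cases hh : h ∈ Q
      · simp [hk, hh]
      · have : k ≠ h := by rintro rfl; exact hh hk
        simp [hk, hh, AddMonoidAlgebra.coeff_single, this]
    · by_cases hh : h ∈ Q
      · have : k ≠ h := by rintro rfl; exact hk hh
        simp [hk, hh, AddMonoidAlgebra.coeff_single, this]
      · simp [hk, hh, AddMonoidAlgebra.coeff_single, Finsupp.single_apply]

variable [IsDomain R] [IsAddTorsionFree H] {V : Set (AddMonoidAlgebra R H → ℕ∞)}

namespace PreDivFamily

variable (hV : PreDivFamily V) {v : AddMonoidAlgebra R H → ℕ∞} (hv : v ∈ V)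
include hV hv

theorem le_of_coeff (x : AddMonoidAlgebra R H) (c : ℕ∞)
    (h : ∀ k ∈ x.coeff.support, c ≤ v (monX R k) + v (monC H (x.coeff k))) : c ≤ v x := by
  rw [← AddMonoidAlgebra.sum_coeff_single x]
  refine hV.le_map_sum hv _ _ c fun k hk => ?_
  rw [single_eq, hV.map_mul v hv]
  exact h k hk

/-- The constants of positive value form a prime ideal `p` of `R`, and `x` is nilpotent in the
domain `(R/p)[H]`. -/
theorem monC_pos_of_pow {a : R} (ha : 1 ≤ v (monC H a)) {x : AddMonoidAlgebra R H} {n : ℕ}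
    (h : monC H a ∣ x ^ n) (k : H) : 1 ≤ v (monC H (x.coeff k)) := by
  let p : Ideal R :=
    { carrier := {r | 1 ≤ v (monC H r)}
      add_mem' := fun {r s} hr hs => by
        simp only [Set.mem_ofPred_eq, monC, AddMonoidAlgebra.single_add]
        exact (le_min hr hs).trans (hV.min_le_add hv _ _)
      zero_mem' := by
        simp only [Set.mem_ofPred_eq, monC, AddMonoidAlgebra.single_zero]
        rw [(hV.eq_top v hv 0).2 (by simp [zeroElts_ring])]
        exact le_top
      smul_mem' := fun r s hs => by
        simp only [Set.mem_ofPred_eq, smul_eq_mul] at hs ⊢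
        rw [monC_mul, hV.map_mul v hv]
        exact hs.trans le_add_self }
  have hp : p.IsPrime := by
    refine ⟨fun h => ?_, fun {r s} hrs => ?_⟩
    · have h1 : (1 : ℕ∞) ≤ v (monC H (1 : R)) := (Ideal.eq_top_iff_one p).1 h
      have : v (monC H (1 : R)) = 0 := hV.map_one hv
      rw [this] at h1
      simp at h1
    · have h1 : 1 ≤ v (monC H (r * s)) := hrs
      rw [monC_mul, hV.map_mul v hv] at h1
      by_contra! hc
      have hr : v (monC H r) = 0 := Order.lt_one_iff.1 (not_le.1 hc.1)
      have hs : v (monC H s) = 0 := Order.lt_one_iff.1 (not_le.1 hc.2)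
      rw [hr, hs] at h1
      simp at h1
  let π := AddMonoidAlgebra.mapRingHom H (Ideal.Quotient.mk p)
  have h1 : π x ^ n = 0 := by
    rw [← _root_.map_pow]
    obtain ⟨y, hy⟩ := h
    rw [hy, _root_.map_mul]
    have : π (monC H a) = 0 := by
      have ha0 : Ideal.Quotient.mk p a = 0 := Ideal.Quotient.eq_zero_iff_mem.2 ha
      simp [π, monC, ha0]
    rw [this, zero_mul]
  have h2 : π x = 0 := eq_zero_of_pow_eq_zero h1
  have h3 : (π x).coeff k = 0 := by rw [h2]; rfl
  have h4 : Ideal.Quotient.mk p (x.coeff k) = 0 := by simpa [π] using h3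
  exact Ideal.Quotient.eq_zero_iff_mem.1 h4

/-- Exponents of positive value form a prime ideal of `H`; deleting their monomials is a ring
homomorphism into a domain, and it makes `x` nilpotent. -/
theorem monX_pos_of_pow {a : H} (ha : 1 ≤ v (monX R a)) {x : AddMonoidAlgebra R H} {n : ℕ}
    (h : monX R a ∣ x ^ n) {k : H} (hk : k ∈ x.coeff.support) : 1 ≤ v (monX R k) := by
  let Q : Set H := {h | 1 ≤ v (monX R h)}
  have hz : (0 : H) ∉ Q := by
    have : v (monX R (0 : H)) = 0 := hV.map_one hv
    simp [Q, this]
  have hadd : ∀ a b, a + b ∈ Q ↔ a ∈ Q ∨ b ∈ Q := by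
    intro a b
    simp only [Q, Set.mem_ofPred_eq]
    rw [monX_add, hV.map_mul v hv, Order.one_le_iff_ne_zero, Order.one_le_iff_ne_zero,
      Order.one_le_iff_ne_zero, Ne, add_eq_zero]
    tauto
  have h1 : outside R Q hz hadd x ^ n = 0 := by
    rw [← _root_.map_pow]
    obtain ⟨y, hy⟩ := h
    rw [hy, _root_.map_mul]
    have : outside R Q hz hadd (monX R a) = 0 := by
      ext b
      rw [coeff_outside]
      split_ifs with hb
      · rfl
      · have : a ≠ b := by rintro rfl; exact hb ha
        simp [AddMonoidAlgebra.coeff_single, this]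
    rw [this, zero_mul]
  have h2 := eq_zero_of_pow_eq_zero h1
  by_contra hkQ
  have h3 := coeff_outside Q hz hadd x k
  rw [h2, if_neg (show k ∉ Q from hkQ)] at h3
  exact Finsupp.mem_support_iff.1 hk h3.symm

end PreDivFamily

theorem DivFamily.exists_pow_dvd {M : Type*} [CommMonoid M] [IsCancelOffZero M]
    {V : Set (M → ℕ∞)} (hV : DivFamily V) {a : M} (ha : a ∉ zeroElts M) :
    ∃ n : ℕ, ∀ t, (∀ v ∈ V, min (v a) 1 ≤ v t) → a ∣ t ^ n := by
  obtain ⟨n, hn⟩ := hV.bounded a ha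
  refine ⟨n, fun t ht => hV.dvd_of_le _ _ ha fun v hv => ?_⟩
  rw [hV.map_pow hv]
  have h1 := ht v hv
  rcases eq_or_ne (v a) 0 with h0 | h0
  · rw [h0]; exact zero_le
  · rw [min_eq_right (Order.one_le_iff_ne_zero.2 h0)] at h1
    calc v a ≤ n * 1 := by rw [mul_one]; exact hn v hv
      _ ≤ n * v t := by gcongr

/-- The restrictions of valuations to the constants. -/
def constFamily (V : Set (AddMonoidAlgebra R H → ℕ∞)) : Set (R → ℕ∞) :=
  (fun v r => v (monC H r)) '' V

/-- The restrictions of valuations to the exponents. -/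
def expFamily (V : Set (AddMonoidAlgebra R H → ℕ∞)) : Set (Multiplicative H → ℕ∞) :=
  (fun v h => v (monX R h.toAdd)) '' V

/-- A representing set of ring elements is replaced by the set of their nonzero coefficients. Values
of elements are bounded below by those of their coefficients, and `hc` supplies the opposite
inequality. -/
theorem rep_constFamily (hV : PreDivFamily V) {T : Finset (AddMonoidAlgebra R H)}
    (hT : T.Nonempty) (h0 : ∀ t ∈ T, t ∉ zeroElts (AddMonoidAlgebra R H))
    {φ : (R → ℕ∞) → ℕ∞} (h : ∀ v ∈ V, T.inf v = φ fun r => v (monC H r))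
    (hc : ∀ v ∈ V, ∀ t ∈ T, ∀ k, φ (fun r => v (monC H r)) ≤ v (monC H (t.coeff k))) :
    Rep (constFamily V) φ := by
  classical
  have hne : ∀ t ∈ T, t.coeff.support.Nonempty := by
    intro t ht
    rw [Finsupp.support_nonempty_iff]
    simpa using notMem_zeroElts_ring.1 (h0 t ht)
  refine ⟨T.biUnion fun t => t.coeff.support.image t.coeff, ?_, ?_, ?_⟩
  · obtain ⟨t, ht⟩ := hT
    obtain ⟨k, hk⟩ := hne t ht
    exact ⟨_, Finset.mem_biUnion.2 ⟨t, ht, Finset.mem_image_of_mem _ hk⟩⟩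
  · intro r hr
    obtain ⟨t, ht, hr⟩ := Finset.mem_biUnion.1 hr
    obtain ⟨k, hk, rfl⟩ := Finset.mem_image.1 hr
    exact notMem_zeroElts_ring.2 (Finsupp.mem_support_iff.1 hk)
  · rintro _ ⟨v, hv, rfl⟩
    apply le_antisymm
    · refine le_trans (Finset.le_inf fun t ht => ?_) (h v hv).le
      refine hV.le_of_coeff hv t _ fun k hk => le_trans ?_ le_add_self
      exact Finset.inf_le (f := fun r => v (monC H r))
        (Finset.mem_biUnion.2 ⟨t, ht, Finset.mem_image_of_mem _ hk⟩)
    · refine Finset.le_inf fun r hr => ?_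
      obtain ⟨t, ht, hr⟩ := Finset.mem_biUnion.1 hr
      obtain ⟨k, hk, rfl⟩ := Finset.mem_image.1 hr
      exact hc v hv t ht k

theorem rep_expFamily (hV : PreDivFamily V) [Nontrivial H] {T : Finset (AddMonoidAlgebra R H)}
    (hT : T.Nonempty) (h0 : ∀ t ∈ T, t ∉ zeroElts (AddMonoidAlgebra R H))
    {φ : (Multiplicative H → ℕ∞) → ℕ∞} (h : ∀ v ∈ V, T.inf v = φ fun h => v (monX R h.toAdd))
    (hc : ∀ v ∈ V, ∀ t ∈ T, ∀ k ∈ t.coeff.support, φ (fun h => v (monX R h.toAdd)) ≤ v (monX R k)) :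
    Rep (expFamily V) φ := by
  classical
  have hne : ∀ t ∈ T, t.coeff.support.Nonempty := by
    intro t ht
    rw [Finsupp.support_nonempty_iff]
    simpa using notMem_zeroElts_ring.1 (h0 t ht)
  refine ⟨T.biUnion fun t => t.coeff.support.image Multiplicative.ofAdd, ?_, ?_, ?_⟩
  · obtain ⟨t, ht⟩ := hT
    obtain ⟨k, hk⟩ := hne t ht
    exact ⟨_, Finset.mem_biUnion.2 ⟨t, ht, Finset.mem_image_of_mem _ hk⟩⟩
  · intro r _
    rw [zeroElts_cancel]
    exact Set.notMem_empty _
  · rintro _ ⟨v, hv, rfl⟩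
    apply le_antisymm
    · refine le_trans (Finset.le_inf fun t ht => ?_) (h v hv).le
      refine hV.le_of_coeff hv t _ fun k hk => le_trans ?_ le_self_add
      exact Finset.inf_le (f := fun h : Multiplicative H => v (monX R h.toAdd))
        (Finset.mem_biUnion.2 ⟨t, ht, Finset.mem_image_of_mem _ hk⟩)
    · refine Finset.le_inf fun r hr => ?_
      obtain ⟨t, ht, hr⟩ := Finset.mem_biUnion.1 hr
      obtain ⟨k, hk, rfl⟩ := Finset.mem_image.1 hr
      exact hc v hv t ht k hk

theorem monC_notMem {r : R} (hr : r ∉ zeroElts R) :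
    monC H r ∉ zeroElts (AddMonoidAlgebra R H) := by
  rw [notMem_zeroElts_ring] at hr ⊢
  exact monC_ne_zero hr

theorem monX_notMem (h : H) : monX R h ∉ zeroElts (AddMonoidAlgebra R H) :=
  notMem_zeroElts_ring.2 (monX_ne_zero h)

/-- Divisibility by a constant is checked coefficientwise, so `a ∣ b * t` passes to the coefficients
of `t`. For supports, `t` has a power divisible by `a`, and `monC_pos_of_pow` applies. -/
theorem DivFamily.constFamily (hV : DivFamily V) : DivFamily (constFamily V) where
  map_mul := by
    rintro _ ⟨v, hv, rfl⟩ x y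
    simp only [monC_mul, hV.map_mul v hv]
  eq_top := by
    rintro _ ⟨v, hv, rfl⟩ x
    simp only [hV.eq_top v hv, zeroElts_ring, Set.mem_singleton_iff,
      AddMonoidAlgebra.single_eq_zero]
  dvd_of_le := by
    intro a b ha h
    have := monC_dvd_iff.1 (hV.dvd_of_le (monC H a) (monC H b) (monC_notMem ha)
      fun v hv => h _ ⟨v, hv, rfl⟩) 0
    simpa [AddMonoidAlgebra.coeff_single] using this
  rep_tsub := by
    intro a b ha hb
    obtain ⟨T, hT, h0, h⟩ := hV.rep_tsub _ _ (monC_notMem (H := H) ha) (monC_notMem (H := H) hb)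
    refine rep_constFamily hV.toPreDivFamily hT h0 h fun v hv t ht k => ?_
    have hd : monC H a ∣ monC H b * t := hV.dvd_of_le _ _ (monC_notMem ha) fun w hw => by
      rw [hV.map_mul w hw, ← tsub_le_iff_left]
      exact (h w hw).ge.trans (Finset.inf_le ht)
    obtain ⟨s, hs⟩ := monC_dvd_iff.1 hd k
    rw [coeff_monC_mul] at hs
    rw [tsub_le_iff_left, ← hV.map_mul v hv, ← monC_mul, hs]
    exact hV.le_of_dvd hv (by rw [monC_mul]; exact dvd_mul_right _ _)
  rep_min_one := by
    intro a ha
    obtain ⟨T, hT, h0, h⟩ := hV.rep_min_one _ (monC_notMem (H := H) ha)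
    refine rep_constFamily hV.toPreDivFamily hT h0 h fun v hv t ht k => ?_
    obtain ⟨n, hn⟩ := hV.exists_pow_dvd (monC_notMem (H := H) ha)
    have hd := hn t fun w hw => (h w hw).ge.trans (Finset.inf_le ht)
    rcases eq_or_ne (v (monC H a)) 0 with h0 | h0
    · exact (min_le_left _ _).trans (h0.le.trans zero_le)
    · exact (min_le_right _ _).trans
        (hV.monC_pos_of_pow hv (Order.one_le_iff_ne_zero.2 h0) hd k)
  bounded := by
    intro a ha
    obtain ⟨n, hn⟩ := hV.bounded _ (monC_notMem (H := H) ha)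
    exact ⟨n, by rintro _ ⟨v, hv, rfl⟩; exact hn v hv⟩

theorem DivFamily.expFamily [Nontrivial H] (hV : DivFamily V) : DivFamily (expFamily V) where
  map_mul := by
    rintro _ ⟨v, hv, rfl⟩ x y
    simp only [toAdd_mul, monX_add, hV.map_mul v hv]
  eq_top := by
    rintro _ ⟨v, hv, rfl⟩ x
    simp only [zeroElts_cancel, Set.mem_empty_iff_false, iff_false]
    exact hV.ne_top hv (monX_notMem _)
  dvd_of_le := by
    intro a b ha h
    have := hV.dvd_of_le (monX R a.toAdd) (monX R b.toAdd) (monX_notMem _)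
      fun v hv => h _ ⟨v, hv, rfl⟩
    obtain ⟨e, he⟩ := exists_of_monX_dvd this (k := b.toAdd) (by
      simp [AddMonoidAlgebra.coeff_single])
    exact ⟨Multiplicative.ofAdd e, he⟩
  rep_tsub := by
    intro a b ha hb
    obtain ⟨T, hT, h0, h⟩ := hV.rep_tsub _ _ (monX_notMem (R := R) a.toAdd)
      (monX_notMem (R := R) b.toAdd)
    refine rep_expFamily hV.toPreDivFamily hT h0 h fun v hv t ht k hk => ?_
    have hd : monX R a.toAdd ∣ monX R b.toAdd * t :=
      hV.dvd_of_le _ _ (monX_notMem _) fun w hw => by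
        rw [hV.map_mul w hw, ← tsub_le_iff_left]
        exact (h w hw).ge.trans (Finset.inf_le ht)
    obtain ⟨e, he⟩ := exists_of_monX_dvd hd (k := b.toAdd + k) (by
      rw [Finsupp.mem_support_iff, coeff_monX_mul]
      exact Finsupp.mem_support_iff.1 hk)
    rw [tsub_le_iff_left, ← hV.map_mul v hv, ← monX_add, he]
    exact hV.le_of_dvd hv (by rw [monX_add]; exact dvd_mul_right _ _)
  rep_min_one := by
    intro a ha
    obtain ⟨T, hT, h0, h⟩ := hV.rep_min_one _ (monX_notMem (R := R) a.toAdd)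
    refine rep_expFamily hV.toPreDivFamily hT h0 h fun v hv t ht k hk => ?_
    obtain ⟨n, hn⟩ := hV.exists_pow_dvd (monX_notMem (R := R) a.toAdd)
    have hd := hn t fun w hw => (h w hw).ge.trans (Finset.inf_le ht)
    rcases eq_or_ne (v (monX R a.toAdd)) 0 with h0 | h0
    · exact (min_le_left _ _).trans (h0.le.trans zero_le)
    · exact (min_le_right _ _).trans
        (hV.monX_pos_of_pow hv (Order.one_le_iff_ne_zero.2 h0) hd hk)
  bounded := by
    intro a ha
    obtain ⟨n, hn⟩ := hV.bounded _ (monX_notMem (R := R) a.toAdd)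
    exact ⟨n, by rintro _ ⟨v, hv, rfl⟩; exact hn v hv⟩

end MonoidRing

theorem DivFamily.isRadicalFactorial {A B : Type*} [CommMonoid A] [IsCancelOffZero A]
    [CommMonoid B] [IsCancelOffZero B] {V : Set (A → ℕ∞)} (hV : DivFamily V) {S : Submonoid A}
    {ι : A →* B} (hι : IsLoc S ι) (hB : HasSG B) : IsRadicalFactorial B :=
  isRadicalFactorial_iff.2 fun _ ha => exists_radElt_factorization hV hι hB ha

/-! ### Valuations of a monoid ring induced by coefficients and exponents -/

section GradedVal

variable {R H : Type*} [CommRing R] [AddCancelCommMonoid H]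

/-- A valuation on the homogeneous elements of a monoid ring. -/
structure GradedVal (u : H → R → ℕ∞) : Prop where
  eq_top_iff : ∀ h r, u h r = ⊤ ↔ r = 0
  map_mul : ∀ h k r s, u (h + k) (r * s) = u h r + u k s
  map_add : ∀ h r s, min (u h r) (u h s) ≤ u h (r + s)
  map_neg : ∀ h r, u h (-r) = u h r

/-- The minimum of the values of the homogeneous components. -/
noncomputable def gval (u : H → R → ℕ∞) (x : AddMonoidAlgebra R H) : ℕ∞ :=
  x.coeff.support.inf fun h => u h (x.coeff h)

namespace GradedVal

variable {u : H → R → ℕ∞} (hu : GradedVal u)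
include hu

theorem le_gval_iff {c : ℕ∞} {x : AddMonoidAlgebra R H} :
    c ≤ gval u x ↔ ∀ h, c ≤ u h (x.coeff h) := by
  refine ⟨fun hc h => ?_, fun hc => Finset.le_inf fun h _ => hc h⟩
  by_cases hx : x.coeff h = 0
  · rw [(hu.eq_top_iff h _).2 hx]; exact le_top
  · exact hc.trans (Finset.inf_le (Finsupp.mem_support_iff.2 hx))

theorem gval_le (x : AddMonoidAlgebra R H) (h : H) : gval u x ≤ u h (x.coeff h) :=
  hu.le_gval_iff.1 le_rfl h

theorem gval_single (h : H) (r : R) : gval u (AddMonoidAlgebra.single h r) = u h r := by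
  classical
  apply le_antisymm
  · simpa [AddMonoidAlgebra.coeff_single] using hu.gval_le (AddMonoidAlgebra.single h r) h
  · refine hu.le_gval_iff.2 fun k => ?_
    rw [AddMonoidAlgebra.coeff_single, Finsupp.single_apply]
    split_ifs with hk
    · rw [hk]
    · rw [(hu.eq_top_iff k 0).2 rfl]; exact le_top

theorem gval_zero : gval u 0 = ⊤ := rfl

theorem gval_eq_top_iff {x : AddMonoidAlgebra R H} : gval u x = ⊤ ↔ x = 0 := by
  refine ⟨fun h => ?_, fun h => by rw [h]; rfl⟩
  ext k
  exact (hu.eq_top_iff k _).1 (top_le_iff.1 (h ▸ hu.gval_le x k))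

theorem min_le_gval_add (x y : AddMonoidAlgebra R H) :
    min (gval u x) (gval u y) ≤ gval u (x + y) :=
  hu.le_gval_iff.2 fun h => by
    rw [AddMonoidAlgebra.coeff_add, Finsupp.add_apply]
    exact (min_le_min (hu.gval_le x h) (hu.gval_le y h)).trans (hu.map_add h _ _)

theorem gval_neg (x : AddMonoidAlgebra R H) : gval u (-x) = gval u x := by
  have key : ∀ x : AddMonoidAlgebra R H, gval u x ≤ gval u (-x) := fun x =>
    hu.le_gval_iff.2 fun h => by
      rw [AddMonoidAlgebra.coeff_neg, Finsupp.neg_apply, hu.map_neg]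
      exact hu.gval_le x h
  exact le_antisymm (by simpa using key (-x)) (key x)

theorem le_gval_sum {ι : Type*} (s : Finset ι) (f : ι → AddMonoidAlgebra R H) (c : ℕ∞)
    (h : ∀ i ∈ s, c ≤ gval u (f i)) : c ≤ gval u (∑ i ∈ s, f i) := by
  classical
  induction s using Finset.induction_on with
  | empty => rw [Finset.sum_empty, hu.gval_zero]; exact le_top
  | insert i s hi ih =>
    rw [Finset.sum_insert hi]
    exact le_trans (le_min (h i (by simp)) (ih fun j hj => h j (by simp [hj])))
      (hu.min_le_gval_add _ _)

theorem add_le_gval_mul (x y : AddMonoidAlgebra R H) : gval u x + gval u y ≤ gval u (x * y) := by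
  have hx := AddMonoidAlgebra.sum_coeff_single x
  have hy := AddMonoidAlgebra.sum_coeff_single y
  conv_rhs => rw [← hx, ← hy, Finsupp.sum, Finsupp.sum, Finset.sum_mul_sum]
  refine hu.le_gval_sum _ _ _ fun h _ => hu.le_gval_sum _ _ _ fun k _ => ?_
  rw [AddMonoidAlgebra.single_mul_single, hu.gval_single, hu.map_mul]
  exact add_le_add (hu.gval_le x h) (hu.gval_le y k)

/-- The sum of the homogeneous components of least value, together with the remaining ones. -/
theorem exists_initial_part {x : AddMonoidAlgebra R H} (hx : x ≠ 0) :
    ∃ y z, x = y + z ∧ y ≠ 0 ∧ (∀ h ∈ y.coeff.support, u h (y.coeff h) = gval u x) ∧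
      gval u x + 1 ≤ gval u z := by
  classical
  let p : H → Prop := fun h => u h (x.coeff h) = gval u x
  have hne : x.coeff.support.Nonempty := by
    rw [Finsupp.support_nonempty_iff]
    simpa using hx
  obtain ⟨h₀, hh₀, he⟩ := Finset.exists_mem_eq_inf _ hne fun h => u h (x.coeff h)
  refine ⟨AddMonoidAlgebra.ofCoeff (x.coeff.filter p),
    AddMonoidAlgebra.ofCoeff (x.coeff.filter fun h => ¬ p h), ?_, ?_, ?_, ?_⟩
  · ext h
    simp only [AddMonoidAlgebra.coeff_add]
    exact (DFunLike.congr_fun (Finsupp.filter_add_filter_not x.coeff p) h).symm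
  · intro h0
    have h1 : x.coeff.filter p h₀ = 0 := by
      have := congrArg (fun y : AddMonoidAlgebra R H => y.coeff h₀) h0
      exact this
    rw [Finsupp.filter_apply_pos p _ he.symm] at h1
    exact Finsupp.mem_support_iff.1 hh₀ h1
  · intro h hh
    have hh' : h ∈ (x.coeff.filter p).support := hh
    rw [Finsupp.support_filter, Finset.mem_filter] at hh'
    change u h (x.coeff.filter p h) = _
    rw [Finsupp.filter_apply_pos p _ hh'.2]
    exact hh'.2
  · refine hu.le_gval_iff.2 fun h => ?_
    change _ ≤ u h (x.coeff.filter (fun h => ¬ p h) h)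
    by_cases hp : p h
    · rw [Finsupp.filter_apply_neg (fun h => ¬ p h) _ (not_not.2 hp), (hu.eq_top_iff h 0).2 rfl]
      exact le_top
    · rw [Finsupp.filter_apply_pos (fun h => ¬ p h) _ hp]
      exact Order.add_one_le_of_lt (lt_of_le_of_ne (hu.gval_le x h) (Ne.symm hp))

variable [IsDomain R] [IsAddTorsionFree H]

/-- Gauss's lemma. The supports of the initial parts of `x` and `y` have a unique sum, so one
coefficient of the product of the initial parts has value exactly `gval u x + gval u y`. -/
theorem gval_mul (x y : AddMonoidAlgebra R H) : gval u (x * y) = gval u x + gval u y := by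
  rcases eq_or_ne x 0 with rfl | hx
  · rw [zero_mul, hu.gval_zero, top_add]
  rcases eq_or_ne y 0 with rfl | hy
  · rw [mul_zero, hu.gval_zero, add_top]
  refine le_antisymm ?_ (hu.add_le_gval_mul x y)
  obtain ⟨x₁, x₂, hx12, hx₁, hx₁v, hx₂v⟩ := hu.exists_initial_part hx
  obtain ⟨y₁, y₂, hy12, hy₁, hy₁v, hy₂v⟩ := hu.exists_initial_part hy
  have hne : ∀ z : AddMonoidAlgebra R H, z ≠ 0 → z.coeff.support.Nonempty := by
    intro z hz
    rw [Finsupp.support_nonempty_iff]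
    simpa using hz
  have := uniqueSums_of_grading H
  obtain ⟨a, ha, b, hb, hab⟩ := UniqueSums.uniqueAdd_of_nonempty (hne x₁ hx₁) (hne y₁ hy₁)
  have hc := AddMonoidAlgebra.coeff_mul_add_of_uniqueAdd hab
  have hv : u (a + b) ((x₁ * y₁).coeff (a + b)) = gval u x + gval u y := by
    rw [hc, hu.map_mul, hx₁v a ha, hy₁v b hb]
  by_contra hlt
  have hlt' : gval u x + gval u y + 1 ≤ gval u (x * y) := Order.add_one_le_of_lt (not_le.1 hlt)
  have hle : ∀ z : AddMonoidAlgebra R H, z ≠ 0 → gval u z ≠ ⊤ :=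
    fun z hz h => hz (hu.gval_eq_top_iff.1 h)
  have hx₁g : gval u x ≤ gval u x₁ := Finset.le_inf fun h hh => (hx₁v h hh).ge
  -- If `x * y` had larger value, all three terms on the right would, contradicting the coefficient
  -- just found.
  have e : x₁ * y₁ = x * y + (-(x₁ * y₂) + -(x₂ * y)) := by rw [hx12, hy12]; ring
  have h1 : gval u x + gval u y + 1 ≤ gval u (x₁ * y₁) := by
    rw [e]
    refine le_trans (le_min hlt' (le_trans (le_min ?_ ?_) (hu.min_le_gval_add _ _)))
      (hu.min_le_gval_add _ _)
    · rw [hu.gval_neg, add_assoc]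
      exact (add_le_add hx₁g hy₂v).trans (hu.add_le_gval_mul _ _)
    · rw [hu.gval_neg, add_right_comm]
      exact (add_le_add hx₂v le_rfl).trans (hu.add_le_gval_mul _ _)
  have h2 := h1.trans (hu.gval_le _ (a + b))
  rw [hv] at h2
  refine (ENat.add_one_le_iff ?_).1 h2 |>.false
  exact WithTop.add_ne_top.2 ⟨hle x hx, hle y hy⟩

end GradedVal

open Classical in
/-- The valuation of the homogeneous elements given by the value of the exponent. -/
noncomputable def expVal (R : Type*) [CommRing R] (v : Multiplicative H → ℕ∞) (h : H) (r : R) :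
    ℕ∞ :=
  if r = 0 then ⊤ else v (Multiplicative.ofAdd h)

variable [IsDomain R]

theorem PreDivFamily.gradedVal_const {V : Set (R → ℕ∞)} (hV : PreDivFamily V) {v : R → ℕ∞}
    (hv : v ∈ V) : GradedVal fun _ : H => v where
  eq_top_iff _ r := by rw [hV.eq_top v hv, zeroElts_ring]; rfl
  map_mul _ _ r s := hV.map_mul v hv r s
  map_add _ r s := hV.min_le_add hv r s
  map_neg _ r := le_antisymm (hV.le_of_dvd hv (by simp)) (hV.le_of_dvd hv (by simp))

variable [Nontrivial H]

theorem PreDivFamily.gradedVal_exp {V : Set (Multiplicative H → ℕ∞)} (hV : PreDivFamily V)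
    {v : Multiplicative H → ℕ∞} (hv : v ∈ V) : GradedVal (expVal R v) where
  eq_top_iff h r := by
    have : v (Multiplicative.ofAdd h) ≠ ⊤ := hV.ne_top hv (by rw [zeroElts_cancel]; simp)
    simp [expVal, this]
  map_mul h k r s := by
    by_cases hr : r = 0
    · simp [expVal, hr]
    by_cases hs : s = 0
    · simp [expVal, hs]
    simp [expVal, hr, hs, hV.map_mul v hv]
  map_add h r s := by
    by_cases hr : r = 0
    · simp [hr]
    by_cases hs : s = 0
    · simp [hs]
    by_cases hrs : r + s = 0
    · simp [expVal, hrs]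
    simp [expVal, hr, hs, hrs]
  map_neg h r := by by_cases hr : r = 0 <;> simp [expVal, hr]

end GradedVal

/-! ### Divisors represented by finite sets, for an indexed family of valuations -/

section IRep

variable {M J : Type*} [CommMonoid M] [IsCancelOffZero M]

/-- The indexed version of `Rep`. -/
def IRep (val : J → M → ℕ∞) (I : Set J) (Φ : J → ℕ∞) : Prop :=
  ∃ T : Finset M, T.Nonempty ∧ (∀ t ∈ T, t ∉ zeroElts M) ∧ ∀ i ∈ I, T.inf (val i) = Φ i

variable {val : J → M → ℕ∞} {I : Set J} {Φ Ψ : J → ℕ∞}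

namespace IRep

theorem congr (h : IRep val I Φ) (he : ∀ i ∈ I, Φ i = Ψ i) : IRep val I Ψ := by
  obtain ⟨T, hT, h0, h⟩ := h
  exact ⟨T, hT, h0, fun i hi => (h i hi).trans (he i hi)⟩

theorem eval {a : M} (ha : a ∉ zeroElts M) : IRep val I fun i => val i a :=
  ⟨{a}, by simp, by simpa using ha, by simp⟩

theorem min (hΦ : IRep val I Φ) (hΨ : IRep val I Ψ) :
    IRep val I fun i => Min.min (Φ i) (Ψ i) := by
  classical
  obtain ⟨T, hT, h0, h⟩ := hΦ
  obtain ⟨T', hT', h0', h'⟩ := hΨ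
  refine ⟨T ∪ T', hT.inl, ?_, fun i hi => ?_⟩
  · intro t ht
    exact (Finset.mem_union.1 ht).elim (h0 t) (h0' t)
  · rw [Finset.inf_union, h i hi, h' i hi]

theorem add (hmul : ∀ i ∈ I, ∀ x y, val i (x * y) = val i x + val i y)
    (hΦ : IRep val I Φ) (hΨ : IRep val I Ψ) : IRep val I fun i => Φ i + Ψ i := by
  classical
  obtain ⟨S, hS, hS0, hSΦ⟩ := hΦ
  obtain ⟨T, hT, hT0, hTΨ⟩ := hΨ
  refine ⟨S * T, hS.mul hT, fun x hx => ?_, fun i hi => ?_⟩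
  · obtain ⟨s, hs, t, ht, rfl⟩ := Finset.mem_mul.1 hx
    exact mul_notMem_zeroElts (hS0 s hs) (hT0 t ht)
  change _ = Φ i + Ψ i
  rw [← hSΦ i hi, ← hTΨ i hi]
  refine le_antisymm ?_ (Finset.le_inf fun x hx => ?_)
  · obtain ⟨s, hs, hse⟩ := Finset.exists_mem_eq_inf S hS (val i)
    obtain ⟨t, ht, hte⟩ := Finset.exists_mem_eq_inf T hT (val i)
    rw [hse, hte, ← hmul i hi]
    exact Finset.inf_le (Finset.mul_mem_mul hs ht)
  · obtain ⟨s, hs, t, ht, rfl⟩ := Finset.mem_mul.1 hx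
    rw [hmul i hi]
    exact add_le_add (Finset.inf_le hs) (Finset.inf_le ht)

/-- Dividing every element of `T` by `a` subtracts the finite value of `a` from the minimum. -/
theorem of_dvd (hmul : ∀ i ∈ I, ∀ x y, val i (x * y) = val i x + val i y) {a : M}
    (ha : ∀ i ∈ I, val i a ≠ ⊤) {T : Finset M} (hT : T.Nonempty)
    (h0 : ∀ t ∈ T, t ∉ zeroElts M) (hd : ∀ t ∈ T, a ∣ t)
    (h : ∀ i ∈ I, T.inf (val i) = val i a + Ψ i) : IRep val I Ψ := by
  classical
  choose! q hq using hd
  refine ⟨T.image q, hT.image q, fun x hx => ?_, fun i hi => ?_⟩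
  · obtain ⟨t, ht, rfl⟩ := Finset.mem_image.1 hx
    exact notMem_zeroElts_of_dvd ⟨a, (hq t ht).trans (mul_comm _ _)⟩ (h0 t ht)
  · rw [Finset.inf_image]
    have hval : ∀ t ∈ T, val i t = val i a + val i (q t) := fun t ht => by
      rw [← hmul i hi, ← hq t ht]
    apply le_antisymm
    · obtain ⟨t, ht, hte⟩ := Finset.exists_mem_eq_inf T hT (val i)
      refine (Finset.inf_le ht).trans ?_
      rw [h i hi, hval t ht] at hte
      exact (WithTop.add_left_cancel (ha i hi) hte).ge
    · refine Finset.le_inf fun t ht => ?_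
      have : val i a + Ψ i ≤ val i a + val i (q t) := by
        rw [← h i hi, ← hval t ht]
        exact Finset.inf_le ht
      exact (ENat.add_le_add_iff_left (ha i hi)).1 this

theorem rep (h : IRep val I Φ) {φ : (M → ℕ∞) → ℕ∞} (hφ : ∀ i ∈ I, Φ i = φ (val i)) :
    Rep (val '' I) φ := by
  obtain ⟨T, hT, h0, h⟩ := h
  refine ⟨T, hT, h0, ?_⟩
  rintro _ ⟨i, hi, rfl⟩
  exact (h i hi).trans (hφ i hi)

end IRep

end IRep

/-! ### Divisor families of monoid rings -/

section MonoidRing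

variable {R H B : Type*} [CommRing R] [IsDomain R] [AddCancelCommMonoid H] [IsAddTorsionFree H]
  [Nontrivial H] [CommMonoid B] [IsCancelOffZero B]

/-- The valuations of a monoid ring induced by valuations of the coefficients, of the exponents and
of a localization. -/
noncomputable def ringVal (ι : AddMonoidAlgebra R H →* B) :
    (R → ℕ∞) ⊕ (Multiplicative H → ℕ∞) ⊕ (B → ℕ∞) → AddMonoidAlgebra R H → ℕ∞
  | .inl v => gval fun _ => v
  | .inr (.inl v) => gval (expVal R v)
  | .inr (.inr v) => fun x => v (ι x)

/-- The index set of the valuations of a monoid ring. -/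
def ringIndex (V₁ : Set (R → ℕ∞)) (V₂ : Set (Multiplicative H → ℕ∞)) (V₃ : Set (B → ℕ∞)) :
    Set ((R → ℕ∞) ⊕ (Multiplicative H → ℕ∞) ⊕ (B → ℕ∞)) :=
  {i | Sum.elim (· ∈ V₁) (Sum.elim (· ∈ V₂) (· ∈ V₃)) i}

variable {ι : AddMonoidAlgebra R H →* B} {V₁ : Set (R → ℕ∞)} {V₂ : Set (Multiplicative H → ℕ∞)}
  {V₃ : Set (B → ℕ∞)}

theorem forall_ringIndex {p : (R → ℕ∞) ⊕ (Multiplicative H → ℕ∞) ⊕ (B → ℕ∞) → Prop} :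
    (∀ i ∈ ringIndex V₁ V₂ V₃, p i) ↔ (∀ v ∈ V₁, p (.inl v)) ∧ (∀ v ∈ V₂, p (.inr (.inl v))) ∧
      ∀ v ∈ V₃, p (.inr (.inr v)) :=
  ⟨fun h => ⟨fun v hv => h (.inl v) hv, fun v hv => h (.inr (.inl v)) hv,
    fun v hv => h (.inr (.inr v)) hv⟩, fun h => by
    rintro (v | v | v) hv
    exacts [h.1 v hv, h.2.1 v hv, h.2.2 v hv]⟩

variable (h₁ : PreDivFamily V₁) (h₂ : PreDivFamily V₂) (h₃ : PreDivFamily V₃)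
  (hι : IsLoc (monomials R H) ι)

theorem expVal_of_ne_zero (v : Multiplicative H → ℕ∞) (h : H) {r : R} (hr : r ≠ 0) :
    expVal R v h r = v (Multiplicative.ofAdd h) := if_neg hr

include h₁ h₂ in
theorem single_dvd {h : H} {r : R} (hr : r ≠ 0) {x : AddMonoidAlgebra R H}
    (hxr : ∀ v ∈ V₁, v r ≤ gval (fun _ => v) x)
    (hxh : ∀ v ∈ V₂, v (Multiplicative.ofAdd h) ≤ gval (expVal R v) x) :
    AddMonoidAlgebra.single h r ∣ x := by
  have hX : monX R h ∣ x := monX_dvd_of_forall fun k hk => by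
    obtain ⟨e, he⟩ := h₂.dvd_of_le (Multiplicative.ofAdd h) (Multiplicative.ofAdd k)
      (by rw [zeroElts_cancel]; simp) fun v hv => by
        have := (hxh v hv).trans ((h₂.gradedVal_exp hv).gval_le x k)
        rwa [expVal_of_ne_zero _ _ (Finsupp.mem_support_iff.1 hk)] at this
    exact ⟨e.toAdd, he⟩
  obtain ⟨y, rfl⟩ := hX
  rw [single_eq]
  refine mul_dvd_mul_left _ (monC_dvd_iff.2 fun k => ?_)
  refine h₁.dvd_of_le _ _ (notMem_zeroElts_ring.2 hr) fun v hv => ?_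
  rw [← coeff_monX_mul h]
  exact (hxr v hv).trans ((h₁.gradedVal_const hv).gval_le _ _)

include h₁ in
theorem rep_gval_const {x : AddMonoidAlgebra R H} (hx : x ≠ 0) :
    Rep V₁ fun v => gval (fun _ => v) x := by
  classical
  refine ⟨x.coeff.support.image x.coeff, Finset.Nonempty.image ?_ _, fun r hr => ?_, fun v hv => ?_⟩
  · rw [Finsupp.support_nonempty_iff]
    simpa using hx
  · obtain ⟨k, hk, rfl⟩ := Finset.mem_image.1 hr
    exact notMem_zeroElts_ring.2 (Finsupp.mem_support_iff.1 hk)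
  · rw [Finset.inf_image]
    rfl

include h₂ in
theorem rep_gval_exp {x : AddMonoidAlgebra R H} (hx : x ≠ 0) :
    Rep V₂ fun v => gval (expVal R v) x := by
  classical
  refine ⟨x.coeff.support.image Multiplicative.ofAdd, Finset.Nonempty.image ?_ _,
    fun r hr => ?_, fun v hv => ?_⟩
  · rw [Finsupp.support_nonempty_iff]
    simpa using hx
  · rw [zeroElts_cancel]; simp
  · rw [Finset.inf_image]
    exact Finset.inf_congr rfl fun k hk =>
      (expVal_of_ne_zero _ _ (Finsupp.mem_support_iff.1 hk)).symm

include h₃ hι in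
theorem map_single_eq_zero {v : B → ℕ∞} (hv : v ∈ V₃) (h : H) {r : R} (hr : r ≠ 0) :
    v (ι (AddMonoidAlgebra.single h r)) = 0 := by
  have hu := hι.isUnit _ ⟨h, r, hr, rfl⟩
  have := h₃.le_of_dvd hv (isUnit_iff_dvd_one.1 hu)
  rw [h₃.map_one hv] at this
  exact le_antisymm this zero_le

include h₁ h₂ h₃

theorem ringVal_mul : ∀ i ∈ ringIndex V₁ V₂ V₃, ∀ x y,
    ringVal ι i (x * y) = ringVal ι i x + ringVal ι i y :=
  forall_ringIndex.2 ⟨fun _ hv => (h₁.gradedVal_const hv).gval_mul,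
    fun _ hv => (h₂.gradedVal_exp hv).gval_mul, fun v hv x y => by
      simp only [ringVal, _root_.map_mul, h₃.map_mul v hv]⟩

include hι

theorem ringVal_eq_top : ∀ i ∈ ringIndex V₁ V₂ V₃, ∀ x,
    ringVal ι i x = ⊤ ↔ x ∈ zeroElts (AddMonoidAlgebra R H) := by
  refine forall_ringIndex.2 ⟨fun _ hv x => ?_, fun _ hv x => ?_, fun v hv x => ?_⟩
  · rw [zeroElts_ring]; exact (h₁.gradedVal_const hv).gval_eq_top_iff
  · rw [zeroElts_ring]; exact (h₂.gradedVal_exp hv).gval_eq_top_iff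
  · simp only [ringVal, h₃.eq_top v hv, hι.mem_zeroElts_iff]

theorem irep_const {α : (R → ℕ∞) → ℕ∞} (hα : Rep V₁ α) :
    IRep (ringVal ι) (ringIndex V₁ V₂ V₃) (Sum.elim α (Sum.elim 0 0)) := by
  refine hα.induction (P := fun α => IRep (ringVal ι) (ringIndex V₁ V₂ V₃)
    (Sum.elim α (Sum.elim 0 0))) (fun α β h hα => ?_) (fun a ha => ?_) fun α β _ _ hα hβ => ?_
  · exact hα.congr (forall_ringIndex.2 ⟨h, fun _ _ => rfl, fun _ _ => rfl⟩)
  · refine (IRep.eval (a := monC H a) (monC_notMem ha)).congr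
      (forall_ringIndex.2 ⟨fun v hv => ?_, fun v hv => ?_, fun v hv => ?_⟩)
    · exact (h₁.gradedVal_const hv).gval_single 0 a
    · refine ((h₂.gradedVal_exp hv).gval_single 0 a).trans ?_
      rw [expVal_of_ne_zero _ _ (notMem_zeroElts_ring.1 ha)]
      exact h₂.map_one hv
    · exact map_single_eq_zero h₃ hι hv 0 (notMem_zeroElts_ring.1 ha)
  · exact (hα.min hβ).congr (forall_ringIndex.2
      ⟨fun _ _ => rfl, fun _ _ => min_self _, fun _ _ => min_self _⟩)

theorem irep_exp {β : (Multiplicative H → ℕ∞) → ℕ∞} (hβ : Rep V₂ β) :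
    IRep (ringVal ι) (ringIndex V₁ V₂ V₃) (Sum.elim 0 (Sum.elim β 0)) := by
  refine hβ.induction (P := fun β => IRep (ringVal ι) (ringIndex V₁ V₂ V₃)
    (Sum.elim 0 (Sum.elim β 0))) (fun α β h hα => ?_) (fun a ha => ?_) fun α β _ _ hα hβ => ?_
  · exact hα.congr (forall_ringIndex.2 ⟨fun _ _ => rfl, h, fun _ _ => rfl⟩)
  · refine (IRep.eval (a := monX R a.toAdd) (monX_notMem _)).congr
      (forall_ringIndex.2 ⟨fun v hv => ?_, fun v hv => ?_, fun v hv => ?_⟩)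
    · exact ((h₁.gradedVal_const hv).gval_single _ _).trans (h₁.map_one hv)
    · exact ((h₂.gradedVal_exp hv).gval_single _ _).trans
        (expVal_of_ne_zero _ _ one_ne_zero)
    · exact map_single_eq_zero h₃ hι hv _ one_ne_zero
  · exact (hα.min hβ).congr (forall_ringIndex.2
      ⟨fun _ _ => min_self _, fun _ _ => rfl, fun _ _ => min_self _⟩)

/-- A lift `x` of `q` may have content. Choose a monomial of `x` and multiply `x` by sets that raise
its content to that of the monomial; everything obtained is then divisible by the monomial, and
dividing by it leaves content zero. The values on `B` do not change, since monomials become units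
there. -/
theorem irep_primitive {q : B} (hq : q ∉ zeroElts B) :
    IRep (ringVal ι) (ringIndex V₁ V₂ V₃) (Sum.elim 0 (Sum.elim 0 fun v => v q)) := by
  obtain ⟨x, hx⟩ := hι.exists_associated q
  have hx0 : x ∉ zeroElts (AddMonoidAlgebra R H) := fun h =>
    hq (mem_zeroElts_of_dvd hx.symm.dvd (hι.mem_zeroElts_iff.2 h))
  have hxn := notMem_zeroElts_ring.1 hx0
  obtain ⟨k, hk⟩ : x.coeff.support.Nonempty := by
    rw [Finsupp.support_nonempty_iff]
    simpa using hxn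
  have hk0 := Finsupp.mem_support_iff.1 hk
  have hmul := ringVal_mul h₁ h₂ h₃ (ι := ι)
  have hα := h₁.rep_sub (Rep.eval (notMem_zeroElts_ring.2 hk0)) (rep_gval_const h₁ hxn)
  have hβ := h₂.rep_sub (Rep.eval (a := Multiplicative.ofAdd k) (by rw [zeroElts_cancel]; simp))
    (rep_gval_exp h₂ hxn)
  obtain ⟨T, hT, h0, h⟩ := ((irep_const h₁ h₂ h₃ hι hα).add hmul
    (irep_exp h₁ h₂ h₃ hι hβ)).add hmul (IRep.eval hx0)
  obtain ⟨hc, he, hb⟩ := forall_ringIndex.1 h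
  have hcv : ∀ v ∈ V₁, T.inf (gval fun _ => v) = v (x.coeff k) := fun v hv => by
    refine (hc v hv).trans ?_
    simp only [Sum.elim_inl, Pi.zero_apply, add_zero]
    exact tsub_add_cancel_of_le ((h₁.gradedVal_const hv).gval_le x k)
  have hev : ∀ v ∈ V₂, T.inf (gval (expVal R v)) = v (Multiplicative.ofAdd k) := fun v hv => by
    refine (he v hv).trans ?_
    simp only [Sum.elim_inl, Sum.elim_inr, Pi.zero_apply, zero_add]
    refine tsub_add_cancel_of_le (((h₂.gradedVal_exp hv).gval_le x k).trans ?_)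
    rw [expVal_of_ne_zero _ _ hk0]
  have hbv : ∀ v ∈ V₃, T.inf (fun y => v (ι y)) = v q := fun v hv => by
    refine (hb v hv).trans ?_
    simp only [Sum.elim_inr, Pi.zero_apply, zero_add]
    exact le_antisymm (h₃.le_of_dvd hv hx.symm.dvd) (h₃.le_of_dvd hv hx.dvd)
  refine IRep.of_dvd hmul (a := AddMonoidAlgebra.single k (x.coeff k)) (fun i hi => ?_) hT h0
    (fun t ht => ?_) (forall_ringIndex.2 ⟨fun v hv => ?_, fun v hv => ?_, fun v hv => ?_⟩)
  · rw [Ne, ringVal_eq_top h₁ h₂ h₃ hι i hi]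
    exact notMem_zeroElts_ring.2 (AddMonoidAlgebra.single_ne_zero.2 hk0)
  · refine single_dvd h₁ h₂ hk0 (fun v hv => ?_) fun v hv => ?_
    · rw [← hcv v hv]; exact Finset.inf_le ht
    · rw [← hev v hv]; exact Finset.inf_le ht
  · refine (hcv v hv).trans ?_
    simp only [Sum.elim_inl, Pi.zero_apply, add_zero, ringVal]
    exact ((h₁.gradedVal_const hv).gval_single _ _).symm
  · refine (hev v hv).trans ?_
    simp only [Sum.elim_inl, Sum.elim_inr, Pi.zero_apply, add_zero, ringVal]
    rw [(h₂.gradedVal_exp hv).gval_single, expVal_of_ne_zero _ _ hk0]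
  · refine (hbv v hv).trans ?_
    simp only [Sum.elim_inr, ringVal]
    rw [map_single_eq_zero h₃ hι hv _ hk0, zero_add]

theorem irep_of_rep {α : (R → ℕ∞) → ℕ∞} {β : (Multiplicative H → ℕ∞) → ℕ∞} {γ : (B → ℕ∞) → ℕ∞}
    (hα : Rep V₁ α) (hβ : Rep V₂ β) (hγ : Rep V₃ γ) :
    IRep (ringVal ι) (ringIndex V₁ V₂ V₃) (Sum.elim α (Sum.elim β γ)) := by
  have hmul := ringVal_mul h₁ h₂ h₃ (ι := ι)
  have hp : IRep (ringVal ι) (ringIndex V₁ V₂ V₃) (Sum.elim 0 (Sum.elim 0 γ)) := by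
    refine hγ.induction (P := fun γ => IRep (ringVal ι) (ringIndex V₁ V₂ V₃)
      (Sum.elim 0 (Sum.elim 0 γ))) (fun α β h hα => ?_) (fun a ha => ?_) fun α β _ _ hα hβ => ?_
    · exact hα.congr (forall_ringIndex.2 ⟨fun _ _ => rfl, fun _ _ => rfl, h⟩)
    · exact irep_primitive h₁ h₂ h₃ hι ha
    · exact (hα.min hβ).congr (forall_ringIndex.2
        ⟨fun _ _ => min_self _, fun _ _ => min_self _, fun _ _ => rfl⟩)
  refine (((irep_const h₁ h₂ h₃ hι hα).add hmul (irep_exp h₁ h₂ h₃ hι hβ)).add hmul hp).congr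
    (forall_ringIndex.2 ⟨fun v _ => ?_, fun v _ => ?_, fun v _ => ?_⟩) <;> simp

omit h₁ h₂ h₃ in
-- By `irep_of_rep` representable divisors on the three kinds of valuations can be prescribed
-- independently, so the closure properties hold componentwise.
theorem DivFamily.monoidRing (h₁ : DivFamily V₁) (h₂ : DivFamily V₂) (h₃ : DivFamily V₃) :
    DivFamily (ringVal ι '' ringIndex V₁ V₂ V₃) := by
  have h₁' := h₁.toPreDivFamily
  have h₂' := h₂.toPreDivFamily
  have h₃' := h₃.toPreDivFamily
  have hmul := ringVal_mul h₁' h₂' h₃' (ι := ι)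
  have htop := ringVal_eq_top h₁' h₂' h₃' hι
  have hιz : ∀ {x}, x ∉ zeroElts (AddMonoidAlgebra R H) → ι x ∉ zeroElts B :=
    fun hx h => hx (hι.mem_zeroElts_iff.1 h)
  refine ⟨⟨?_, ?_, ?_, ?_⟩, ?_, ?_⟩
  · rintro _ ⟨i, hi, rfl⟩
    exact hmul i hi
  · rintro _ ⟨i, hi, rfl⟩
    exact htop i hi
  · intro a b ha h
    rw [Set.forall_mem_image] at h
    by_cases hb : b ∈ zeroElts (AddMonoidAlgebra R H)
    · exact dvd_of_mem_zeroElts hb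
    -- Divisibility in `B` holds in `R[H]` up to a monomial denominator. Comparing contents shows
    -- that this monomial divides the quotient `q`.
    have hdvd : ι a ∣ ι b := h₃.dvd_of_le _ _ (hιz ha) fun v hv => h (x := .inr (.inr v)) hv
    obtain ⟨s, ⟨k, r, hr, rfl⟩, q, hq⟩ := hι.dvd_iff.1 hdvd
    have hle : ∀ i ∈ ringIndex V₁ V₂ V₃,
        ringVal ι i (AddMonoidAlgebra.single k r) ≤ ringVal ι i q := fun i hi => by
      have e := congrArg (ringVal ι i) hq
      rw [hmul i hi, hmul i hi] at e
      have hbt : ringVal ι i b ≠ ⊤ := fun hbt => hb ((htop i hi b).1 hbt)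
      refine (ENat.add_le_add_iff_right hbt).1 ?_
      rw [e, add_comm]
      exact add_le_add le_rfl (h hi)
    obtain ⟨q', rfl⟩ : AddMonoidAlgebra.single k r ∣ q := by
      refine single_dvd h₁' h₂' hr (fun v hv => ?_) fun v hv => ?_
      · rw [← (h₁'.gradedVal_const hv).gval_single k r]
        exact hle (.inl v) hv
      · rw [← expVal_of_ne_zero v k hr, ← (h₂'.gradedVal_exp hv).gval_single k r]
        exact hle (.inr (.inl v)) hv
    exact ⟨q', mul_left_cancel₀ (AddMonoidAlgebra.single_ne_zero.2 hr) (hq.trans (by ring))⟩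
  · intro a b ha hb
    have ha' := notMem_zeroElts_ring.1 ha
    have hb' := notMem_zeroElts_ring.1 hb
    exact (irep_of_rep h₁' h₂' h₃' hι
      (h₁'.rep_sub (rep_gval_const h₁' ha') (rep_gval_const h₁' hb'))
      (h₂'.rep_sub (rep_gval_exp h₂' ha') (rep_gval_exp h₂' hb'))
      (h₃'.rep_sub (Rep.eval (hιz ha)) (Rep.eval (hιz hb)))).rep
      (forall_ringIndex.2 ⟨fun _ _ => rfl, fun _ _ => rfl, fun _ _ => rfl⟩)
  · intro a ha
    have ha' := notMem_zeroElts_ring.1 ha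
    exact (irep_of_rep h₁' h₂' h₃' hι (h₁.rep_minOne (rep_gval_const h₁' ha'))
      (h₂.rep_minOne (rep_gval_exp h₂' ha')) (h₃.rep_minOne (Rep.eval (hιz ha)))).rep
      (forall_ringIndex.2 ⟨fun _ _ => rfl, fun _ _ => rfl, fun _ _ => rfl⟩)
  · intro a ha
    have ha' := notMem_zeroElts_ring.1 ha
    obtain ⟨l, hl⟩ := h₁.rep_bounded (rep_gval_const h₁' ha')
    obtain ⟨m, hm⟩ := h₂.rep_bounded (rep_gval_exp h₂' ha')
    obtain ⟨n, hn⟩ := h₃.rep_bounded (Rep.eval (hιz ha))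
    refine ⟨l + m + n, Set.forall_mem_image.2 (forall_ringIndex.2
      ⟨fun v hv => (hl v hv).trans ?_, fun v hv => (hm v hv).trans ?_,
        fun v hv => (hn v hv).trans ?_⟩)⟩ <;> norm_cast <;> omega

end MonoidRing

/-! ### Greatest common divisors in monoid rings -/

/-- The minimum of two divisors of elements is the divisor of an element. -/
def HasMin {M : Type*} [CommMonoid M] (V : Set (M → ℕ∞)) : Prop :=
  ∀ a b, a ∉ zeroElts M → b ∉ zeroElts M →
    ∃ d, d ∉ zeroElts M ∧ ∀ v ∈ V, v d = min (v a) (v b)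

theorem HasMin.exists_eq {M : Type*} [CommMonoid M] [IsCancelOffZero M] {V : Set (M → ℕ∞)}
    (hV : HasMin V) {φ : (M → ℕ∞) → ℕ∞} (hφ : Rep V φ) :
    ∃ d, d ∉ zeroElts M ∧ ∀ v ∈ V, v d = φ v := by
  refine hφ.induction (P := fun φ => ∃ d, d ∉ zeroElts M ∧ ∀ v ∈ V, v d = φ v) ?_ ?_ ?_
  · rintro φ ψ h ⟨d, hd, hdv⟩
    exact ⟨d, hd, fun v hv => (hdv v hv).trans (h v hv)⟩
  · exact fun a ha => ⟨a, ha, fun _ _ => rfl⟩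
  · rintro φ ψ _ _ ⟨d, hd, hdv⟩ ⟨e, he, hev⟩
    obtain ⟨c, hc, hcv⟩ := hV d e hd he
    exact ⟨c, hc, fun v hv => by rw [hcv v hv, hdv v hv, hev v hv]⟩

theorem min_le_of_le_tsub_add {a b x : ℕ∞} (ha : a ≠ ⊤) (hb : b ≠ ⊤) (h : a ≤ a - b + x) :
    min a b ≤ x := by
  induction x using ENat.recTopCoe with
  | top => exact le_top
  | coe x =>
    lift a to ℕ using ha
    lift b to ℕ using hb
    rw [min_le_iff]
    norm_cast at h ⊢
    omega

section MonoidRing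

variable {R H : Type*} [CommRing R] [IsDomain R] [AddCancelCommMonoid H] [IsAddTorsionFree H]

section Descent

variable {V : Set (AddMonoidAlgebra R H → ℕ∞)} (hV : DivFamily V) (hm : HasMin V)
include hV

/-- If constants `t` represent `v a - v b`, then `a ∣ t * d`, hence `a` divides `t` times each
coefficient of `d`. A `t` of minimal value gives the bound. -/
theorem DivFamily.le_monC_coeff {a b : R} (ha : a ∉ zeroElts R) (hb : b ∉ zeroElts R)
    {d : AddMonoidAlgebra R H} (hd : ∀ v ∈ V, min (v (monC H a)) (v (monC H b)) ≤ v d)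
    {v : AddMonoidAlgebra R H → ℕ∞} (hv : v ∈ V) (k : H) :
    min (v (monC H a)) (v (monC H b)) ≤ v (monC H (d.coeff k)) := by
  obtain ⟨T, hT, h0, h⟩ := hV.constFamily.rep_tsub a b ha hb
  have hTv : ∀ w ∈ V, T.inf (fun r => w (monC H r)) = w (monC H a) - w (monC H b) :=
    fun w hw => h _ ⟨w, hw, rfl⟩
  refine min_le_of_le_tsub_add (hV.ne_top hv (monC_notMem ha)) (hV.ne_top hv (monC_notMem hb)) ?_
  obtain ⟨t, ht, hte⟩ := Finset.exists_mem_eq_inf T hT fun r => v (monC H r)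
  rw [← hTv v hv, hte, ← hV.map_mul v hv, ← monC_mul]
  have hdvd : monC H a ∣ monC H t * d := hV.dvd_of_le _ _ (monC_notMem ha) fun w hw => by
    have h1 : w (monC H a) - w (monC H b) ≤ w (monC H t) := by
      rw [← hTv w hw]
      exact Finset.inf_le (f := fun r => w (monC H r)) ht
    rw [hV.map_mul w hw]
    refine le_trans ?_ (add_le_add h1 (hd w hw))
    rcases le_total (w (monC H a)) (w (monC H b)) with hab | hab
    · rw [min_eq_left hab]; exact le_add_self
    · rw [min_eq_right hab]; exact le_tsub_add
  obtain ⟨s, hs⟩ := monC_dvd_iff.1 hdvd k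
  rw [coeff_monC_mul] at hs
  rw [hs, monC_mul]
  exact hV.le_of_dvd hv (dvd_mul_right _ _)

theorem DivFamily.le_monX [Nontrivial H] {a b : H} {d : AddMonoidAlgebra R H}
    (hd : ∀ v ∈ V, min (v (monX R a)) (v (monX R b)) ≤ v d)
    {v : AddMonoidAlgebra R H → ℕ∞} (hv : v ∈ V) {k : H} (hk : k ∈ d.coeff.support) :
    min (v (monX R a)) (v (monX R b)) ≤ v (monX R k) := by
  obtain ⟨T, hT, h0, h⟩ := hV.expFamily.rep_tsub (Multiplicative.ofAdd a)
    (Multiplicative.ofAdd b) (by rw [zeroElts_cancel]; simp) (by rw [zeroElts_cancel]; simp)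
  have hTv : ∀ w ∈ V, T.inf (fun r : Multiplicative H => w (monX R r.toAdd)) =
    w (monX R a) - w (monX R b) := fun w hw => h _ ⟨w, hw, rfl⟩
  refine min_le_of_le_tsub_add (hV.ne_top hv (monX_notMem a)) (hV.ne_top hv (monX_notMem b)) ?_
  obtain ⟨t, ht, hte⟩ :=
    Finset.exists_mem_eq_inf T hT fun r : Multiplicative H => v (monX R r.toAdd)
  rw [← hTv v hv, hte, ← hV.map_mul v hv, ← monX_add]
  have hdvd : monX R a ∣ monX R t.toAdd * d := hV.dvd_of_le _ _ (monX_notMem a) fun w hw => by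
    have h1 : w (monX R a) - w (monX R b) ≤ w (monX R t.toAdd) := by
      rw [← hTv w hw]
      exact Finset.inf_le (f := fun r : Multiplicative H => w (monX R r.toAdd)) ht
    rw [hV.map_mul w hw]
    refine le_trans ?_ (add_le_add h1 (hd w hw))
    rcases le_total (w (monX R a)) (w (monX R b)) with hab | hab
    · rw [min_eq_left hab]; exact le_add_self
    · rw [min_eq_right hab]; exact le_tsub_add
  obtain ⟨e, he⟩ := exists_of_monX_dvd hdvd (k := t.toAdd + k) (by
    rw [Finsupp.mem_support_iff, coeff_monX_mul]
    exact Finsupp.mem_support_iff.1 hk)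
  rw [he, monX_add]
  exact hV.le_of_dvd hv (dvd_mul_right _ _)

include hm

/-- The augmentation `ε` sends a gcd `d` of two constants to a common divisor `ε d`. As the sum of
the coefficients of `d`, it has value at least the minimum. -/
theorem DivFamily.hasMin_constFamily : HasMin (WSP.constFamily V) := by
  intro a b ha hb
  obtain ⟨d, hd, hdv⟩ := hm _ _ (monC_notMem (H := H) ha) (monC_notMem (H := H) hb)
  let ε : AddMonoidAlgebra R H →ₐ[R] R := AddMonoidAlgebra.lift R R H 1
  have hε : ∀ h r, ε (AddMonoidAlgebra.single h r) = r := fun h r => by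
    simp [ε, AddMonoidAlgebra.lift_single]
  have hda : monC H (ε d) ∣ monC H a := by
    have h1 : d ∣ monC H a := hV.dvd_of_le _ _ hd fun v hv => (hdv v hv).trans_le (min_le_left _ _)
    obtain ⟨q, hq⟩ := _root_.map_dvd ε h1
    rw [hε] at hq
    rw [hq, monC_mul]
    exact dvd_mul_right _ _
  have hdb : monC H (ε d) ∣ monC H b := by
    have h1 : d ∣ monC H b :=
      hV.dvd_of_le _ _ hd fun v hv => (hdv v hv).trans_le (min_le_right _ _)
    obtain ⟨q, hq⟩ := _root_.map_dvd ε h1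
    rw [hε] at hq
    rw [hq, monC_mul]
    exact dvd_mul_right _ _
  refine ⟨ε d, ?_, ?_⟩
  · rw [notMem_zeroElts_ring]
    intro h0
    rw [h0] at hda
    exact notMem_zeroElts_of_dvd hda (monC_notMem ha) (by simp [zeroElts_ring])
  · rintro _ ⟨v, hv, rfl⟩
    refine le_antisymm (le_min (hV.le_of_dvd hv hda) (hV.le_of_dvd hv hdb)) ?_
    have hs : monC H (ε d) = ∑ k ∈ d.coeff.support, monC H (d.coeff k) := by
      conv_lhs => rw [← AddMonoidAlgebra.sum_coeff_single d, Finsupp.sum, _root_.map_sum]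
      simp only [hε]
      exact _root_.map_sum (AddMonoidAlgebra.singleAddHom (0 : H)) _ _
    change _ ≤ v (monC H (ε d))
    rw [hs]
    exact hV.le_map_sum hv _ _ _ fun k _ =>
      hV.le_monC_coeff ha hb (fun w hw => (hdv w hw).ge) hv k

/-- Let `d * q` be the monomial of `a`, and write `a = e + k` with `e` in the support of `d` and `k`
in that of `q`. Since the monomial of `a` divides that of `b` times `q`, the exponent `b + k` lies
in `a + H`; cancelling `k` makes `e` a common divisor of `a` and `b`. -/
theorem DivFamily.hasMin_expFamily [Nontrivial H] : HasMin (WSP.expFamily V) := by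
  classical
  intro a' b' _ _
  obtain ⟨a, rfl⟩ := Multiplicative.ofAdd.surjective a'
  obtain ⟨b, rfl⟩ := Multiplicative.ofAdd.surjective b'
  obtain ⟨d, hd, hdv⟩ := hm _ _ (monX_notMem (R := R) a) (monX_notMem (R := R) b)
  obtain ⟨q, hq⟩ : d ∣ monX R a :=
    hV.dvd_of_le _ _ hd fun v hv => (hdv v hv).trans_le (min_le_left _ _)
  have hbq : monX R a ∣ monX R b * q := hV.dvd_of_le _ _ (monX_notMem a) fun v hv => by
    have h1 := hV.map_mul v hv d q
    rw [← hq, hdv v hv] at h1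
    rw [hV.map_mul v hv, h1]
    exact add_le_add (min_le_right _ _) le_rfl
  have ha : a ∈ (d * q).coeff.support := by
    rw [← hq]
    simp [AddMonoidAlgebra.coeff_single]
  obtain ⟨e, he, k, hk, rfl⟩ := Finset.mem_add.1 (AddMonoidAlgebra.support_coeff_mul_subset _ _ ha)
  obtain ⟨l, hl⟩ := exists_of_monX_dvd hbq (k := b + k) (by
    rw [Finsupp.mem_support_iff, coeff_monX_mul]
    exact Finsupp.mem_support_iff.1 hk)
  refine ⟨Multiplicative.ofAdd e, by rw [zeroElts_cancel]; simp, ?_⟩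
  rintro _ ⟨v, hv, rfl⟩
  have hb : b = e + l := add_right_cancel (b := k) (hl.trans (by abel))
  refine le_antisymm (le_min (hV.le_of_dvd hv ?_) (hV.le_of_dvd hv ?_))
    (hV.le_monX (fun w hw => (hdv w hw).ge) hv he)
  · simp only [toAdd_ofAdd, monX_add]
    exact dvd_mul_right _ _
  · simp only [toAdd_ofAdd, hb, monX_add]
    exact dvd_mul_right _ _

end Descent

section Ascent

variable [Nontrivial H] {B : Type*} [CommMonoid B] [IsCancelOffZero B]
  {ι : AddMonoidAlgebra R H →* B} {V₁ : Set (R → ℕ∞)} {V₂ : Set (Multiplicative H → ℕ∞)}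
  {V₃ : Set (B → ℕ∞)}

/-- Lift a gcd from `B` to `R[H]`, divide it by a monomial with the same content, and multiply by a
monomial whose content is the minimum of those of `a` and `b`. Monomials are units in `B`, so the
values there stay right. -/
theorem HasMin.monoidRing (h₁ : DivFamily V₁) (h₂ : DivFamily V₂) (h₃ : DivFamily V₃)
    (hι : IsLoc (monomials R H) ι) (hB : HasSG B) (hm₁ : HasMin V₁) (hm₂ : HasMin V₂) :
    HasMin (ringVal ι '' ringIndex V₁ V₂ V₃) := by
  classical
  intro a b ha hb
  have h₁' := h₁.toPreDivFamily
  have h₂' := h₂.toPreDivFamily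
  have h₃' := h₃.toPreDivFamily
  have hmul := ringVal_mul h₁' h₂' h₃' (ι := ι)
  have htop := ringVal_eq_top h₁' h₂' h₃' hι
  have hιz : ∀ {x}, x ∉ zeroElts (AddMonoidAlgebra R H) → ι x ∉ zeroElts B :=
    fun hx h => hx (hι.mem_zeroElts_iff.1 h)
  have ha' := notMem_zeroElts_ring.1 ha
  have hb' := notMem_zeroElts_ring.1 hb
  obtain ⟨r, hr, hrv⟩ := hm₁.exists_eq ((rep_gval_const h₁' ha').min (rep_gval_const h₁' hb'))
  obtain ⟨h, -, hhv⟩ := hm₂.exists_eq ((rep_gval_exp h₂' ha').min (rep_gval_exp h₂' hb'))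
  obtain ⟨q, hq⟩ := hB _ _ (hιz ha) (hιz hb)
  have hq0 : q ∉ zeroElts B := hq.notMem_zeroElts (t := ι a) (by simp) (hιz ha)
  have hqv : ∀ v ∈ V₃, v q = min (v (ι a)) (v (ι b)) := fun v hv => by
    have := h₃.inf_eq_of_isSG (T := {ι a, ι b}) (by simp) (by simp [hιz ha, hιz hb])
      (d := q) (by simpa using hq) hv
    rw [← this]
    simp
  obtain ⟨x, hx⟩ := hι.exists_associated q
  have hx0 : x ∉ zeroElts (AddMonoidAlgebra R H) := fun h =>
    hq0 (mem_zeroElts_of_dvd hx.symm.dvd (hι.mem_zeroElts_iff.2 h))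
  have hxn := notMem_zeroElts_ring.1 hx0
  obtain ⟨s, hs, hsv⟩ := hm₁.exists_eq (rep_gval_const h₁' hxn)
  obtain ⟨k, -, hkv⟩ := hm₂.exists_eq (rep_gval_exp h₂' hxn)
  have hs0 := notMem_zeroElts_ring.1 hs
  have hr0 := notMem_zeroElts_ring.1 hr
  obtain ⟨y, rfl⟩ : AddMonoidAlgebra.single k.toAdd s ∣ x :=
    single_dvd h₁' h₂' hs0 (fun v hv => (hsv v hv).le) fun v hv => (hkv v hv).le
  have hy0 : y ∉ zeroElts (AddMonoidAlgebra R H) := notMem_zeroElts_of_dvd (dvd_mul_left _ _) hx0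
  have hz0 : AddMonoidAlgebra.single h.toAdd r * y ∉ zeroElts (AddMonoidAlgebra R H) :=
    mul_notMem_zeroElts (notMem_zeroElts_ring.2 (AddMonoidAlgebra.single_ne_zero.2 hr0)) hy0
  refine ⟨_, hz0, Set.forall_mem_image.2 (forall_ringIndex.2
    ⟨fun v hv => ?_, fun v hv => ?_, fun v hv => ?_⟩)⟩
  · have hu := h₁'.gradedVal_const (H := H) hv
    have e := hsv v hv
    simp only [hu.gval_mul, hu.gval_single] at e
    have hy : gval (fun _ => v) y = 0 := by
      have h2 := h₁'.ne_top hv hs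
      exact (WithTop.add_left_cancel h2 ((add_zero _).trans e)).symm
    simp only [ringVal]
    rw [hu.gval_mul, hu.gval_single, hy, add_zero, hrv v hv]
  · have hu := h₂'.gradedVal_exp (R := R) hv
    have e := hkv v hv
    simp only [hu.gval_mul, hu.gval_single, expVal_of_ne_zero _ _ hs0, ofAdd_toAdd] at e
    have hy : gval (expVal R v) y = 0 := by
      have h2 := h₂'.ne_top hv (a := k) (by rw [zeroElts_cancel]; simp)
      exact (WithTop.add_left_cancel h2 ((add_zero _).trans e)).symm
    simp only [ringVal]
    rw [hu.gval_mul, hu.gval_single, hy, add_zero, expVal_of_ne_zero _ _ hr0, ofAdd_toAdd,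
      hhv v hv]
  · simp only [ringVal]
    have e : v q = v (ι y) := by
      rw [le_antisymm (h₃'.le_of_dvd hv hx.dvd) (h₃'.le_of_dvd hv hx.symm.dvd), _root_.map_mul,
        h₃'.map_mul v hv, map_single_eq_zero h₃' hι hv _ hs0, zero_add]
    rw [_root_.map_mul, h₃'.map_mul v hv, map_single_eq_zero h₃' hι hv _ hr0, zero_add, ← e,
      hqv v hv]

end Ascent

end MonoidRing

/-! ### Assembling both equivalences -/

section Main

variable {R H K G : Type*} [CommRing R] [IsDomain R] [AddCancelCommMonoid H] [IsAddTorsionFree H]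
  [Nontrivial H] [Field K] [Algebra R K] [IsFractionRing R K] [AddCommGroup G]

theorem localizationMap_injective (f : (⊤ : AddSubmonoid H).LocalizationMap G) :
    Function.Injective f := by
  intro x y h
  obtain ⟨c, hc⟩ := f.eq_iff_exists.1 h
  exact add_left_cancel hc

theorem isAddTorsionFree_of_localizationMap (f : (⊤ : AddSubmonoid H).LocalizationMap G) :
    IsAddTorsionFree G where
  nsmul_right_injective n hn x y hxy := by
    obtain ⟨⟨a, b⟩, hx⟩ := f.surj x
    obtain ⟨⟨c, d⟩, hy⟩ := f.surj y
    simp only at hx hy hxy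
    have h1 : n • (a + d) = n • (c + b) := by
      apply localizationMap_injective f
      rw [_root_.map_nsmul, _root_.map_nsmul, _root_.map_add, _root_.map_add, ← hx, ← hy]
      simp only [nsmul_add, hxy]
      abel
    have h2 := congrArg f (nsmul_right_injective hn h1)
    rw [_root_.map_add, _root_.map_add, ← hx, ← hy] at h2
    have h3 : x + (f b + f d) = y + (f b + f d) := by
      rw [← add_assoc, h2]; abel
    exact add_right_cancel h3

theorem exists_isLoc (f : (⊤ : AddSubmonoid H).LocalizationMap G) [IsAddTorsionFree G] :
    ∃ ι : AddMonoidAlgebra R H →* AddMonoidAlgebra K G, IsLoc (monomials R H) ι := by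
  refine ⟨_, isLoc_incl (f := algebraMap R K) (φ := (f : H →+ G)) (IsFractionRing.injective R K)
    (localizationMap_injective f) (fun c => ?_) fun g => ?_⟩
  · obtain ⟨⟨r, d⟩, h⟩ := IsLocalization.surj (nonZeroDivisors R) c
    exact ⟨r, d, nonZeroDivisors.ne_zero d.2, by rw [mul_comm]; exact h⟩
  · obtain ⟨⟨a, b⟩, h⟩ := f.surj g
    exact ⟨b, a, by rw [add_comm]; exact h⟩

variable (R K) in
theorem isWSP_monoidRing_iff (f : (⊤ : AddSubmonoid H).LocalizationMap G) :
    IsWSP (AddMonoidAlgebra R H) ↔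
      IsWSP R ∧ IsWSP (Multiplicative H) ∧ IsRadicalFactorial (AddMonoidAlgebra K G) := by
  have := isAddTorsionFree_of_localizationMap f
  obtain ⟨ι, hι⟩ := exists_isLoc (R := R) (K := K) f
  have hB := hasSG_groupRing K G
  constructor
  · intro h
    have hV := h.divFamily
    exact ⟨hV.constFamily.isWSP, hV.expFamily.isWSP, hV.isRadicalFactorial hι hB⟩
  · rintro ⟨h₁, h₂, h₃⟩
    exact (DivFamily.monoidRing hι h₁.divFamily h₂.divFamily (hB.divFamily h₃)).isWSP

variable (R K) in
theorem isWBezout_monoidRing_iff (f : (⊤ : AddSubmonoid H).LocalizationMap G) :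
    (IsWBezout (AddMonoidAlgebra R H) ∧ IsWSP (AddMonoidAlgebra R H)) ↔
      (IsWBezout R ∧ IsWSP R) ∧ (IsWBezout (Multiplicative H) ∧ IsWSP (Multiplicative H)) ∧
        IsRadicalFactorial (AddMonoidAlgebra K G) := by
  have := isAddTorsionFree_of_localizationMap f
  obtain ⟨ι, hι⟩ := exists_isLoc (R := R) (K := K) f
  have hB := hasSG_groupRing K G
  constructor
  · rintro ⟨hb, h⟩
    have hV := h.divFamily
    have hm : HasMin (valSet (AddMonoidAlgebra R H)) := hV.isWBezout_iff.1 hb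
    obtain ⟨h₁, h₂, h₃⟩ := (isWSP_monoidRing_iff R K f).1 h
    exact ⟨⟨hV.constFamily.isWBezout_iff.2 (hV.hasMin_constFamily hm), h₁⟩,
      ⟨hV.expFamily.isWBezout_iff.2 (hV.hasMin_expFamily hm), h₂⟩, h₃⟩
  · rintro ⟨⟨hb₁, h₁⟩, ⟨hb₂, h₂⟩, h₃⟩
    have hV₁ := h₁.divFamily
    have hV₂ := h₂.divFamily
    have hV₃ := hB.divFamily h₃
    exact ⟨(DivFamily.monoidRing hι hV₁ hV₂ hV₃).isWBezout_iff.2 (HasMin.monoidRing hV₁ hV₂ hV₃ hι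
      hB (hV₁.isWBezout_iff.1 hb₁) (hV₂.isWBezout_iff.1 hb₂)),
      (isWSP_monoidRing_iff R K f).2 ⟨h₁, h₂, h₃⟩⟩

end Main

end WSP

theorem proposition6p4 {R H K G : Type*}
    [CommRing R] [IsDomain R]
    [AddCancelCommMonoid H] [IsAddTorsionFree H] [Nontrivial H]
    [Field K] [Algebra R K] [IsFractionRing R K]
    [AddCommGroup G] (_f : (⊤ : AddSubmonoid H).LocalizationMap G) :
    (WSP.IsWSP (AddMonoidAlgebra R H) ↔
      WSP.IsWSP R ∧ WSP.IsWSP (Multiplicative H) ∧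
        WSP.IsRadicalFactorial (AddMonoidAlgebra K G)) ∧
    ((WSP.IsWBezout (AddMonoidAlgebra R H) ∧ WSP.IsWSP (AddMonoidAlgebra R H)) ↔
      (WSP.IsWBezout R ∧ WSP.IsWSP R) ∧
        (WSP.IsWBezout (Multiplicative H) ∧ WSP.IsWSP (Multiplicative H)) ∧
        WSP.IsRadicalFactorial (AddMonoidAlgebra K G)) :=
  ⟨WSP.isWSP_monoidRing_iff R K _f, WSP.isWBezout_monoidRing_iff R K _f⟩
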